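/- **Setting.** Let $\kappa\in\{0,1,2,\dots\}$, $\theta\in(0,1)$ and let $(q_i)_{i\in\mathbb Z}$ be non-negative reals with $q_i=1$ for $i>\kappa$ and $\sum_{i\in\mathbb Z}q_i\theta^i<\infty$. Put $\alpha=(\sum_i\theta^iq_i)^{-1}$ and $a(w)=\sum_{i\le\kappa}(q_{i+1}-q_i)w^i$. Let $\psi$ be a complex function. Suppose that there are radii $0<r<\theta<1<\bar r$ such that $a$ is (extends to be) analytic on $\{|w|\ge r\}$, $\psi$ is analytic on the closed annulus $A_{r,\bar r}=\{r\le|w|\le\bar r\}$, and $a,\psi$ have no zeros on $A_{r,\bar r}$ (analytic on a closed set means analytic on a neighbourhood of it). Let $\gamma_\rho$ be the positively oriented circle of radius $\rho$ about $0$. Kernels $\mathbb Z\times\mathbb Z\to\mathbb C$ are composed by $KL(x,y)=\sum_zK(x,z)L(z,y)$ (absolutely convergent sums), and $K^*(x,y)=K(y,x)$. Define $$Q(x,y)=\alpha\theta^{x-y}q_{x-y},\qquad A(x,y)=\alpha\theta^{x-y}(q_{x-y+1}-q_{x-y}),\qquad \mathcal R(x,y)=\frac1{2\pi i}\oint_{\gamma_r}\frac{\theta^{x-y}}{w^{x-y+1}}\psi(w)\,dw,$$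 and let $Q^{-1},A^{-1},\mathcal R^{-1}$ be the kernels $\frac1{2\pi i}\oint_{\gamma_r}\frac{\theta^{x-y}}{w^{x-y+1}}\phi(w)\,dw$ with $\phi(w)=\frac{1-w}{\alpha\,w\,a(w)}$, $\frac1{\alpha\,a(w)}$, $\frac1{\psi(w)}$ respectively. For $\ell\ge1$ let $$\bar Q^{(\ell)}=A^\ell\bar Q_0^{(\ell)},\qquad \bar Q_0^{(\ell)}(x,y)=\frac{\theta^{x-y}}{(\ell-1)!}\prod_{i=0}^{\ell-2}(x-y-1-i).$$ Fix $\bar n\ge1$ and $y\in\mathbb Z^{\bar n}$ with $y_j-y_{j+1}\ge\kappa$ for $1\le j<\bar n$. For $1\le n\le\bar n$ and $n-\bar n\le k\le n-1$ let $\Psi^n_k(x)=\mathcal RQ^{-k}(x,y_{n-k})$. Let $B$ be the random walk on $\mathbb Z$ with transition matrix $Q$ and, given $n$, let $\tau=\min\{m\in\{0,\dots,n-1\}:B_m>y_{m+1}\}$ ($\tau=\infty$ if there is no such $m$). **Theorem.** (a) $Q^{-1},A^{-1},\mathcal R^{-1}$ are two-sided inverses of $Q,A,\mathcal R$; all sums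 defining the inverse identities, the powers $Q^m,(Q^{-1})^m,A^m$ ($m\ge0$) and the products $\mathcal RQ^{-k}$ ($k\in\mathbb Z$) converge absolutely, and $$\mathcal RQ^{-k}(x,y)=\frac{\alpha^{-k}}{2\pi i}\oint_{\gamma_r}\frac{\theta^{x-y}}{w^{x-y+k+1}}\Big(\frac{1-w}{a(w)}\Big)^k\psi(w)\,dw .$$ (b) For $1\le n\le\bar n$ and $0\le k<n$ there is exactly one $\Phi^n_k:\mathbb Z\to\mathbb C$ such that $\theta^x\Phi^n_k(x)$ is a polynomial of degree $k$ in $x$ and $\sum_{x\in\mathbb Z}\Psi^n_\ell(x)\Phi^n_k(x)=\mathbf 1_{\ell=k}$ (absolutely convergent) for $\ell=0,\dots,n-1$. (c) For $1\le n\le\bar n$ and every $r'\in[r,1)$, $$\mathcal S_{-n}(z_1,z_2):=\frac{\alpha^{-n+1}}{2\pi i}\oint_{\gamma_{r'}}\frac{\theta^{z_2-z_1}}{w^{z_2-z_1+n+1}}\frac{(1-w)^n}{a(w)^{n-1}}\psi(w)\,dw=(\mathcal RQ^{-n}A)^*(z_1,z_2).$$ (d) Let $\delta\in(0,1)$ be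 such that $a(1-w)$ and $1/\psi(1-w)$ are analytic on $\{|w|\le\delta\}$. For $1\le n\le\bar n$, $$\bar{\mathcal S}_n(z_1,z_2):=\frac{\alpha^{n-1}}{2\pi i}\oint_{\gamma_\delta}\frac{(1-w)^{z_2-z_1+n-1}}{\theta^{z_2-z_1}w^n}\frac{a(1-w)^{n-1}}{\psi(1-w)}\,dw=\bar Q^{(n)}\mathcal R^{-1}A^{-1}(z_1,z_2).$$ The sums defining the products in (c), (d) converge absolutely. (e) With $\delta$ as in (d), $\bar{\mathcal S}_{n-\tau}(B_\tau,z_2)\mathbf 1_{\tau<n}$ is integrable for the walk started at any $z_1$. Put $$\bar{\mathcal S}^{\mathrm{epi}(y)}_n(z_1,z_2)=\mathbb E_{B_0=z_1}\big[\bar{\mathcal S}_{n-\tau}(B_\tau,z_2)\mathbf 1_{\tau<n}\big].$$ Then, for all $n_i,n_j\in\{1,\dots,\bar n\}$ and $x_i,x_j\in\mathbb Z$, the kernel $$K(n_i,x_i;n_j,x_j)=-Q^{n_j-n_i}(x_i,x_j)\mathbf 1_{n_i<n_j}+\sum_{k=1}^{n_j}\Psi^{n_i}_{n_i-k}(x_i)\Phi^{n_j}_{n_j-k}(x_j)$$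 satisfies $$K(n_i,x_i;n_j,x_j)=-Q^{n_j-n_i}(x_i,x_j)\mathbf 1_{n_i<n_j}+(\mathcal S_{-n_i})^*\bar{\mathcal S}^{\mathrm{epi}(y)}_{n_j}(x_i,x_j),$$ where the last composition is an absolutely convergent sum and the contour radius in $\mathcal S_{-n_i}$ may be any $r'\in[r,1)$. -/

import Mathlib

noncomputable section

namespace EpiKernel

/-! Kernels on `ℤ` and their compositions. -/

/-- Composition `K L (x, y) = ∑_z K(x, z) L(z, y)`; meaningful when `Composable K L` holds. -/
def comp (K L : ℤ → ℤ → ℂ) : ℤ → ℤ → ℂ := fun x y => ∑' z : ℤ, K x z * L z y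

/-- All the sums that define `comp K L` converge absolutely (in `ℂ` summability is absolute). -/
def Composable (K L : ℤ → ℤ → ℂ) : Prop := ∀ x y : ℤ, Summable fun z : ℤ => K x z * L z y

/-- The identity kernel. -/
def idKer : ℤ → ℤ → ℂ := fun x y => if x = y then 1 else 0

/-- Iterated composition: the power `K ^ m` of a kernel, `m ≥ 0`. -/
def kpow (K : ℤ → ℤ → ℂ) : ℕ → ℤ → ℤ → ℂ
  | 0 => idKer
  | m + 1 => comp (kpow K m) K

/-- The adjoint kernel (the transpose, without complex conjugation). -/
def adj (K : ℤ → ℤ → ℂ) : ℤ → ℤ → ℂ := fun x y => K y x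

/-- `L` is a two-sided inverse of `K`, with absolutely convergent sums. -/
def IsInverse (K L : ℤ → ℤ → ℂ) : Prop :=
  Composable K L ∧ Composable L K ∧ comp K L = idKer ∧ comp L K = idKer

/-- The closed annulus `r ≤ |w| ≤ R`. -/
def annulus (r R : ℝ) : Set ℂ := {w | r ≤ ‖w‖ ∧ ‖w‖ ≤ R}

/-- The kernel `(1 / 2πi) ∮_{|w| = ρ} θ^(x-y) w^(-(x-y+1)) φ(w) dw`. -/
def contourKer (θ ρ : ℝ) (φ : ℂ → ℂ) : ℤ → ℤ → ℂ := fun x y =>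
  (2 * Real.pi * Complex.I)⁻¹ *
    ∮ w in C(0, ρ), (θ : ℂ) ^ (x - y) / w ^ (x - y + 1) * φ w

/-! The kernels built from the weights `q`, the functions `a` and `ψ`, and the parameter `θ`. -/

/-- The normalization `α = (∑_i θ^i q_i)⁻¹`. -/
def alpha (θ : ℝ) (q : ℤ → ℝ) : ℝ := (∑' i : ℤ, q i * θ ^ i)⁻¹

/-- The transition matrix `Q(x, y) = α θ^(x-y) q_(x-y)`, as a real matrix. -/
def stepProb (θ : ℝ) (q : ℤ → ℝ) (x y : ℤ) : ℝ := alpha θ q * θ ^ (x - y) * q (x - y)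

/-- `Q` as a complex kernel. -/
def Qker (θ : ℝ) (q : ℤ → ℝ) : ℤ → ℤ → ℂ := fun x y => (stepProb θ q x y : ℂ)

/-- `A(x, y) = α θ^(x-y) (q_(x-y+1) - q_(x-y))`. -/
def Aker (θ : ℝ) (q : ℤ → ℝ) : ℤ → ℤ → ℂ := fun x y =>
  ((alpha θ q * θ ^ (x - y) * (q (x - y + 1) - q (x - y)) : ℝ) : ℂ)

/-- The kernel `Q⁻¹`: the contour integral of
`α⁻¹ θ^(x-y) w^(-(x-y+2)) (1 - w) / a(w)` over `|w| = r`. -/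
def Qinv (θ : ℝ) (q : ℤ → ℝ) (a : ℂ → ℂ) (r : ℝ) : ℤ → ℤ → ℂ :=
  contourKer θ r fun w => (alpha θ q : ℂ)⁻¹ * ((1 - w) / (w * a w))

/-- The kernel `A⁻¹`. -/
def Ainv (θ : ℝ) (q : ℤ → ℝ) (a : ℂ → ℂ) (r : ℝ) : ℤ → ℤ → ℂ :=
  contourKer θ r fun w => (alpha θ q : ℂ)⁻¹ * (1 / a w)

/-- The kernel `R`. -/
def Rker (θ : ℝ) (ψ : ℂ → ℂ) (r : ℝ) : ℤ → ℤ → ℂ := contourKer θ r ψ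

/-- The kernel `R⁻¹`. -/
def Rinv (θ : ℝ) (ψ : ℂ → ℂ) (r : ℝ) : ℤ → ℤ → ℂ := contourKer θ r fun w => 1 / ψ w

/-- Integer powers of `Q`; the negative ones are powers of `Q⁻¹`. -/
def Qpow (θ : ℝ) (q : ℤ → ℝ) (a : ℂ → ℂ) (r : ℝ) : ℤ → ℤ → ℤ → ℂ
  | Int.ofNat m => kpow (Qker θ q) m
  | Int.negSucc m => kpow (Qinv θ q a r) (m + 1)

/-- `R Q^k`. -/
def RQpow (θ : ℝ) (q : ℤ → ℝ) (a ψ : ℂ → ℂ) (r : ℝ) (k : ℤ) : ℤ → ℤ → ℂ :=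
  comp (Rker θ ψ r) (Qpow θ q a r k)

/-- `θ^(x-y) (x-y-1)(x-y-2)⋯(x-y-ℓ+1) / (ℓ-1)!`, for `ℓ ≥ 1`. -/
def Qbar0 (θ : ℝ) (l : ℕ) : ℤ → ℤ → ℂ := fun x y =>
  (θ : ℂ) ^ (x - y) * (∏ i ∈ Finset.range (l - 1), ((x - y - 1 - i : ℤ) : ℂ)) /
    (Nat.factorial (l - 1) : ℂ)

/-- The extension `A^ℓ Qbar0^(ℓ)` of `Q^ℓ`, for `ℓ ≥ 1`. -/
def Qbar (θ : ℝ) (q : ℤ → ℝ) (l : ℕ) : ℤ → ℤ → ℂ := comp (kpow (Aker θ q) l) (Qbar0 θ l)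

/-- `S_{-n}`, as a contour integral over `|w| = ρ`. -/
def Sneg (θ : ℝ) (q : ℤ → ℝ) (a ψ : ℂ → ℂ) (ρ : ℝ) (n : ℕ) : ℤ → ℤ → ℂ := fun z₁ z₂ =>
  (alpha θ q : ℂ) ^ (-(n : ℤ) + 1) * (2 * Real.pi * Complex.I)⁻¹ *
    ∮ w in C(0, ρ), (θ : ℂ) ^ (z₂ - z₁) / w ^ (z₂ - z₁ + n + 1) *
      ((1 - w) ^ n / a w ^ ((n : ℤ) - 1)) * ψ w

/-- `Sbar_n`, as a contour integral over `|w| = δ`. -/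
def Sbar (θ : ℝ) (q : ℤ → ℝ) (a ψ : ℂ → ℂ) (δ : ℝ) (n : ℕ) : ℤ → ℤ → ℂ := fun z₁ z₂ =>
  (alpha θ q : ℂ) ^ ((n : ℤ) - 1) * (2 * Real.pi * Complex.I)⁻¹ *
    ∮ w in C(0, δ), (1 - w) ^ (z₂ - z₁ + n - 1) / ((θ : ℂ) ^ (z₂ - z₁) * w ^ n) *
      (a (1 - w) ^ ((n : ℤ) - 1) / ψ (1 - w))

/-! The biorthogonalization problem and the kernel `K`. -/

/-- `Ψ^n_k(x) = R Q^{-k}(x, y_{n-k})`, for `1 ≤ n ≤ N` and `n - N ≤ k ≤ n - 1`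
(so that `1 ≤ n - k ≤ N`), where `N` is the number of entries of `y`. -/
def Psi (θ : ℝ) (q : ℤ → ℝ) (a ψ : ℂ → ℂ) (r : ℝ) (y : ℕ → ℤ) (n : ℕ) (k : ℤ) (x : ℤ) : ℂ :=
  RQpow θ q a ψ r (-k) x (y ((n : ℤ) - k).toNat)

/-- `φ = Φ^n_k` solves the biorthogonalization problem: `θ^x φ(x)` is a polynomial of degree `k`,
and `∑_x Ψ^n_ℓ(x) φ(x) = 1_{ℓ = k}` for `ℓ = 0, …, n - 1`. -/
def IsBiorth (θ : ℝ) (Ψ : ℕ → ℤ → ℤ → ℂ) (n k : ℕ) (φ : ℤ → ℂ) : Prop :=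
  (∃ p : Polynomial ℂ, p.degree = (k : WithBot ℕ) ∧
    ∀ x : ℤ, (θ : ℂ) ^ x * φ x = p.eval (x : ℂ)) ∧
  ∀ l : ℕ, l < n → HasSum (fun x : ℤ => Ψ n l x * φ x) (if l = k then 1 else 0)

/-- The extended kernel `K(nᵢ, xᵢ; nⱼ, xⱼ)`. -/
def Kext (Q : ℤ → ℤ → ℂ) (Ψ : ℕ → ℤ → ℤ → ℂ) (Φ : ℕ → ℕ → ℤ → ℂ)
    (ni : ℕ) (xi : ℤ) (nj : ℕ) (xj : ℤ) : ℂ :=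
  -(if ni < nj then kpow Q (nj - ni) xi xj else 0) +
    ∑ k ∈ Finset.Icc 1 nj, Ψ ni ((ni : ℤ) - k) xi * Φ nj (nj - k) xj

/-! The random walk and its hitting time. -/

/-- Under `P z`, the process `B` is the Markov chain on `ℤ` with transition matrix `p` started
at `z`. -/
structure IsWalk {Ω : Type*} [MeasurableSpace Ω] (p : ℤ → ℤ → ℝ) (P : ℤ → MeasureTheory.Measure Ω)
    (B : ℕ → Ω → ℤ) : Prop where
  prob : ∀ z, MeasureTheory.IsProbabilityMeasure (P z)
  meas : ∀ m, Measurable (B m)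
  law : ∀ (z : ℤ) (m : ℕ) (x : ℕ → ℤ), (P z).real {ω | ∀ i ≤ m, B i ω = x i} =
    if x 0 = z then ∏ i ∈ Finset.range m, p (x i) (x (i + 1)) else 0

/-- `τ = min {m = 0, …, n - 1 : b_m > y_{m+1}}`, and `τ = ∞` if there is no such `m`. -/
def hitTime (y : ℕ → ℤ) (n : ℕ) (b : ℕ → ℤ) : ℕ∞ :=
  ⨅ (m : ℕ) (_ : m < n ∧ y (m + 1) < b m), (m : ℕ∞)

/-- The random variable `S_{n-τ}(B_τ, z₂) 1_{τ < n}`, for a family of kernels `S`, on the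
trajectory `b` of the walk. -/
def epiIntegrand (S : ℕ → ℤ → ℤ → ℂ) (y : ℕ → ℤ) (n : ℕ) (z₂ : ℤ) (b : ℕ → ℤ) : ℂ :=
  if hitTime y n b < (n : ℕ∞) then
    S (n - (hitTime y n b).toNat) (b (hitTime y n b).toNat) z₂
  else 0

/-- `S^{epi(y)}_n(z₁, z₂) = E_{B_0 = z₁} [S_{n-τ}(B_τ, z₂) 1_{τ < n}]`. -/
def Sepi {Ω : Type*} [MeasurableSpace Ω] (P : ℤ → MeasureTheory.Measure Ω) (B : ℕ → Ω → ℤ)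
    (S : ℕ → ℤ → ℤ → ℂ) (y : ℕ → ℤ) (n : ℕ) : ℤ → ℤ → ℂ := fun z₁ z₂ =>
  ∫ ω, epiIntegrand S y n z₂ (fun m => B m ω) ∂(P z₁)

end EpiKernel

end

open EpiKernel

/-! Up to the conjugation by θ^(x-y), all the kernels `Q`, `A`, `R` and their inverses are
convolutions, determined by a symbol on a circle about 0: 1/s(w) for `Q` with s(w) = (1-w)/(α w
a(w)) (`invSym`), α a(w) for `A` (`aSym`), ψ(w) for `R`. Composition multiplies symbols, and
Cauchy's theorem moves the contours. This settles inverses, powers and `S_{-n}`. A second family,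
`resKer`, integrates over a small circle about w = 1, in the variable 1 - w. Its members are θ^(x-y)
times polynomials when the symbol has a pole, and composing with a convolution again multiplies the
symbols. This covers `Qbar` and `Sbar`.

Biorthogonalization. Summing Ψ_l against θ^(-x) p_s(x), where (1-w)^x = ∑ p_s(x) w^s, is a residue
at w = 0 of w^(-s-1) s(1-w)^l ψ(1-w) (1-w)^y. Since s(1-w) has a simple zero at 0, it vanishes for s
< l and not for s = l. The system is triangular, so `Φ` exists and is unique.

Kernel formula. Fix n and put v_j = y_(n-j). By the Markov property the expectation equals h_n,
where h_0 = 0 and h_(j+1)(z) is Sbar_(j+1)(z,u) if z > v_j and (Q h_j)(z) otherwise (`hrec`,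
`IsWalk.integral_epiIntegrand`). Let D f(z) = θ⁻¹ f(z+1) - f(z) (`tdiff`). Then D Q = A, D Sbar_1 =
0 and D Sbar_(j+1) = A Sbar_j. Hence D h_(j+1) = A h_j except at z = v_j, where there is a jump
c_j(u). This is `tdiff_hrec`; it uses that A(z,b) = 0 for z - b > κ and that the barrier rises by at
least κ from v_j to v_(j+1). As s(w) α a(w) = 1/w - 1, summation by parts gives R Q^(-k) A f = R
Q^(-(k-1)) D f. Iterating it from h_n down to h_0 = 0 leaves ∑_j R Q^(-(k-n+j))(x, v_j) c_j(u)
(`kact_RQpow_A_telescope`). For k = n_i and n = n_j this is ∑ Ψ c_j, so it remains to identify the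
jump c_j with Φ^n_j.

First, θ^u c_j(u) is a polynomial of degree at most j: Sbar_(j+1) has this property, and the
recursion preserves it (`isPolyLT_hrec`). Second, the recursion is linear, so summing against Ψ_l
replaces Sbar_(j+1)(z,u) by its composition with R Q^(-l), which is zero for j < l and extends A⁻¹
Q^(j-l+1) otherwise. With such data the recursion returns A⁻¹ Q^(s+1) itself at step l + s + 1
(`hrec_resKer`), and since D A⁻¹ Q^(s+2) = A A⁻¹ Q^(s+1), its only jump is at j = l and equals 1
(`jump_resKer`). Uniqueness of `Φ` concludes. -/

namespace EpiKernel

open scoped Real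
open Metric Set Complex

noncomputable section

/-! ### Laurent coefficients -/

/-- The Laurent coefficient `(1 / 2πi) ∮_{|w| = ρ} φ(w) w^(-(m+1)) dw`. -/
def laurentCoeff (φ : ℂ → ℂ) (ρ : ℝ) (m : ℤ) : ℂ :=
  (2 * π * I)⁻¹ * ∮ w in C(0, ρ), φ w / w ^ (m + 1)

/-- On the circle `|w| = ρ`, `φ` is the sum of the absolutely convergent series `∑ c_m w^m`. -/
structure HasLaurent (φ : ℂ → ℂ) (ρ : ℝ) (c : ℤ → ℂ) : Prop where
  summable : Summable fun m : ℤ => ‖c m‖ * ρ ^ m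
  hasSum : ∀ w : ℂ, ‖w‖ = ρ → HasSum (fun m : ℤ => c m * w ^ m) (φ w)

theorem contourKer_eq (θ ρ : ℝ) (φ : ℂ → ℂ) (x y : ℤ) :
    contourKer θ ρ φ x y = (θ : ℂ) ^ (x - y) * laurentCoeff φ ρ (x - y) := by
  unfold contourKer laurentCoeff
  rw [mul_left_comm, ← circleIntegral.integral_const_mul ((θ : ℂ) ^ (x - y))]
  congr 2
  funext w
  ring

/-- Dominated convergence on the circle. Every composition formula below comes from expanding one
symbol in a series and integrating term by term with it. -/
theorem hasSum_circleIntegral {ι : Type*} [Countable ι] {F : ι → ℂ → ℂ} {f : ℂ → ℂ} {ρ : ℝ}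
    (hρ : 0 ≤ ρ) (hF : ∀ i, ContinuousOn (F i) (sphere 0 ρ)) (bound : ι → ℝ)
    (hb : Summable bound) (hFb : ∀ i, ∀ w ∈ sphere (0 : ℂ) ρ, ‖F i w‖ ≤ bound i)
    (hf : ∀ w ∈ sphere (0 : ℂ) ρ, HasSum (fun i => F i w) (f w)) :
    HasSum (fun i => ∮ w in C(0, ρ), F i w) (∮ w in C(0, ρ), f w) := by
  unfold circleIntegral
  refine intervalIntegral.hasSum_integral_of_dominated_convergence
    (fun i _ => ρ * bound i) ?_ ?_ ?_ ?_ ?_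
  · intro i
    have h1 : Continuous fun t : ℝ => F i (circleMap 0 ρ t) :=
      (hF i).comp_continuous (continuous_circleMap 0 ρ) fun t => circleMap_mem_sphere 0 hρ t
    have h2 : Continuous fun t : ℝ => deriv (circleMap 0 ρ) t • F i (circleMap 0 ρ t) := by
      simp only [deriv_circleMap]
      exact ((continuous_circleMap 0 ρ).mul continuous_const).smul h1
    exact h2.aestronglyMeasurable
  · intro i
    refine .of_forall fun t _ => ?_
    rw [norm_smul, deriv_circleMap, norm_mul, norm_I, mul_one, norm_circleMap_zero,
      abs_of_nonneg hρ]
    exact mul_le_mul_of_nonneg_left (hFb i _ (circleMap_mem_sphere 0 hρ t)) hρ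
  · exact .of_forall fun t _ => hb.mul_left ρ
  · exact intervalIntegrable_const
  · exact .of_forall fun t _ => (hf _ (circleMap_mem_sphere 0 hρ t)).const_smul _

theorem circleIntegral_zpow {ρ : ℝ} (hρ : 0 < ρ) (m : ℤ) :
    (∮ w in C(0, ρ), w ^ m) = if m = -1 then 2 * π * I else 0 := by
  split_ifs with h
  · subst h
    simpa using circleIntegral.integral_sub_center_inv 0 hρ.ne'
  · simpa using circleIntegral.integral_sub_zpow_of_ne h 0 0 ρ

theorem ne_zero_of_norm_eq {w : ℂ} {ρ : ℝ} (hρ : 0 < ρ) (hw : ‖w‖ = ρ) : w ≠ 0 := by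
  rintro rfl
  simp at hw
  exact hρ.ne hw

theorem continuousOn_zpow_sphere {ρ : ℝ} (hρ : 0 < ρ) (m : ℤ) :
    ContinuousOn (fun w : ℂ => w ^ m) (sphere 0 ρ) := fun w hw =>
  (continuousAt_zpow₀ w m (.inl (ne_zero_of_norm_eq hρ (by simpa using hw)))).continuousWithinAt

theorem laurentCoeff_congr {φ φ' : ℂ → ℂ} {ρ : ℝ} (hρ : 0 ≤ ρ)
    (h : ∀ w : ℂ, ‖w‖ = ρ → φ w = φ' w) (m : ℤ) :
    laurentCoeff φ ρ m = laurentCoeff φ' ρ m := by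
  unfold laurentCoeff
  congr 1
  refine circleIntegral.integral_congr hρ fun w hw => ?_
  rw [h w (by simpa using hw)]

theorem HasLaurent.laurentCoeff {φ : ℂ → ℂ} {ρ : ℝ} {c : ℤ → ℂ} (h : HasLaurent φ ρ c)
    (hρ : 0 < ρ) (m : ℤ) : laurentCoeff φ ρ m = c m := by
  have key := hasSum_circleIntegral hρ.le (F := fun k w => c k * w ^ k / w ^ (m + 1))
    (f := fun w => φ w / w ^ (m + 1))
    (fun k => by
      refine (continuousOn_const.mul (continuousOn_zpow_sphere hρ k)).div
        (continuousOn_zpow_sphere hρ _) fun w hw => ?_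
      exact zpow_ne_zero _ (ne_zero_of_norm_eq hρ (by simpa using hw)))
    (fun k => ‖c k‖ * ρ ^ k / ρ ^ (m + 1)) (h.summable.div_const _)
    (fun k w hw => by
      have : ‖w‖ = ρ := by simpa using hw
      simp [this])
    (fun w hw => (h.hasSum w (by simpa using hw)).div_const _)
  have h2 : ∀ k, (∮ w in C(0, ρ), c k * w ^ k / w ^ (m + 1)) =
      if k = m then c m * (2 * π * I) else 0 := by
    intro k
    have : (∮ w in C(0, ρ), c k * w ^ k / w ^ (m + 1)) =
        ∮ w in C(0, ρ), c k * w ^ (k - (m + 1)) := by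
      refine circleIntegral.integral_congr hρ.le fun w hw => ?_
      have hw0 := ne_zero_of_norm_eq hρ (w := w) (by simpa using hw)
      rw [zpow_sub₀ hw0]
      ring
    rw [this, circleIntegral.integral_const_mul, circleIntegral_zpow hρ]
    by_cases hk : k = m
    · subst hk
      simp
    · rw [if_neg hk, if_neg (by omega), mul_zero]
  simp only [h2] at key
  have h3 := key.unique (hasSum_ite_eq m (c m * (2 * π * I)))
  unfold EpiKernel.laurentCoeff
  rw [h3]
  have : (2 * π * I : ℂ) ≠ 0 := two_pi_I_ne_zero
  field_simp

theorem norm_laurentCoeff_le {φ : ℂ → ℂ} {ρ M : ℝ} (hρ : 0 < ρ)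
    (h : ∀ w : ℂ, ‖w‖ = ρ → ‖φ w‖ ≤ M) (m : ℤ) : ‖laurentCoeff φ ρ m‖ ≤ M * ρ ^ (-m) := by
  have := circleIntegral.norm_two_pi_i_inv_smul_integral_le_of_norm_le_const (c := 0)
    (f := fun w => φ w / w ^ (m + 1)) (C := M / ρ ^ (m + 1)) hρ.le (fun w hw => by
      have hw' : ‖w‖ = ρ := by simpa using hw
      rw [norm_div, norm_zpow, hw']
      have := h w hw'
      gcongr)
  unfold laurentCoeff
  rw [smul_eq_mul] at this
  refine this.trans (le_of_eq ?_)
  rw [zpow_add₀ hρ.ne', zpow_neg]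
  field_simp

/-- Absolutely summable Laurent coefficients represent a continuous function. -/
theorem hasLaurent_of_summable {φ : ℂ → ℂ} {ρ : ℝ} (hρ : 0 < ρ)
    (hφ : ContinuousOn φ (sphere 0 ρ))
    (hs : Summable fun m : ℤ => ‖laurentCoeff φ ρ m‖ * ρ ^ m) :
    HasLaurent φ ρ (laurentCoeff φ ρ) := by
  refine ⟨hs, fun w hw => ?_⟩
  have : Fact (0 < 2 * π) := ⟨by positivity⟩
  -- Pulled back to the unit circle by t ↦ ρ e^(it), `φ` has Fourier coefficients `laurentCoeff φ ρ
  -- m * ρ ^ m`. They are summable, so the Fourier series converges pointwise to the continuous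
  -- function.
  let u : AddCircle (2 * π) → ℂ := fun x => (ρ : ℂ) * fourier 1 x
  have hu : Continuous u := continuous_const.mul (map_continuous _)
  have hus : ∀ x, u x ∈ sphere (0 : ℂ) ρ := fun x => by
    have h1 : ‖(fourier 1 x : ℂ)‖ = 1 := by
      rw [fourier_apply]; exact Circle.norm_coe _
    simp only [mem_sphere_iff_norm, sub_zero, u, norm_mul, h1, Complex.norm_real, mul_one]
    exact abs_of_pos hρ
  let f : C(AddCircle (2 * π), ℂ) := ⟨fun x => φ (u x), hφ.comp_continuous hu hus⟩
  have hfo : ∀ (n : ℤ) (x : ℝ), (fourier n (x : AddCircle (2 * π)) : ℂ) =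
      Complex.exp (x * I) ^ n := by
    intro n x
    rw [fourier_coe_apply, ← Complex.exp_int_mul]
    congr 1
    have : (π : ℂ) ≠ 0 := by exact_mod_cast Real.pi_ne_zero
    push_cast
    field_simp
  have hu2 : ∀ x : ℝ, u (x : AddCircle (2 * π)) = circleMap 0 ρ x := by
    intro x
    simp only [u, hfo, circleMap, zpow_one, zero_add]
  have hc : ∀ m : ℤ, fourierCoeff f m = laurentCoeff φ ρ m * (ρ : ℂ) ^ m := by
    intro m
    rw [fourierCoeff_eq_intervalIntegral f m 0, laurentCoeff, circleIntegral]
    rw [zero_add, mul_assoc, mul_comm (∫ _ in _.._, _) _, ← intervalIntegral.integral_const_mul,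
      Complex.real_smul, ← intervalIntegral.integral_const_mul,
      ← intervalIntegral.integral_const_mul]
    refine intervalIntegral.integral_congr fun x _ => ?_
    have h0 : circleMap 0 ρ x ≠ 0 := circleMap_ne_center hρ.ne'
    have hρc : (ρ : ℂ) ≠ 0 := by exact_mod_cast hρ.ne'
    have he : Complex.exp (x * I) ≠ 0 := Complex.exp_ne_zero _
    have hpi : (π : ℂ) ≠ 0 := by exact_mod_cast Real.pi_ne_zero
    simp only [smul_eq_mul, deriv_circleMap, hfo, f, ContinuousMap.coe_mk, hu2]
    rw [zpow_add₀ h0, zpow_one]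
    have : circleMap 0 ρ x ^ m = (ρ : ℂ) ^ m * Complex.exp (x * I) ^ m := by
      rw [circleMap, zero_add, mul_zpow]
    rw [this, zpow_neg]
    have h1 : (ρ : ℂ) ^ m ≠ 0 := zpow_ne_zero _ hρc
    have h2 : Complex.exp (x * I) ^ m ≠ 0 := zpow_ne_zero _ he
    push_cast
    field_simp
  have hsum : Summable (fourierCoeff f) := by
    refine Summable.of_norm ?_
    refine hs.congr fun m => ?_
    rw [hc, norm_mul, norm_zpow, Complex.norm_real, Real.norm_of_nonneg hρ.le]
  have hx := has_pointwise_sum_fourier_series_of_summable hsum ((arg w : ℝ) : AddCircle (2 * π))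
  have hwx : circleMap 0 ρ (arg w) = w := by
    rw [circleMap, zero_add, ← hw]; exact norm_mul_exp_arg_mul_I w
  have : f ((arg w : ℝ) : AddCircle (2 * π)) = φ w := by
    simp only [f, ContinuousMap.coe_mk, hu2, hwx]
  rw [this] at hx
  convert! hx using 2 with m
  rw [hc, hfo, smul_eq_mul, mul_assoc, ← mul_zpow]
  congr 2
  rw [← hw]; exact (norm_mul_exp_arg_mul_I w).symm

/-! ### Functions analytic on an annulus -/

theorem circleIntegral_eq_of_analyticOnNhd {f : ℂ → ℂ} {r R ρ : ℝ} (hr : 0 < r)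
    (hf : AnalyticOnNhd ℂ f (annulus r R)) (hρ : r ≤ ρ) (hρR : ρ ≤ R) :
    (∮ w in C(0, ρ), f w) = ∮ w in C(0, r), f w := by
  refine Complex.circleIntegral_eq_of_differentiable_on_annulus_off_countable hr hρ
    Set.countable_empty ?_ ?_
  · intro w hw
    refine (hf w ⟨?_, ?_⟩).continuousAt.continuousWithinAt
    · simpa using hw.2
    · exact le_trans (by simpa using hw.1) hρR
  · intro w hw
    refine (hf w ⟨?_, ?_⟩).differentiableAt
    · exact le_of_lt (by simpa using hw.1.2)
    · exact le_trans (le_of_lt (by simpa using hw.1.1)) hρR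

theorem analyticAt_zpow {w : ℂ} (hw : w ≠ 0) (m : ℤ) : AnalyticAt ℂ (fun w : ℂ => w ^ m) w :=
  analyticAt_id.zpow hw

theorem laurentCoeff_eq_of_analyticOnNhd {φ : ℂ → ℂ} {r R ρ : ℝ} (hr : 0 < r)
    (hf : AnalyticOnNhd ℂ φ (annulus r R)) (hρ : r ≤ ρ) (hρR : ρ ≤ R) (m : ℤ) :
    laurentCoeff φ ρ m = laurentCoeff φ r m := by
  unfold laurentCoeff
  rw [circleIntegral_eq_of_analyticOnNhd hr _ hρ hρR]
  intro w hw
  have hw0 : w ≠ 0 := norm_pos_iff.mp (hr.trans_le hw.1)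
  exact (hf w hw).div (analyticAt_zpow hw0 _) (zpow_ne_zero _ hw0)

theorem isCompact_annulus (r R : ℝ) : IsCompact (annulus r R) := by
  refine (isCompact_closedBall (0 : ℂ) R).of_isClosed_subset ?_ fun w hw => by simpa using hw.2
  exact (isClosed_le continuous_const continuous_norm).inter
    (isClosed_le continuous_norm continuous_const)

/-- The set of analyticity is open and the annulus compact, so a closed thickening of the annulus
still lies in it. The room gained on both sides gives geometric decay of the Laurent coefficients.
-/
theorem exists_annulus_enlarge {φ : ℂ → ℂ} {r R : ℝ} (hr : 0 < r) (hrR : r ≤ R)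
    (hφ : AnalyticOnNhd ℂ φ (annulus r R)) :
    ∃ ε, 0 < ε ∧ ε < r ∧ AnalyticOnNhd ℂ φ (annulus (r - ε) (R + ε)) := by
  obtain ⟨δ, hδ, hsub⟩ := (isCompact_annulus r R).exists_cthickening_subset_open
    (isOpen_analyticAt ℂ φ) hφ
  refine ⟨min δ (r / 2), by positivity, by linarith [min_le_right δ (r / 2)], fun w hw => ?_⟩
  have hεδ := min_le_left δ (r / 2)
  have hεr := min_le_right δ (r / 2)
  set ε := min δ (r / 2)
  have hw1 := hw.1
  have hw2 := hw.2
  have hn : 0 < ‖w‖ := by linarith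
  have hn' : (‖w‖ : ℂ) ≠ 0 := by exact_mod_cast hn.ne'
  refine hsub ?_
  -- The modulus of `w` clamped to `[r, R]`: the point `(s / ‖w‖) * w` is the radial projection of
  -- `w` to the annulus, at distance at most `δ`.
  set s : ℝ := max r (min ‖w‖ R)
  have hs : |‖w‖ - s| ≤ δ := by
    rw [abs_le]
    constructor <;> rcases max_cases r (min ‖w‖ R) with h | h <;>
      rcases min_cases ‖w‖ R with h' | h' <;> simp only [s] <;> linarith [h.1, h.2, h'.1, h'.2]
  have hs1 : r ≤ s := le_max_left _ _
  have hs2 : s ≤ R := max_le hrR (min_le_right _ _)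
  have hnorm : ‖(s / ‖w‖ : ℂ) * w‖ = s := by
    rw [norm_mul, norm_div, Complex.norm_real, Complex.norm_real, norm_norm,
      Real.norm_of_nonneg (hr.le.trans hs1)]
    field_simp
  refine Metric.mem_cthickening_of_dist_le w ((s / ‖w‖ : ℂ) * w) δ _ ⟨?_, ?_⟩ ?_
  · rw [hnorm]; exact hs1
  · rw [hnorm]; exact hs2
  · rw [dist_eq_norm]
    have : w - (s / ‖w‖ : ℂ) * w = ((‖w‖ - s : ℝ) : ℂ) * (w / ‖w‖) := by
      push_cast; field_simp
    rw [this, norm_mul, norm_div, Complex.norm_real, Complex.norm_real, norm_norm,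
      div_self hn.ne', mul_one]
    exact hs

theorem summable_int_of_le_geometric {f : ℤ → ℝ} {C₁ C₂ s t : ℝ} (hf : ∀ m, 0 ≤ f m)
    (hs : 0 ≤ s) (hs1 : s < 1) (ht : 0 ≤ t) (ht1 : t < 1)
    (h₁ : ∀ n : ℕ, f n ≤ C₁ * s ^ n) (h₂ : ∀ n : ℕ, f (-n) ≤ C₂ * t ^ n) : Summable f := by
  refine Summable.of_nat_of_neg ?_ ?_
  · exact Summable.of_nonneg_of_le (fun _ => hf _) h₁
      ((summable_geometric_of_lt_one hs hs1).mul_left _)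
  · exact Summable.of_nonneg_of_le (fun _ => hf _) h₂
      ((summable_geometric_of_lt_one ht ht1).mul_left _)

/-- The Laurent expansion of a function that is analytic on a closed annulus. -/
theorem hasLaurent_of_analyticOnNhd {φ : ℂ → ℂ} {r R ρ : ℝ} (hr : 0 < r)
    (hφ : AnalyticOnNhd ℂ φ (annulus r R)) (hρ : r ≤ ρ) (hρR : ρ ≤ R) :
    HasLaurent φ ρ (laurentCoeff φ r) := by
  have hrR := hρ.trans hρR
  have hρ0 : 0 < ρ := hr.trans_le hρ
  have hcoeff : laurentCoeff φ ρ = laurentCoeff φ r :=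
    funext (laurentCoeff_eq_of_analyticOnNhd hr hφ hρ hρR)
  have hcont : ContinuousOn φ (sphere 0 ρ) := fun w hw => by
    have : ‖w‖ = ρ := by simpa using hw
    exact (hφ w ⟨by rw [this]; exact hρ, by rw [this]; exact hρR⟩).continuousAt.continuousWithinAt
  -- Cauchy estimates on `|w| = R + ε` for positive indices and on `|w| = r - ε` for negative ones
  -- give the ratios `ρ / (R + ε)` and `(r - ε) / ρ`, both less than 1.
  obtain ⟨ε, hε, hεr, hφ'⟩ := exists_annulus_enlarge hr hrR hφ
  obtain ⟨M, hM⟩ := (isCompact_annulus (r - ε) (R + ε)).exists_bound_of_continuousOn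
    hφ'.continuousOn
  have h1 : ∀ m, laurentCoeff φ ρ m = laurentCoeff φ (r - ε) m :=
    laurentCoeff_eq_of_analyticOnNhd (by linarith) hφ' (by linarith) (by linarith)
  have h2 : ∀ m, laurentCoeff φ (R + ε) m = laurentCoeff φ (r - ε) m :=
    laurentCoeff_eq_of_analyticOnNhd (by linarith) hφ' (by linarith) le_rfl
  rw [← hcoeff]
  refine hasLaurent_of_summable hρ0 hcont ?_
  refine summable_int_of_le_geometric (C₁ := M) (C₂ := M) (s := ρ / (R + ε)) (t := (r - ε) / ρ)
    (fun m => by positivity) (div_nonneg hρ0.le (by linarith)) ?_ (div_nonneg (by linarith) hρ0.le) ?_ ?_ ?_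
  · rw [div_lt_one (by linarith)]; linarith
  · rw [div_lt_one hρ0]; linarith
  · intro n
    have := norm_laurentCoeff_le (φ := φ) (ρ := R + ε) (M := M) (by linarith)
      (fun w hw => hM w ⟨by rw [hw]; linarith, hw.le⟩) n
    rw [h1, ← h2, zpow_natCast, div_pow]
    calc _ ≤ (M * (R + ε) ^ (-(n : ℤ))) * ρ ^ n := by gcongr
      _ = _ := by rw [zpow_neg, zpow_natCast]; ring
  · intro n
    have := norm_laurentCoeff_le (φ := φ) (ρ := r - ε) (M := M) (by linarith)
      (fun w hw => hM w ⟨hw.ge, by rw [hw]; linarith⟩) (-n)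
    rw [h1, zpow_neg, zpow_natCast, div_pow]
    calc _ ≤ (M * (r - ε) ^ (-(-(n : ℤ)))) * (ρ ^ n)⁻¹ := by gcongr
      _ = _ := by rw [neg_neg, zpow_natCast]; ring

end

end EpiKernel

namespace EpiKernel

open scoped Real
open Metric Set Complex

noncomputable section

/-! ### Composition of Toeplitz kernels -/

theorem hasSum_laurentCoeff_mul {φ φ' : ℂ → ℂ} {ρ : ℝ} {c : ℤ → ℂ} (hρ : 0 < ρ)
    (hφ : ContinuousOn φ (sphere 0 ρ)) (h' : HasLaurent φ' ρ c) (m : ℤ) :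
    HasSum (fun k => laurentCoeff φ ρ (m - k) * c k)
      (laurentCoeff (fun w => φ w * φ' w) ρ m) := by
  obtain ⟨M, hM⟩ := (isCompact_sphere (0 : ℂ) ρ).exists_bound_of_continuousOn hφ
  have key := hasSum_circleIntegral hρ.le (F := fun k w => φ w / w ^ (m + 1) * (c k * w ^ k))
    (f := fun w => φ w / w ^ (m + 1) * φ' w)
    (fun k => by
      refine (hφ.div (continuousOn_zpow_sphere hρ _) fun w hw => ?_).mul
        (continuousOn_const.mul (continuousOn_zpow_sphere hρ k))
      exact zpow_ne_zero _ (ne_zero_of_norm_eq hρ (by simpa using hw)))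
    (fun k => M / ρ ^ (m + 1) * (‖c k‖ * ρ ^ k)) (h'.summable.mul_left _)
    (fun k w hw => by
      have hw' : ‖w‖ = ρ := by simpa using hw
      have := hM w hw
      rw [norm_mul, norm_div, norm_mul, norm_zpow, norm_zpow, hw']
      gcongr)
    (fun w hw => (h'.hasSum w (by simpa using hw)).mul_left _)
  have key2 := key.mul_left (2 * π * I : ℂ)⁻¹
  have e : (2 * π * I : ℂ)⁻¹ * (∮ w in C(0, ρ), φ w / w ^ (m + 1) * φ' w) =
      laurentCoeff (fun w => φ w * φ' w) ρ m := by
    unfold laurentCoeff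
    congr 2
    funext w
    ring
  rw [e] at key2
  convert! key2 using 2 with k
  unfold laurentCoeff
  rw [mul_assoc, mul_comm _ (c k), ← circleIntegral.integral_const_mul]
  congr 1
  refine circleIntegral.integral_congr hρ.le fun w hw => ?_
  have hw0 := ne_zero_of_norm_eq hρ (w := w) (by simpa using hw)
  rw [show m - k + 1 = (m + 1) - k by ring, zpow_sub₀ hw0]
  have : w ^ k ≠ 0 := zpow_ne_zero _ hw0
  have : w ^ (m + 1) ≠ 0 := zpow_ne_zero _ hw0
  field_simp

theorem sphere_eq_annulus (ρ : ℝ) : sphere (0 : ℂ) ρ = annulus ρ ρ := by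
  ext w
  simp [annulus, le_antisymm_iff, and_comm]

theorem hasLaurent_of_analyticOnNhd_sphere {φ : ℂ → ℂ} {ρ : ℝ} (hρ : 0 < ρ)
    (hφ : AnalyticOnNhd ℂ φ (sphere 0 ρ)) : HasLaurent φ ρ (laurentCoeff φ ρ) :=
  hasLaurent_of_analyticOnNhd hρ (sphere_eq_annulus ρ ▸ hφ) le_rfl le_rfl

/-- The powers of `θ` telescope, since (x-z) + (z-y) = x-y; what is left is the convolution of
Laurent coefficients. -/
theorem hasSum_comp_contourKer {θ ρ : ℝ} {φ φ' : ℂ → ℂ} (hθ : θ ≠ 0) (hρ : 0 < ρ)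
    (hφ : AnalyticOnNhd ℂ φ (sphere 0 ρ)) (hφ' : AnalyticOnNhd ℂ φ' (sphere 0 ρ)) (x y : ℤ) :
    HasSum (fun z => contourKer θ ρ φ x z * contourKer θ ρ φ' z y)
      (contourKer θ ρ (fun w => φ w * φ' w) x y) := by
  have hθc : (θ : ℂ) ≠ 0 := by exact_mod_cast hθ
  have h := (hasSum_laurentCoeff_mul hρ hφ.continuousOn
    (hasLaurent_of_analyticOnNhd_sphere hρ hφ') (x - y)).mul_left ((θ : ℂ) ^ (x - y))
  rw [← contourKer_eq, ← (Equiv.subRight y).hasSum_iff] at h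
  refine h.congr_fun fun z => ?_
  simp only [Function.comp_apply, Equiv.subRight_apply, contourKer_eq]
  rw [show x - y = (x - z) + (z - y) by ring, zpow_add₀ hθc,
    show x - z + (z - y) - (z - y) = x - z by ring]
  ring

theorem composable_contourKer {θ ρ : ℝ} {φ φ' : ℂ → ℂ} (hθ : θ ≠ 0) (hρ : 0 < ρ)
    (hφ : AnalyticOnNhd ℂ φ (sphere 0 ρ)) (hφ' : AnalyticOnNhd ℂ φ' (sphere 0 ρ)) :
    Composable (contourKer θ ρ φ) (contourKer θ ρ φ') := fun x y =>
  (hasSum_comp_contourKer hθ hρ hφ hφ' x y).summable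

theorem comp_contourKer {θ ρ : ℝ} {φ φ' : ℂ → ℂ} (hθ : θ ≠ 0) (hρ : 0 < ρ)
    (hφ : AnalyticOnNhd ℂ φ (sphere 0 ρ)) (hφ' : AnalyticOnNhd ℂ φ' (sphere 0 ρ)) :
    comp (contourKer θ ρ φ) (contourKer θ ρ φ') = contourKer θ ρ fun w => φ w * φ' w := by
  funext x y
  exact (hasSum_comp_contourKer hθ hρ hφ hφ' x y).tsum_eq

theorem contourKer_congr {θ ρ : ℝ} {φ φ' : ℂ → ℂ} (hρ : 0 ≤ ρ)
    (h : ∀ w : ℂ, ‖w‖ = ρ → φ w = φ' w) : contourKer θ ρ φ = contourKer θ ρ φ' := by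
  funext x y
  rw [contourKer_eq, contourKer_eq, laurentCoeff_congr hρ h]

theorem contourKer_of_hasLaurent {θ ρ : ℝ} {φ : ℂ → ℂ} {c : ℤ → ℂ} (hρ : 0 < ρ)
    (h : HasLaurent φ ρ c) (x y : ℤ) :
    contourKer θ ρ φ x y = (θ : ℂ) ^ (x - y) * c (x - y) := by
  rw [contourKer_eq, h.laurentCoeff hρ]

theorem contourKer_one {θ ρ : ℝ} (hρ : 0 < ρ) : contourKer θ ρ (fun _ => 1) = idKer := by
  have h : HasLaurent (fun _ => 1) ρ (fun m => if m = 0 then 1 else 0) := by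
    refine ⟨summable_of_ne_finset_zero (s := {0}) fun m hm => ?_, fun w _ => ?_⟩
    · simp at hm; simp [hm]
    · convert! hasSum_ite_eq (0 : ℤ) (1 : ℂ) using 2 with m
      split_ifs with h <;> simp [h]
  funext x y
  rw [contourKer_of_hasLaurent hρ h, idKer]
  by_cases hxy : x = y
  · simp [hxy]
  · simp [hxy, sub_eq_zero]

theorem kpow_contourKer {θ ρ : ℝ} {φ : ℂ → ℂ} (hθ : θ ≠ 0) (hρ : 0 < ρ)
    (hφ : AnalyticOnNhd ℂ φ (sphere 0 ρ)) (m : ℕ) :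
    kpow (contourKer θ ρ φ) m = contourKer θ ρ fun w => φ w ^ m := by
  induction m with
  | zero => simp only [kpow, pow_zero, contourKer_one hρ]
  | succ m ih =>
    simp only [kpow]
    rw [ih, comp_contourKer hθ hρ (hφ.fun_pow m) hφ]
    simp only [pow_succ]

theorem isInverse_contourKer {θ ρ : ℝ} {φ φ' : ℂ → ℂ} (hθ : θ ≠ 0) (hρ : 0 < ρ)
    (hφ : AnalyticOnNhd ℂ φ (sphere 0 ρ)) (hφ' : AnalyticOnNhd ℂ φ' (sphere 0 ρ))
    (h : ∀ w : ℂ, ‖w‖ = ρ → φ w * φ' w = 1) :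
    IsInverse (contourKer θ ρ φ) (contourKer θ ρ φ') := by
  refine ⟨composable_contourKer hθ hρ hφ hφ', composable_contourKer hθ hρ hφ' hφ, ?_, ?_⟩
  · rw [comp_contourKer hθ hρ hφ hφ', contourKer_congr hρ.le h, contourKer_one hρ]
  · rw [comp_contourKer hθ hρ hφ' hφ, ← contourKer_one (θ := θ) hρ]
    exact contourKer_congr hρ.le fun w hw => by rw [mul_comm, h w hw]

/-- Needed because the series of `Q` and `A` are known on `|w| = θ`, while the other kernels are
integrals over `|w| = r`. -/
theorem contourKer_radius {θ r R ρ : ℝ} {φ : ℂ → ℂ} (hr : 0 < r)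
    (hφ : AnalyticOnNhd ℂ φ (annulus r R)) (hρ : r ≤ ρ) (hρR : ρ ≤ R) :
    contourKer θ ρ φ = contourKer θ r φ := by
  funext x y
  rw [contourKer_eq, contourKer_eq, laurentCoeff_eq_of_analyticOnNhd hr hφ hρ hρR]

/-- The rows of a Toeplitz kernel whose symbol is analytic up to `|w| = θ` are summable. -/
theorem summable_norm_contourKer {θ r : ℝ} {φ : ℂ → ℂ} (hr : 0 < r) (hrθ : r ≤ θ)
    (hφ : AnalyticOnNhd ℂ φ (annulus r θ)) (x : ℤ) :
    Summable fun z => ‖contourKer θ r φ x z‖ := by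
  have h := (hasLaurent_of_analyticOnNhd hr hφ hrθ le_rfl).summable
  rw [← (Equiv.subLeft x).summable_iff] at h
  refine h.congr fun z => ?_
  rw [contourKer_eq, norm_mul, norm_zpow, Complex.norm_real,
    Real.norm_of_nonneg (hr.le.trans hrθ)]
  simp [mul_comm]

/-! ### The symbols of the model -/

/-- The hypotheses on the weights `q` and the functions `a` and `ψ`. -/
structure Model (κ : ℕ) (θ : ℝ) (q : ℤ → ℝ) (a ψ : ℂ → ℂ) (r R : ℝ) : Prop where
  θ_pos : 0 < θ
  θ_lt : θ < 1
  q_nonneg : ∀ i, 0 ≤ q i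
  q_eq_one : ∀ i : ℤ, (κ : ℤ) < i → q i = 1
  q_summable : Summable fun i : ℤ => q i * θ ^ i
  a_hasSum : ∀ w : ℂ, θ ≤ ‖w‖ →
      HasSum (fun i : ℤ => ((q (i + 1) - q i : ℝ) : ℂ) * w ^ i) (a w)
  r_pos : 0 < r
  r_lt : r < θ
  lt_R : 1 < R
  a_an : AnalyticOnNhd ℂ a {w | r ≤ ‖w‖}
  a_ne : ∀ w ∈ annulus r R, a w ≠ 0
  ψ_an : AnalyticOnNhd ℂ ψ (annulus r R)
  ψ_ne : ∀ w ∈ annulus r R, ψ w ≠ 0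

/-- The symbol `(1 - w) / (α w a(w))` of `Q⁻¹`. -/
def invSym (θ : ℝ) (q : ℤ → ℝ) (a : ℂ → ℂ) (w : ℂ) : ℂ :=
  (alpha θ q : ℂ)⁻¹ * ((1 - w) / (w * a w))

/-- The symbol of `A`. -/
def aSym (θ : ℝ) (q : ℤ → ℝ) (a : ℂ → ℂ) (w : ℂ) : ℂ := (alpha θ q : ℂ) * a w

theorem annulus_mono {r r' R R' : ℝ} (hr : r' ≤ r) (hR : R ≤ R') : annulus r R ⊆ annulus r' R' :=
  fun _ hw => ⟨hr.trans hw.1, hw.2.trans hR⟩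

namespace Model

variable {κ : ℕ} {θ : ℝ} {q : ℤ → ℝ} {a ψ : ℂ → ℂ} {r R : ℝ}

theorem θ_ne (h : Model κ θ q a ψ r R) : (θ : ℂ) ≠ 0 := by exact_mod_cast h.θ_pos.ne'

theorem r_lt_one (h : Model κ θ q a ψ r R) : r < 1 := h.r_lt.trans h.θ_lt

theorem alpha_pos (h : Model κ θ q a ψ r R) : 0 < alpha θ q := by
  unfold alpha
  rw [inv_pos]
  refine h.q_summable.tsum_pos (fun i => mul_nonneg (h.q_nonneg i) (zpow_nonneg h.θ_pos.le _))
    (κ + 1) ?_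
  rw [h.q_eq_one _ (by omega), one_mul]
  exact zpow_pos h.θ_pos _

theorem alpha_ne (h : Model κ θ q a ψ r R) : (alpha θ q : ℂ) ≠ 0 := by
  exact_mod_cast h.alpha_pos.ne'

theorem ne_zero_of_mem {w : ℂ} (h : Model κ θ q a ψ r R) (hw : r ≤ ‖w‖) : w ≠ 0 :=
  norm_pos_iff.mp (h.r_pos.trans_le hw)

theorem a_annulus (h : Model κ θ q a ψ r R) {ρ : ℝ} : AnalyticOnNhd ℂ a (annulus r ρ) :=
  h.a_an.mono fun _ hw => hw.1

theorem aSym_an (h : Model κ θ q a ψ r R) {ρ : ℝ} : AnalyticOnNhd ℂ (aSym θ q a) (annulus r ρ) :=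
  analyticOnNhd_const.mul h.a_annulus

theorem aSym_ne (h : Model κ θ q a ψ r R) {w : ℂ} (hw : w ∈ annulus r R) : aSym θ q a w ≠ 0 :=
  mul_ne_zero h.alpha_ne (h.a_ne w hw)

theorem invSym_an (h : Model κ θ q a ψ r R) :
    AnalyticOnNhd ℂ (invSym θ q a) (annulus r R) :=
  analyticOnNhd_const.mul ((analyticOnNhd_const.sub analyticOnNhd_id).div
    (analyticOnNhd_id.mul h.a_annulus) fun w hw =>
      mul_ne_zero (h.ne_zero_of_mem hw.1) (h.a_ne w hw))

theorem invSym_ne (h : Model κ θ q a ψ r R) {w : ℂ} (hw : w ∈ annulus r R) (hw1 : w ≠ 1) :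
    invSym θ q a w ≠ 0 := by
  unfold invSym
  exact mul_ne_zero (inv_ne_zero h.alpha_ne) (div_ne_zero (sub_ne_zero.mpr hw1.symm)
    (mul_ne_zero (h.ne_zero_of_mem hw.1) (h.a_ne w hw)))

theorem mem_of_lt_one (h : Model κ θ q a ψ r R) {ρ : ℝ} (hρ : ρ < 1) {w : ℂ}
    (hw : w ∈ annulus r ρ) : w ∈ annulus r R ∧ w ≠ 1 := by
  refine ⟨annulus_mono le_rfl (hρ.trans h.lt_R).le hw, ?_⟩
  rintro rfl
  have := hw.2
  rw [norm_one] at this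
  linarith

/-- The only zero of `invSym` in the annulus is w = 1. The condition `ρ < 1` excludes it and makes
negative powers analytic too. -/
theorem invSym_zpow_an (h : Model κ θ q a ψ r R) {ρ : ℝ} (hρ : ρ < 1) (k : ℤ) :
    AnalyticOnNhd ℂ (fun w => invSym θ q a w ^ k) (annulus r ρ) := fun w hw =>
  (h.invSym_an w (h.mem_of_lt_one hρ hw).1).zpow
    (h.invSym_ne (h.mem_of_lt_one hρ hw).1 (h.mem_of_lt_one hρ hw).2)

theorem summable_a (h : Model κ θ q a ψ r R) :
    HasLaurent (aSym θ q a) θ (fun m => ((alpha θ q * (q (m + 1) - q m) : ℝ) : ℂ)) := by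
  have h0 := h.a_hasSum θ (by rw [Complex.norm_real]; exact le_abs_self _)
  constructor
  · have := (h0.summable.mul_left (alpha θ q : ℂ)).norm
    refine this.congr fun m => ?_
    simp only [norm_mul, norm_zpow, Complex.norm_real, ofReal_mul, Real.norm_of_nonneg h.θ_pos.le]
    ring
  · intro w hw
    refine ((h.a_hasSum w hw.ge).mul_left (alpha θ q : ℂ)).congr_fun fun m => ?_
    push_cast
    ring

/-- Shifting the index gives a(w) = (1/w - 1) ∑ q_m w^m on |w| = θ, hence α ∑ q_m w^m = α w a(w) /
(1 - w), the inverse of `invSym`. -/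
theorem hasLaurent_Q (h : Model κ θ q a ψ r R) :
    HasLaurent (fun w => (invSym θ q a w)⁻¹) θ (fun m => ((alpha θ q * q m : ℝ) : ℂ)) := by
  have hsum : Summable fun m => ‖((alpha θ q * q m : ℝ) : ℂ)‖ * θ ^ m := by
    refine (h.q_summable.mul_left (alpha θ q)).congr fun m => ?_
    rw [Complex.norm_real, Real.norm_of_nonneg (mul_nonneg h.alpha_pos.le (h.q_nonneg m))]
    ring
  refine ⟨hsum, fun w hw => ?_⟩
  have hw0 : w ≠ 0 := ne_zero_of_norm_eq h.θ_pos hw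
  have hS : Summable fun m : ℤ => (q m : ℂ) * w ^ m := by
    refine Summable.of_norm (h.q_summable.congr fun m => ?_)
    rw [norm_mul, norm_zpow, hw, Complex.norm_real, Real.norm_of_nonneg (h.q_nonneg m)]
  obtain ⟨S, hS⟩ := hS
  have hshift : HasSum (fun m : ℤ => (q (m + 1) : ℂ) * w ^ m) (S / w) := by
    have := ((Equiv.addRight (1 : ℤ)).hasSum_iff.mpr hS).div_const w
    refine this.congr_fun fun m => ?_
    simp only [Function.comp_apply, Equiv.coe_addRight, zpow_add₀ hw0, zpow_one]
    field_simp
  have ha := (h.a_hasSum w hw.ge).unique ((hshift.sub hS).congr_fun fun m => by push_cast; ring)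
  have hw1 : 1 - w ≠ 0 := by
    rw [sub_ne_zero]
    rintro rfl
    rw [norm_one] at hw
    linarith [h.θ_lt]
  have hval : (invSym θ q a w)⁻¹ = alpha θ q * S := by
    unfold invSym
    rw [mul_inv, inv_inv, inv_div, ha]
    field_simp
  rw [hval]
  refine (hS.mul_left (alpha θ q : ℂ)).congr_fun fun m => ?_
  push_cast
  ring

theorem invSym_inv_an (h : Model κ θ q a ψ r R) {ρ : ℝ} (hρ : ρ < 1) :
    AnalyticOnNhd ℂ (fun w => (invSym θ q a w)⁻¹) (annulus r ρ) := by
  simpa using h.invSym_zpow_an hρ (-1)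

theorem Qker_eq (h : Model κ θ q a ψ r R) :
    Qker θ q = contourKer θ r fun w => (invSym θ q a w)⁻¹ := by
  rw [← contourKer_radius h.r_pos (h.invSym_inv_an h.θ_lt) h.r_lt.le le_rfl]
  funext x y
  rw [contourKer_of_hasLaurent h.θ_pos h.hasLaurent_Q, Qker, stepProb]
  push_cast
  ring

theorem Aker_eq (h : Model κ θ q a ψ r R) : Aker θ q = contourKer θ r (aSym θ q a) := by
  rw [← contourKer_radius h.r_pos h.aSym_an h.r_lt.le le_rfl]
  funext x y
  rw [contourKer_of_hasLaurent h.θ_pos h.summable_a, Aker]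
  push_cast
  ring

theorem Qinv_eq : Qinv θ q a r = contourKer θ r (invSym θ q a) := rfl

theorem Ainv_eq : Ainv θ q a r = contourKer θ r fun w => (aSym θ q a w)⁻¹ := by
  simp only [Ainv, aSym, mul_inv, one_div]

theorem Rinv_eq : Rinv θ ψ r = contourKer θ r fun w => (ψ w)⁻¹ := by
  simp only [Rinv, one_div]

theorem sphere_an {φ : ℂ → ℂ} {r ρ : ℝ} (hφ : AnalyticOnNhd ℂ φ (annulus r ρ)) (hρ : r ≤ ρ) :
    AnalyticOnNhd ℂ φ (sphere 0 r) := by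
  rw [sphere_eq_annulus]
  exact hφ.mono (annulus_mono le_rfl hρ)

theorem r_le_R (h : Model κ θ q a ψ r R) : r ≤ R := (h.r_lt_one.trans h.lt_R).le

theorem invSym_zpow_sphere (h : Model κ θ q a ψ r R) (k : ℤ) :
    AnalyticOnNhd ℂ (fun w => invSym θ q a w ^ k) (sphere 0 r) :=
  sphere_an (h.invSym_zpow_an h.θ_lt k) h.r_lt.le

theorem inverses (h : Model κ θ q a ψ r R) :
    IsInverse (Qker θ q) (Qinv θ q a r) ∧ IsInverse (Aker θ q) (Ainv θ q a r) ∧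
      IsInverse (Rker θ ψ r) (Rinv θ ψ r) := by
  have hmem : ∀ w : ℂ, ‖w‖ = r → w ∈ annulus r R ∧ w ≠ 1 := fun w hw =>
    h.mem_of_lt_one h.r_lt_one ⟨hw.ge, hw.le⟩
  refine ⟨?_, ?_, ?_⟩
  · rw [h.Qker_eq, Qinv_eq]
    refine isInverse_contourKer h.θ_pos.ne' h.r_pos (sphere_an (h.invSym_inv_an h.θ_lt) h.r_lt.le)
      (sphere_an h.invSym_an h.r_le_R) fun w hw => ?_
    exact inv_mul_cancel₀ (h.invSym_ne (hmem w hw).1 (hmem w hw).2)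
  · rw [h.Aker_eq, Ainv_eq]
    refine isInverse_contourKer h.θ_pos.ne' h.r_pos (sphere_an h.aSym_an h.r_le_R)
      (sphere_an (h.aSym_an.inv fun w hw => h.aSym_ne hw) h.r_le_R) fun w hw => ?_
    exact mul_inv_cancel₀ (h.aSym_ne (hmem w hw).1)
  · rw [Rinv_eq]
    refine isInverse_contourKer h.θ_pos.ne' h.r_pos (sphere_an h.ψ_an h.r_le_R)
      (sphere_an (h.ψ_an.inv h.ψ_ne) h.r_le_R) fun w hw => ?_
    exact mul_inv_cancel₀ (h.ψ_ne w (hmem w hw).1)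

theorem composable_kpow (h : Model κ θ q a ψ r R) (m : ℕ) :
    Composable (kpow (Qker θ q) m) (Qker θ q) ∧
      Composable (kpow (Qinv θ q a r) m) (Qinv θ q a r) ∧
      Composable (kpow (Aker θ q) m) (Aker θ q) := by
  have key : ∀ φ : ℂ → ℂ, AnalyticOnNhd ℂ φ (sphere 0 r) →
      Composable (kpow (contourKer θ r φ) m) (contourKer θ r φ) := fun φ hφ => by
    rw [kpow_contourKer h.θ_pos.ne' h.r_pos hφ]
    exact composable_contourKer h.θ_pos.ne' h.r_pos (hφ.fun_pow m) hφ
  rw [h.Qker_eq, Qinv_eq, h.Aker_eq]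
  exact ⟨key _ (sphere_an (h.invSym_inv_an h.θ_lt) h.r_lt.le),
    key _ (sphere_an h.invSym_an h.r_le_R), key _ (sphere_an h.aSym_an h.r_le_R)⟩

theorem Qpow_eq (h : Model κ θ q a ψ r R) (k : ℤ) :
    Qpow θ q a r k = contourKer θ r fun w => invSym θ q a w ^ (-k) := by
  cases k with
  | ofNat m =>
    simp only [Qpow]
    rw [h.Qker_eq, kpow_contourKer h.θ_pos.ne' h.r_pos
      (sphere_an (h.invSym_inv_an h.θ_lt) h.r_lt.le)]
    simp
  | negSucc m =>
    simp only [Qpow]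
    rw [Qinv_eq, kpow_contourKer h.θ_pos.ne' h.r_pos (sphere_an h.invSym_an h.r_le_R)]
    congr 1

theorem composable_R_Qpow (h : Model κ θ q a ψ r R) (k : ℤ) :
    Composable (Rker θ ψ r) (Qpow θ q a r k) := by
  rw [h.Qpow_eq]
  exact composable_contourKer h.θ_pos.ne' h.r_pos (sphere_an h.ψ_an h.r_le_R)
    (h.invSym_zpow_sphere _)

theorem RQpow_eq (h : Model κ θ q a ψ r R) (k : ℤ) :
    RQpow θ q a ψ r (-k) = contourKer θ r fun w => invSym θ q a w ^ k * ψ w := by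
  rw [RQpow, h.Qpow_eq, Rker, comp_contourKer h.θ_pos.ne' h.r_pos (sphere_an h.ψ_an h.r_le_R)
    (h.invSym_zpow_sphere _)]
  simp only [neg_neg, mul_comm]

theorem RQ_an (h : Model κ θ q a ψ r R) {ρ : ℝ} (hρ : ρ < 1) (k : ℤ) :
    AnalyticOnNhd ℂ (fun w => invSym θ q a w ^ k * ψ w) (annulus r ρ) :=
  (h.invSym_zpow_an hρ k).mul (h.ψ_an.mono fun _ hw => (h.mem_of_lt_one hρ hw).1)

theorem composable_RQpow_A (h : Model κ θ q a ψ r R) (k : ℤ) :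
    Composable (RQpow θ q a ψ r (-k)) (Aker θ q) := by
  rw [h.RQpow_eq, h.Aker_eq]
  exact composable_contourKer h.θ_pos.ne' h.r_pos (sphere_an (h.RQ_an h.θ_lt k) h.r_lt.le)
    (sphere_an h.aSym_an h.r_le_R)

theorem RQpow_A_eq (h : Model κ θ q a ψ r R) (k : ℤ) :
    comp (RQpow θ q a ψ r (-k)) (Aker θ q) =
      contourKer θ r fun w => invSym θ q a w ^ k * ψ w * aSym θ q a w := by
  rw [h.RQpow_eq, h.Aker_eq, comp_contourKer h.θ_pos.ne' h.r_pos
    (sphere_an (h.RQ_an h.θ_lt k) h.r_lt.le) (sphere_an h.aSym_an h.r_le_R)]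

theorem Sneg_eq (h : Model κ θ q a ψ r R) {n : ℕ} {r' : ℝ} (hr' : r' ∈ Set.Ico r 1) :
    Sneg θ q a ψ r' n = adj (comp (RQpow θ q a ψ r (-(n : ℤ))) (Aker θ q)) := by
  rw [h.RQpow_A_eq, ← contourKer_radius h.r_pos ((h.RQ_an hr'.2 n).mul h.aSym_an) hr'.1 le_rfl]
  funext z₁ z₂
  simp only [Sneg, adj, contourKer]
  rw [mul_comm ((alpha θ q : ℂ) ^ _), mul_assoc, ← circleIntegral.integral_const_mul]
  congr 1
  refine circleIntegral.integral_congr (h.r_pos.le.trans hr'.1) fun w hw => ?_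
  have hw' : ‖w‖ = r' := by simpa using hw
  obtain ⟨hw1, -⟩ := h.mem_of_lt_one hr'.2 (w := w) ⟨hr'.1.trans hw'.ge, hw'.le⟩
  have hw0 := h.ne_zero_of_mem hw1.1
  have ha0 := h.a_ne w hw1
  have hα := h.alpha_ne
  have := h.θ_ne
  simp only [invSym, aSym]
  rw [zpow_sub₀ ha0, zpow_add₀ hα, zpow_neg, zpow_one, zpow_one,
    show z₂ - z₁ + (n : ℤ) + 1 = (z₂ - z₁ + 1) + n by ring, zpow_add₀ hw0]
  simp only [zpow_natCast, mul_pow, div_pow, inv_pow]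
  field_simp

end Model

end

end EpiKernel

namespace EpiKernel

open scoped Real
open Metric Set Complex Polynomial

noncomputable section

/-! ### Residue kernels -/

/-- The kernel `θ^(x-y) (1 / 2πi) ∮_{|w| = δ} (1 - w)^(y-x) F(w) dw`. -/
def resKer (θ δ : ℝ) (F : ℂ → ℂ) : ℤ → ℤ → ℂ := fun x y =>
  (θ : ℂ) ^ (x - y) * ((2 * π * I)⁻¹ * ∮ w in C(0, δ), (1 - w) ^ (y - x) * F w)

theorem norm_one_sub_mem {δ : ℝ} {w : ℂ} (hw : ‖w‖ ≤ δ) : 1 - w ∈ annulus (1 - δ) (1 + δ) := by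
  constructor
  · have := norm_sub_norm_le 1 w
    rw [norm_one] at this
    linarith
  · have := norm_sub_le 1 w
    rw [norm_one] at this
    linarith

theorem one_sub_ne_zero {δ : ℝ} (hδ1 : δ < 1) {w : ℂ} (hw : ‖w‖ ≤ δ) : 1 - w ≠ 0 := by
  have := (norm_one_sub_mem hw).1
  exact norm_pos_iff.mp (by linarith)

/-- As x ↦ x^m is monotone, its maximum on [a, b] is at an endpoint which depends on the sign of
`m`; the sum treats both signs at once. -/
theorem zpow_le_add_zpow {a b x : ℝ} (ha : 0 < a) (hax : a ≤ x) (hxb : x ≤ b) (m : ℤ) :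
    x ^ m ≤ a ^ m + b ^ m := by
  have hx : 0 < x := ha.trans_le hax
  have hb : 0 < b := hx.trans_le hxb
  rcases le_total 0 m with hm | hm
  · have := zpow_le_zpow_left₀ hm hx.le hxb
    have := zpow_pos ha m
    linarith
  · have h1 : x ^ m ≤ a ^ m := by
      obtain ⟨n, rfl⟩ := Int.exists_eq_neg_ofNat hm
      rw [zpow_neg, zpow_neg, zpow_natCast, zpow_natCast]
      gcongr
    have := zpow_pos hb m
    linarith

theorem norm_one_sub_zpow_le {δ : ℝ} (hδ1 : δ < 1) {w : ℂ} (hw : ‖w‖ ≤ δ) (m : ℤ) :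
    ‖(1 - w) ^ m‖ ≤ (1 - δ) ^ m + (1 + δ) ^ m := by
  rw [norm_zpow]
  exact zpow_le_add_zpow (by linarith) (norm_one_sub_mem hw).1 (norm_one_sub_mem hw).2 m

theorem continuousOn_one_sub_zpow {δ : ℝ} (hδ1 : δ < 1) (m : ℤ) :
    ContinuousOn (fun w : ℂ => (1 - w) ^ m) (sphere 0 δ) := fun w hw => by
  have : ContinuousAt (fun w : ℂ => (1 - w) ^ m) w :=
    (continuousAt_const.sub continuousAt_id).zpow₀ m
      (.inl (one_sub_ne_zero hδ1 (by simpa using hw.le)))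
  exact this.continuousWithinAt

theorem resKer_congr {θ δ : ℝ} {F F' : ℂ → ℂ} (hδ : 0 ≤ δ) (h : ∀ w : ℂ, ‖w‖ = δ → F w = F' w) :
    resKer θ δ F = resKer θ δ F' := by
  funext x y
  unfold resKer
  congr 2
  refine circleIntegral.integral_congr hδ fun w hw => ?_
  rw [h w (by simpa using hw)]

theorem norm_resKer_le {θ δ M : ℝ} {F : ℂ → ℂ} (hθ : 0 < θ) (hδ : 0 ≤ δ) (hδ1 : δ < 1)
    (hM : ∀ w : ℂ, ‖w‖ = δ → ‖F w‖ ≤ M) (x y : ℤ) :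
    ‖resKer θ δ F x y‖ ≤ δ * M * (θ ^ (x - y) * ((1 - δ) ^ (y - x) + (1 + δ) ^ (y - x))) := by
  have := circleIntegral.norm_two_pi_i_inv_smul_integral_le_of_norm_le_const (c := 0)
    (f := fun w => (1 - w) ^ (y - x) * F w)
    (C := ((1 - δ) ^ (y - x) + (1 + δ) ^ (y - x)) * M) hδ (fun w hw => by
      have hw' : ‖w‖ = δ := by simpa using hw
      rw [norm_mul]
      refine mul_le_mul (norm_one_sub_zpow_le hδ1 hw'.le _) (hM w hw') (norm_nonneg _) ?_
      have h1 : 0 < 1 - δ := by linarith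
      have h2 : 0 < 1 + δ := by linarith
      positivity)
  rw [smul_eq_mul] at this
  unfold resKer
  rw [norm_mul, norm_zpow, Complex.norm_real, Real.norm_of_nonneg hθ.le]
  calc _ ≤ θ ^ (x - y) * (δ * (((1 - δ) ^ (y - x) + (1 + δ) ^ (y - x)) * M)) := by gcongr
    _ = _ := by ring

theorem hasSum_mul_circleIntegral_one_sub {δ : ℝ} {F φ : ℂ → ℂ} {c : ℤ → ℂ} (hδ : 0 < δ)
    (hδ1 : δ < 1) (hF : ContinuousOn F (sphere 0 δ))
    (hs : Summable fun k : ℤ => ‖c k‖ * ((1 - δ) ^ k + (1 + δ) ^ k))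
    (hc : ∀ w : ℂ, ‖w‖ = δ → HasSum (fun k => c k * (1 - w) ^ k) (φ (1 - w))) (m : ℤ) :
    HasSum (fun k => c k * ∮ w in C(0, δ), (1 - w) ^ (m + k) * F w)
      (∮ w in C(0, δ), (1 - w) ^ m * (F w * φ (1 - w))) := by
  have hcont : ContinuousOn (fun w => (1 - w) ^ m * F w) (sphere 0 δ) :=
    (continuousOn_one_sub_zpow hδ1 m).mul hF
  obtain ⟨M, hM⟩ := (isCompact_sphere (0 : ℂ) δ).exists_bound_of_continuousOn hcont
  have key := hasSum_circleIntegral hδ.le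
    (F := fun k w => (1 - w) ^ m * F w * (c k * (1 - w) ^ k))
    (f := fun w => (1 - w) ^ m * (F w * φ (1 - w)))
    (fun k => hcont.mul (continuousOn_const.mul (continuousOn_one_sub_zpow hδ1 k)))
    (fun k => M * (‖c k‖ * ((1 - δ) ^ k + (1 + δ) ^ k))) (hs.mul_left _)
    (fun k w hw => by
      have hw' : ‖w‖ = δ := by simpa using hw
      rw [norm_mul, norm_mul (c k)]
      have h1 := hM w hw
      have h2 := norm_one_sub_zpow_le hδ1 hw'.le k
      have h3 := (norm_nonneg _).trans h1
      gcongr)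
    (fun w hw => by
      rw [← mul_assoc]
      exact (hc w (by simpa using hw)).mul_left _)
  refine key.congr_fun fun k => ?_
  rw [← circleIntegral.integral_const_mul]
  refine circleIntegral.integral_congr hδ.le fun w hw => ?_
  have hw0 := one_sub_ne_zero hδ1 (w := w) (by simpa using hw.le)
  simp only [zpow_add₀ hw0]
  ring

/-- The radii for which residues at `w = 1` and Laurent expansions are compatible. -/
structure GoodRadius (r R δ : ℝ) : Prop where
  pos : 0 < δ
  r_pos : 0 < r
  le_sub : r ≤ 1 - δ
  add_le : 1 + δ ≤ R

namespace GoodRadius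

variable {θ r R δ : ℝ} {F φ : ℂ → ℂ}

theorem lt_one (h : GoodRadius r R δ) : δ < 1 := by linarith [h.r_pos, h.le_sub]

theorem mem (h : GoodRadius r R δ) {w : ℂ} (hw : ‖w‖ ≤ δ) : 1 - w ∈ annulus r R :=
  annulus_mono h.le_sub h.add_le (norm_one_sub_mem hw)

theorem summable_norm_laurentCoeff (h : GoodRadius r R δ)
    (hφ : AnalyticOnNhd ℂ φ (annulus r R)) :
    Summable fun k : ℤ => ‖laurentCoeff φ r k‖ * ((1 - δ) ^ k + (1 + δ) ^ k) := by
  have h1 := (hasLaurent_of_analyticOnNhd h.r_pos hφ h.le_sub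
    (by linarith [h.pos, h.add_le])).summable
  have h2 := (hasLaurent_of_analyticOnNhd h.r_pos hφ (ρ := 1 + δ)
    (by linarith [h.pos, h.le_sub]) h.add_le).summable
  refine (h1.add h2).congr fun k => ?_
  ring

theorem hasSum_circleIntegral (h : GoodRadius r R δ)
    (hφ : AnalyticOnNhd ℂ φ (annulus r R)) (hF : ContinuousOn F (sphere 0 δ)) (m : ℤ) :
    HasSum (fun k => laurentCoeff φ r k * ∮ w in C(0, δ), (1 - w) ^ (m + k) * F w)
      (∮ w in C(0, δ), (1 - w) ^ m * (F w * φ (1 - w))) :=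
  hasSum_mul_circleIntegral_one_sub h.pos h.lt_one hF (h.summable_norm_laurentCoeff hφ)
    (fun _ hw => (hasLaurent_of_analyticOnNhd h.r_pos hφ (h.mem hw.le).1 (h.mem hw.le).2).hasSum _
      rfl) m

/-- The circle |w| = δ is sent by w ↦ 1 - w into the annulus, so φ(1-w) can be replaced by its
Laurent series about 0; the term (1-w)^k only shifts the exponent y - x. Only continuity of `F` on
the circle enters, so it may have a pole at w = 0. -/
theorem hasSum_contourKer_resKer (h : GoodRadius r R δ) (hθ : θ ≠ 0)
    (hφ : AnalyticOnNhd ℂ φ (annulus r R)) (hF : ContinuousOn F (sphere 0 δ)) (x y : ℤ) :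
    HasSum (fun z => contourKer θ r φ x z * resKer θ δ F z y)
      (resKer θ δ (fun w => F w * φ (1 - w)) x y) := by
  have hθc : (θ : ℂ) ≠ 0 := by exact_mod_cast hθ
  have key := ((h.hasSum_circleIntegral hφ hF (y - x)).mul_left (2 * π * I : ℂ)⁻¹).mul_left
    ((θ : ℂ) ^ (x - y))
  rw [← (Equiv.subLeft x).hasSum_iff] at key
  refine key.congr_fun fun z => ?_
  simp only [Function.comp_apply, Equiv.subLeft_apply, contourKer_eq, resKer]
  rw [show x - y = (x - z) + (z - y) by ring, zpow_add₀ hθc,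
    show y - x + (x - z) = y - z by ring]
  ring

theorem hasSum_resKer_contourKer (h : GoodRadius r R δ) (hθ : θ ≠ 0)
    (hφ : AnalyticOnNhd ℂ φ (annulus r R)) (hF : ContinuousOn F (sphere 0 δ)) (x y : ℤ) :
    HasSum (fun z => resKer θ δ F x z * contourKer θ r φ z y)
      (resKer θ δ (fun w => F w * φ (1 - w)) x y) := by
  have hθc : (θ : ℂ) ≠ 0 := by exact_mod_cast hθ
  have key := ((h.hasSum_circleIntegral hφ hF (y - x)).mul_left (2 * π * I : ℂ)⁻¹).mul_left
    ((θ : ℂ) ^ (x - y))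
  rw [← (Equiv.subRight y).hasSum_iff] at key
  refine key.congr_fun fun z => ?_
  simp only [Function.comp_apply, Equiv.subRight_apply, contourKer_eq, resKer]
  rw [show x - y = (x - z) + (z - y) by ring, zpow_add₀ hθc,
    show y - x + (z - y) = z - x by ring]
  ring

end GoodRadius

/-! ### Evaluation of residue kernels -/

theorem iteratedDeriv_one_sub_zpow (m : ℤ) (j : ℕ) :
    iteratedDeriv j (fun w : ℂ => (1 - w) ^ m) 0 =
      (-1) ^ j * (descPochhammer ℂ j).eval (m : ℂ) := by
  rw [iteratedDeriv_comp_const_sub (f := fun w : ℂ => w ^ m) (s := (1 : ℂ)),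
    iteratedDeriv_eq_iterate]
  simp [descPochhammer_eval_eq_prod_range]

theorem circleIntegral_div_pow {δ : ℝ} {G : ℂ → ℂ} (hδ : 0 < δ)
    (hG : AnalyticOnNhd ℂ G (closedBall 0 δ)) (s : ℕ) :
    (2 * π * I : ℂ)⁻¹ * (∮ w in C(0, δ), G w / w ^ (s + 1)) =
      (s.factorial : ℂ)⁻¹ * iteratedDeriv s G 0 := by
  have h := hG.differentiableOn.circleIntegral_one_div_sub_center_pow_smul hδ s
  have e : (∮ w in C(0, δ), G w / w ^ (s + 1)) =
      ∮ w in C(0, δ), (1 / (w - 0) ^ (s + 1)) • G w := by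
    congr 1
    funext w
    simp only [sub_zero, smul_eq_mul]
    ring
  rw [e, h, smul_eq_mul]
  have : (2 * π * I : ℂ) ≠ 0 := two_pi_I_ne_zero
  field_simp

theorem analyticAt_one_sub_zpow {δ : ℝ} (hδ1 : δ < 1) {w : ℂ} (hw : ‖w‖ ≤ δ) (m : ℤ) :
    AnalyticAt ℂ (fun w : ℂ => (1 - w) ^ m) w :=
  (analyticAt_const.sub analyticAt_id).zpow (one_sub_ne_zero hδ1 hw)

theorem circleIntegral_one_sub_zpow {δ : ℝ} (hδ : 0 < δ) (hδ1 : δ < 1) (m : ℤ) (s : ℕ) :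
    (2 * π * I : ℂ)⁻¹ * (∮ w in C(0, δ), (1 - w) ^ m / w ^ (s + 1)) =
      (s.factorial : ℂ)⁻¹ * ((-1) ^ s * (descPochhammer ℂ s).eval (m : ℂ)) := by
  rw [circleIntegral_div_pow hδ (G := fun w => (1 - w) ^ m) _ s, iteratedDeriv_one_sub_zpow]
  exact fun w hw => analyticAt_one_sub_zpow hδ1 (by simpa using hw) m

/-- A residue kernel whose symbol has a pole of order at most `s + 1` at `0` is, up to the
factor `θ^(x-y)`, a polynomial of degree at most `s` in `y - x`. -/
theorem exists_resKer_eq_eval {θ δ : ℝ} {F G : ℂ → ℂ} (hδ : 0 < δ) (hδ1 : δ < 1) {s : ℕ}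
    (hG : AnalyticOnNhd ℂ G (closedBall 0 δ)) (hF : ∀ w : ℂ, ‖w‖ = δ → F w = G w / w ^ (s + 1)) :
    ∃ p : ℂ[X], p.natDegree ≤ s ∧
      ∀ x y : ℤ, resKer θ δ F x y = (θ : ℂ) ^ (x - y) * p.eval ((y - x : ℤ) : ℂ) := by
  -- By Cauchy's formula the integral is the s-th Taylor coefficient of (1-w)^(y-x) G(w). The
  -- witness is Leibniz's rule, in which the i-th derivative of (1-w)^m at 0 is (-1)^i times the
  -- falling factorial of m, a polynomial of degree i in m.
  refine ⟨Polynomial.C (s.factorial : ℂ)⁻¹ * ∑ i ∈ Finset.range (s + 1),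
    Polynomial.C (s.choose i * (-1) ^ i * iteratedDeriv (s - i) G 0) * descPochhammer ℂ i, ?_,
    fun x y => ?_⟩
  · refine (natDegree_C_mul_le _ _).trans (natDegree_sum_le_of_forall_le _ _ fun i hi => ?_)
    refine (natDegree_C_mul_le _ _).trans ?_
    rw [descPochhammer_natDegree]
    exact Nat.lt_succ_iff.mp (Finset.mem_range.mp hi)
  · have h0 : (0 : ℂ) ∈ closedBall (0 : ℂ) δ := by simp [hδ.le]
    have hz := fun (w : ℂ) (hw : w ∈ closedBall (0 : ℂ) δ) =>
      analyticAt_one_sub_zpow hδ1 (w := w) (by simpa using hw) (y - x)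
    rw [resKer_congr (F' := fun w => G w / w ^ (s + 1)) hδ.le hF, resKer]
    have e : (∮ w in C(0, δ), (1 - w) ^ (y - x) * (G w / w ^ (s + 1))) =
        ∮ w in C(0, δ), ((1 - w) ^ (y - x) * G w) / w ^ (s + 1) := by
      congr 1
      funext w
      ring
    rw [e, circleIntegral_div_pow hδ (G := fun w => (1 - w) ^ (y - x) * G w)
      (fun w hw => (hz w hw).mul (hG w hw)), iteratedDeriv_fun_mul (hz 0 h0).contDiffAt
        (hG 0 h0).contDiffAt]
    simp only [eval_mul, eval_C, eval_finsetSum, iteratedDeriv_one_sub_zpow]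
    congr 2
    refine Finset.sum_congr rfl fun i _ => ?_
    push_cast
    ring

theorem resKer_eq_zero {θ δ : ℝ} {F G : ℂ → ℂ} (hδ : 0 < δ) (hδ1 : δ < 1)
    (hG : AnalyticOnNhd ℂ G (closedBall 0 δ)) (hF : ∀ w : ℂ, ‖w‖ = δ → F w = G w) :
    resKer θ δ F = 0 := by
  funext x y
  rw [resKer_congr (F' := G) hδ.le hF, resKer]
  rw [Complex.circleIntegral_eq_zero_of_differentiable_on_off_countable hδ.le
    Set.countable_empty]
  · simp
  · exact fun w hw => ((analyticAt_one_sub_zpow hδ1 (by simpa using hw) _).mul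
      (hG w hw)).continuousAt.continuousWithinAt
  · exact fun w hw => ((analyticAt_one_sub_zpow hδ1 (by simpa using (ball_subset_closedBall hw.1)) _).mul
      (hG w (ball_subset_closedBall hw.1))).differentiableAt

theorem resKer_radius {θ δ δ' : ℝ} {F : ℂ → ℂ} (hδ' : 0 < δ') (hle : δ' ≤ δ) (hδ1 : δ < 1)
    (hF : AnalyticOnNhd ℂ F (annulus δ' δ)) : resKer θ δ F = resKer θ δ' F := by
  funext x y
  unfold resKer
  rw [circleIntegral_eq_of_analyticOnNhd hδ' _ hle le_rfl]
  exact fun w hw => (analyticAt_one_sub_zpow hδ1 hw.2 _).mul (hF w hw)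

theorem resKer_inv_pow {θ δ : ℝ} (hδ : 0 < δ) (hδ1 : δ < 1) (s : ℕ) (x y : ℤ) :
    resKer θ δ (fun w => (w ^ (s + 1))⁻¹) x y =
      (θ : ℂ) ^ (x - y) * ((s.factorial : ℂ)⁻¹ *
        ((-1) ^ s * (descPochhammer ℂ s).eval ((y - x : ℤ) : ℂ))) := by
  rw [resKer, ← circleIntegral_one_sub_zpow hδ hδ1]
  simp only [div_eq_mul_inv]

theorem Qbar0_eq_resKer {θ δ : ℝ} (hδ : 0 < δ) (hδ1 : δ < 1) (s : ℕ) :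
    Qbar0 θ (s + 1) = resKer θ δ fun w => (1 - w) ^ s / w ^ (s + 1) := by
  funext x y
  have e : (∮ w in C(0, δ), (1 - w) ^ (y - x) * ((1 - w) ^ s / w ^ (s + 1))) =
      ∮ w in C(0, δ), (1 - w) ^ (y - x + s) / w ^ (s + 1) := by
    refine circleIntegral.integral_congr hδ.le fun w hw => ?_
    have hw0 := one_sub_ne_zero hδ1 (w := w) (by simpa using hw.le)
    simp only [zpow_add₀ hw0, zpow_natCast]
    ring
  rw [resKer, e, circleIntegral_one_sub_zpow hδ hδ1, Qbar0, descPochhammer_eval_eq_prod_range,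
    Nat.add_sub_cancel, ← Finset.prod_range_reflect, mul_div_assoc, div_eq_inv_mul]
  congr 2
  -- The signs are distributed over the reversed falling factorial of y - x + s: -(y - x + s -
  -- (s-1-i)) = x - y - 1 - i.
  have : (-1 : ℂ) ^ s = ∏ i ∈ Finset.range s, (-1 : ℂ) := by simp
  rw [this, ← Finset.prod_mul_distrib]
  refine Finset.prod_congr rfl fun i hi => ?_
  have : ((s - 1 - i : ℕ) : ℤ) = s - 1 - i := by have := Finset.mem_range.mp hi; omega
  rw [this]
  push_cast
  ring

end

end EpiKernel

/-! ### ### Small contours about `w = 1` and the factorization of `Sbar` -/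

namespace EpiKernel

open scoped Real
open Metric Set Complex Polynomial

noncomputable section

/-- The symbol of the residue kernel that extends `A⁻¹ Q^(k+1)`. -/
def barSym (θ : ℝ) (q : ℤ → ℝ) (a : ℂ → ℂ) (k : ℤ) (w : ℂ) : ℂ :=
  invSym θ q a (1 - w) ^ (-k) * w⁻¹

namespace Model

variable {κ : ℕ} {θ : ℝ} {q : ℤ → ℝ} {a ψ : ℂ → ℂ} {r R δ : ℝ}

/-- The bound `(1 - θ) / 2` gives `θ < 1 - δ`, hence also `r ≤ 1 - δ`, and makes the residue kernels
decay above the barrier. The bound `R - 1` keeps the circle about 1 inside the annulus, and `δ₀`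
allows the given contour to be shrunk. -/
theorem exists_goodRadius (h : Model κ θ q a ψ r R) {δ₀ : ℝ} (hδ₀ : 0 < δ₀) :
    ∃ δ ≤ δ₀, θ < 1 - δ ∧ GoodRadius r R δ := by
  have h1 := h.θ_lt
  have h2 := h.lt_R
  have h3 := h.r_lt
  have ha := min_le_left δ₀ (min ((1 - θ) / 2) (R - 1))
  have hb := (min_le_right δ₀ (min ((1 - θ) / 2) (R - 1))).trans (min_le_left _ _)
  have hc := (min_le_right δ₀ (min ((1 - θ) / 2) (R - 1))).trans (min_le_right _ _)
  refine ⟨min δ₀ (min ((1 - θ) / 2) (R - 1)), ha, by linarith, ?_, h.r_pos, by linarith,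
    by linarith⟩
  exact lt_min hδ₀ (lt_min (by linarith) (by linarith))

theorem barSym_natCast (h : Model κ θ q a ψ r R) (hδ : GoodRadius r R δ) {w : ℂ} (hw : ‖w‖ = δ)
    (s : ℕ) : barSym θ q a s w = (1 - w) ^ s / w ^ (s + 1) * aSym θ q a (1 - w) ^ s := by
  have hw0 := ne_zero_of_norm_eq hδ.pos hw
  have h1 := h.ne_zero_of_mem (hδ.mem hw.le).1
  have h2 := h.a_ne _ (hδ.mem hw.le)
  have h3 := h.alpha_ne
  rw [barSym, zpow_neg, zpow_natCast, invSym, aSym, sub_sub_cancel, mul_pow, div_pow, mul_pow,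
    mul_pow, inv_pow, pow_succ]
  field_simp

theorem barSym_continuousOn (h : Model κ θ q a ψ r R) (hδ : GoodRadius r R δ) (k : ℤ) :
    ContinuousOn (barSym θ q a k) (sphere 0 δ) := by
  intro w hw
  have hw' : ‖w‖ = δ := by simpa using hw
  have hw0 := ne_zero_of_norm_eq hδ.pos hw'
  have h1 : ContinuousAt (fun w => invSym θ q a (1 - w)) w :=
    ContinuousAt.comp (g := invSym θ q a) (h.invSym_an _ (hδ.mem hw'.le)).continuousAt
      (continuousAt_const.sub continuousAt_id)
  have hne : (1 : ℂ) - w ≠ 1 := by simpa using hw0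
  exact ((h1.zpow₀ _ (.inl (h.invSym_ne (hδ.mem hw'.le) hne))).mul
    (continuousAt_id.inv₀ hw0)).continuousWithinAt

theorem comp_one_sub_an (hδ : GoodRadius r R δ) {φ : ℂ → ℂ} (hφ : AnalyticOnNhd ℂ φ (annulus r R)) :
    AnalyticOnNhd ℂ (fun w => φ (1 - w)) (closedBall 0 δ) := fun w hw =>
  (hφ _ (hδ.mem (by simpa using hw))).comp (analyticAt_const.sub analyticAt_id)

theorem comp_one_sub_continuousOn (hδ : GoodRadius r R δ) {φ : ℂ → ℂ}
    (hφ : AnalyticOnNhd ℂ φ (annulus r R)) :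
    ContinuousOn (fun w => φ (1 - w)) (sphere 0 δ) :=
  (comp_one_sub_an hδ hφ).continuousOn.mono sphere_subset_closedBall

theorem ψ_inv_an (h : Model κ θ q a ψ r R) : AnalyticOnNhd ℂ (fun w => (ψ w)⁻¹) (annulus r R) :=
  h.ψ_an.inv h.ψ_ne

theorem aSym_inv_an (h : Model κ θ q a ψ r R) :
    AnalyticOnNhd ℂ (fun w => (aSym θ q a w)⁻¹) (annulus r R) :=
  h.aSym_an.inv fun _ hw => h.aSym_ne hw

/-- The circle of radius `δ₀` about 1 may leave the annulus. The integrand has its only pole at w =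
0, so the contour can be shrunk to a good radius. -/
theorem Sbar_eq_resKer (h : Model κ θ q a ψ r R) {δ₀ : ℝ} (hδ : GoodRadius r R δ) (hle : δ ≤ δ₀)
    (hδ₀ : δ₀ < 1) (ha : AnalyticOnNhd ℂ (fun w => a (1 - w)) (closedBall 0 δ₀))
    (hψ : AnalyticOnNhd ℂ (fun w => (ψ (1 - w))⁻¹) (closedBall 0 δ₀)) (s : ℕ) :
    Sbar θ q a ψ δ₀ (s + 1) =
      resKer θ δ fun w => barSym θ q a s w * (ψ (1 - w))⁻¹ := by
  have e1 : Sbar θ q a ψ δ₀ (s + 1) = resKer θ δ₀ fun w =>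
      (1 - w) ^ s / w ^ (s + 1) * aSym θ q a (1 - w) ^ s * (ψ (1 - w))⁻¹ := by
    funext z₁ z₂
    rw [Sbar, resKer, mul_comm ((alpha θ q : ℂ) ^ _), mul_assoc,
      mul_left_comm ((θ : ℂ) ^ (z₁ - z₂)),
      ← circleIntegral.integral_const_mul ((alpha θ q : ℂ) ^ _),
      ← circleIntegral.integral_const_mul ((θ : ℂ) ^ (z₁ - z₂))]
    congr 1
    refine circleIntegral.integral_congr (hδ.pos.le.trans hle) fun w hw => ?_
    have hw' : ‖w‖ = δ₀ := by simpa using hw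
    have hw0 := one_sub_ne_zero hδ₀ hw'.le
    have e2 : z₂ - z₁ + ((s + 1 : ℕ) : ℤ) - 1 = (z₂ - z₁) + s := by push_cast; ring
    have e3 : ((s + 1 : ℕ) : ℤ) - 1 = s := by push_cast; ring
    simp only [e2, e3, zpow_natCast, aSym, mul_pow]
    rw [zpow_add₀ hw0, show z₁ - z₂ = -(z₂ - z₁) by ring, zpow_neg, zpow_natCast]
    ring
  rw [e1, resKer_radius hδ.pos hle hδ₀]
  · exact resKer_congr hδ.pos.le fun w hw => by rw [h.barSym_natCast hδ hw]
  · intro w hw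
    have hwb : w ∈ closedBall (0 : ℂ) δ₀ := by simpa using hw.2
    have hw0 : w ≠ 0 := norm_pos_iff.mp (hδ.pos.trans_le hw.1)
    have h1 : AnalyticAt ℂ (fun w : ℂ => (1 - w) ^ s) w := by fun_prop
    have h2 : AnalyticAt ℂ (fun w : ℂ => w ^ (s + 1)) w := by fun_prop
    exact ((h1.div h2 (pow_ne_zero _ hw0)).mul
      ((analyticAt_const.mul (ha w hwb)).pow s)).mul (hψ w hwb)

theorem pole_continuousOn (hδ : 0 < δ) (s : ℕ) :
    ContinuousOn (fun w : ℂ => (1 - w) ^ s / w ^ (s + 1)) (sphere 0 δ) :=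
  ContinuousOn.div (by fun_prop) (by fun_prop) fun w hw =>
    pow_ne_zero _ (ne_zero_of_norm_eq hδ (by simpa using hw))

theorem kpow_A_eq (h : Model κ θ q a ψ r R) (n : ℕ) :
    kpow (Aker θ q) n = contourKer θ r fun w => aSym θ q a w ^ n := by
  rw [h.Aker_eq, kpow_contourKer h.θ_pos.ne' h.r_pos (sphere_an h.aSym_an h.r_le_R)]

theorem hasSum_Qbar (h : Model κ θ q a ψ r R) (hδ : GoodRadius r R δ) (p s : ℕ) (x y : ℤ) :
    HasSum (fun z => kpow (Aker θ q) p x z * Qbar0 θ (s + 1) z y)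
      (resKer θ δ (fun w => (1 - w) ^ s / w ^ (s + 1) * aSym θ q a (1 - w) ^ p) x y) := by
  rw [h.kpow_A_eq, Qbar0_eq_resKer hδ.pos hδ.lt_one]
  exact hδ.hasSum_contourKer_resKer h.θ_pos.ne' (h.aSym_an.fun_pow p)
    (pole_continuousOn hδ.pos s) x y

theorem Qbar_eq (h : Model κ θ q a ψ r R) (hδ : GoodRadius r R δ) (s : ℕ) :
    Qbar θ q (s + 1) =
      resKer θ δ fun w => (1 - w) ^ s / w ^ (s + 1) * aSym θ q a (1 - w) ^ (s + 1) := by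
  funext x y
  exact (h.hasSum_Qbar hδ (s + 1) s x y).tsum_eq

/-- The symbol of `Qbar` is multiplied by 1/ψ(1-w) and by 1/(α a(1-w)); the latter lowers the
exponent of `aSym` from s + 1 to the exponent s of `Sbar`. -/
theorem Sbar_factorization (h : Model κ θ q a ψ r R) {δ₀ : ℝ} (hδ₀0 : 0 < δ₀)
    (hδ₀ : δ₀ < 1) (ha : AnalyticOnNhd ℂ (fun w => a (1 - w)) (closedBall 0 δ₀))
    (hψ : AnalyticOnNhd ℂ (fun w => (ψ (1 - w))⁻¹) (closedBall 0 δ₀)) {n : ℕ} (hn : 1 ≤ n) :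
    Composable (kpow (Aker θ q) n) (Qbar0 θ n) ∧
      Composable (Qbar θ q n) (Rinv θ ψ r) ∧
      Composable (comp (Qbar θ q n) (Rinv θ ψ r)) (Ainv θ q a r) ∧
      Sbar θ q a ψ δ₀ n = comp (comp (Qbar θ q n) (Rinv θ ψ r)) (Ainv θ q a r) := by
  obtain ⟨δ, hle, -, hδ⟩ := h.exists_goodRadius hδ₀0
  obtain ⟨s, rfl⟩ : ∃ s, n = s + 1 := ⟨n - 1, by omega⟩
  have c1 : ContinuousOn (fun w => (1 - w) ^ s / w ^ (s + 1) * aSym θ q a (1 - w) ^ (s + 1))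
      (sphere 0 δ) := (pole_continuousOn hδ.pos s).mul
        ((comp_one_sub_continuousOn hδ h.aSym_an).pow _)
  have k1 := hδ.hasSum_resKer_contourKer h.θ_pos.ne' h.ψ_inv_an c1
  have e1 : comp (Qbar θ q (s + 1)) (Rinv θ ψ r) = resKer θ δ fun w =>
      (1 - w) ^ s / w ^ (s + 1) * aSym θ q a (1 - w) ^ (s + 1) * (ψ (1 - w))⁻¹ := by
    rw [h.Qbar_eq hδ, Rinv_eq]
    funext x y
    exact (k1 x y).tsum_eq
  have k2 := hδ.hasSum_resKer_contourKer h.θ_pos.ne' h.aSym_inv_an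
    (c1.mul (comp_one_sub_continuousOn hδ h.ψ_inv_an))
  refine ⟨fun x y => (h.hasSum_Qbar hδ _ s x y).summable, ?_, ?_, ?_⟩
  · rw [h.Qbar_eq hδ, Rinv_eq]
    exact fun x y => (k1 x y).summable
  · rw [e1, Ainv_eq]
    exact fun x y => (k2 x y).summable
  · rw [e1, Ainv_eq, h.Sbar_eq_resKer hδ hle hδ₀ ha hψ]
    funext x y
    refine Eq.trans ?_ (k2 x y).tsum_eq.symm
    refine congrFun (congrFun (resKer_congr hδ.pos.le fun w hw => ?_) x) y
    have := h.aSym_ne (hδ.mem hw.le)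
    rw [h.barSym_natCast hδ hw, Pi.mul_apply, pow_succ (aSym θ q a (1 - w))]
    field_simp

end Model

end

end EpiKernel

namespace EpiKernel

open scoped Real
open Metric Set Complex Polynomial

noncomputable section

/-! ### Biorthogonalization -/

theorem degree_le_of_lt_succ {p : ℂ[X]} {n : ℕ} (h : p.degree < ((n + 1 : ℕ) : WithBot ℕ)) :
    p.degree ≤ n :=
  (degree_le_iff_coeff_zero _ _).2 fun m hm =>
    (degree_lt_iff_coeff_zero _ _).1 h m (Nat.succ_le_of_lt (by exact_mod_cast hm))

theorem eq_zero_of_degree_lt_natCast_zero {p : ℂ[X]} (h : p.degree < ((0 : ℕ) : WithBot ℕ)) :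
    p = 0 := by
  ext m
  simpa using (degree_lt_iff_coeff_zero _ _).1 h m (Nat.zero_le _)

theorem exists_degree_sub_smul_lt {t p : ℂ[X]} {n : ℕ} (ht : t.degree = n) (hp : p.degree ≤ n) :
    ∃ c : ℂ, (p - c • t).degree < n ∧ (p.degree = n → c ≠ 0) := by
  have ht' : t.coeff n ≠ 0 := coeff_ne_zero_of_eq_degree ht
  refine ⟨p.coeff n / t.coeff n, ?_, fun h => div_ne_zero (coeff_ne_zero_of_eq_degree h) ht'⟩
  rw [degree_lt_iff_coeff_zero]
  intro m hm
  rcases hm.eq_or_lt with rfl | hm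
  · simp [ht']
  · have h1 : p.coeff m = 0 := coeff_eq_zero_of_degree_lt (hp.trans_lt (by exact_mod_cast hm))
    have h2 : t.coeff m = 0 := coeff_eq_zero_of_degree_lt (ht.trans_lt (by exact_mod_cast hm))
    simp [h1, h2]

/-- On polynomials of degree at most k the functionals L_0, …, L_k form a triangular system with
nonzero diagonal, injective and hence bijective by dimension. For l > k the value 0 is automatic,
and L_k p = 1 forces the degree to be exactly k. -/
theorem exists_biorthogonal_polynomial {L : ℕ → ℂ[X] →ₗ[ℂ] ℂ}
    (h0 : ∀ (l : ℕ) (p : ℂ[X]), p.degree < l → L l p = 0)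
    (h1 : ∀ (l : ℕ) (p : ℂ[X]), p.degree = l → L l p ≠ 0) (k : ℕ) :
    ∃ p : ℂ[X], p.degree = k ∧ ∀ l, L l p = if l = k then 1 else 0 := by
  let T : degreeLT ℂ (k + 1) →ₗ[ℂ] (Fin (k + 1) → ℂ) :=
    (LinearMap.pi fun i : Fin (k + 1) => L i) ∘ₗ (degreeLT ℂ (k + 1)).subtype
  have hinj : Function.Injective T := by
    rw [injective_iff_map_eq_zero]
    intro p hp
    by_contra hne
    have hne' : (p : ℂ[X]) ≠ 0 := fun h => hne (Subtype.ext h)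
    have hd := mem_degreeLT.mp p.2
    rw [degree_eq_natDegree hne'] at hd
    have := congrFun hp ⟨(p : ℂ[X]).natDegree, by exact_mod_cast hd⟩
    exact h1 _ _ (degree_eq_natDegree hne') this
  have hfin : Module.finrank ℂ (degreeLT ℂ (k + 1)) = Module.finrank ℂ (Fin (k + 1) → ℂ) :=
    (degreeLTEquiv ℂ (k + 1)).finrank_eq
  have : FiniteDimensional ℂ (degreeLT ℂ (k + 1)) :=
    (degreeLTEquiv ℂ (k + 1)).symm.finiteDimensional
  obtain ⟨p, hp⟩ := (LinearMap.injective_iff_surjective_of_finrank_eq_finrank hfin).mp hinj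
    fun i => if (i : ℕ) = k then 1 else 0
  have hL : ∀ l < k + 1, L l p = if l = k then 1 else 0 := fun l hl => congrFun hp ⟨l, hl⟩
  have hle : (p : ℂ[X]).degree ≤ k := degree_le_of_lt_succ (mem_degreeLT.mp p.2)
  refine ⟨p, ?_, fun l => ?_⟩
  · by_contra hne
    have := h0 k p (lt_of_le_of_ne hle hne)
    rw [hL k (by omega), if_pos rfl] at this
    exact one_ne_zero this
  · by_cases hl : l < k + 1
    · exact hL l hl
    · rw [if_neg (by omega)]
      exact h0 l p (hle.trans_lt (by exact_mod_cast (by omega : k < l)))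

theorem biorthogonal_polynomial_unique {L : ℕ → ℂ[X] →ₗ[ℂ] ℂ}
    (h1 : ∀ (l : ℕ) (p : ℂ[X]), p.degree = l → L l p ≠ 0) {k : ℕ} {p p' : ℂ[X]}
    (hp : p.degree ≤ k) (hp' : p'.degree ≤ k) (h : ∀ l ≤ k, L l p = L l p') : p = p' := by
  by_contra hne
  have hne' := sub_ne_zero.mpr hne
  have hd := (degree_sub_le p p').trans (max_le hp hp')
  rw [degree_eq_natDegree hne'] at hd
  refine h1 _ _ (degree_eq_natDegree hne') ?_
  rw [map_sub, h _ (by exact_mod_cast hd), sub_self]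

/-- The polynomials `p_s` with `∑_s p_s(x) w^s = (1 - w)^x`. -/
def testPoly (s : ℕ) : ℂ[X] := Polynomial.C ((s.factorial : ℂ)⁻¹ * (-1) ^ s) * descPochhammer ℂ s

theorem degree_testPoly (s : ℕ) : (testPoly s).degree = s := by
  have h : ((s.factorial : ℂ)⁻¹ * (-1) ^ s) ≠ 0 :=
    mul_ne_zero (inv_ne_zero (by exact_mod_cast s.factorial_ne_zero)) (by simp)
  rw [testPoly, degree_C_mul h, degree_eq_natDegree, descPochhammer_natDegree]
  exact (monic_descPochhammer ℂ s).ne_zero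

theorem resKer_inv_pow_eq_testPoly {θ δ : ℝ} (hδ : 0 < δ) (hδ1 : δ < 1) (s : ℕ) (x : ℤ) :
    resKer θ δ (fun w => (w ^ (s + 1))⁻¹) 0 x =
      (θ : ℂ) ^ (-x) * (testPoly s).eval (x : ℂ) := by
  rw [resKer_inv_pow hδ hδ1]
  simp [testPoly, mul_assoc]

namespace Model

variable {κ : ℕ} {θ : ℝ} {q : ℤ → ℝ} {a ψ : ℂ → ℂ} {r R δ : ℝ}

theorem invSym_one_sub (θ : ℝ) (q : ℤ → ℝ) (a : ℂ → ℂ) (w : ℂ) :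
    invSym θ q a (1 - w) = w * ((1 - w) * aSym θ q a (1 - w))⁻¹ := by
  rw [invSym, aSym, sub_sub_cancel, mul_inv, mul_inv, div_eq_mul_inv, mul_inv]
  ring

/-- The symbol `invSym(1-w)^l ψ(1-w)`, divided by `w^l`. -/
theorem exists_factor (h : Model κ θ q a ψ r R) (hδ : GoodRadius r R δ) (l : ℕ) :
    ∃ g : ℂ → ℂ, AnalyticOnNhd ℂ g (closedBall 0 δ) ∧ g 0 ≠ 0 ∧
      ∀ w : ℂ, invSym θ q a (1 - w) ^ l * ψ (1 - w) = w ^ l * g w := by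
  refine ⟨fun w => ((1 - w) * aSym θ q a (1 - w))⁻¹ ^ l * ψ (1 - w), ?_, ?_, fun w => ?_⟩
  · intro w hw
    have h1 : AnalyticAt ℂ (fun w : ℂ => 1 - w) w := by fun_prop
    exact (((h1.mul (comp_one_sub_an hδ h.aSym_an w hw)).inv
      (mul_ne_zero (one_sub_ne_zero hδ.lt_one (by simpa using hw))
        (h.aSym_ne (hδ.mem (by simpa using hw))))).pow l).mul (comp_one_sub_an hδ h.ψ_an w hw)
  · have hm : (1 : ℂ) ∈ annulus r R := by simpa using hδ.mem (w := 0) (by simpa using hδ.pos.le)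
    simp only [sub_zero, one_mul]
    exact mul_ne_zero (pow_ne_zero _ (inv_ne_zero (h.aSym_ne hm))) (h.ψ_ne _ hm)
  · rw [← mul_assoc, ← mul_pow, invSym_one_sub]

theorem RQ_an_annulus (h : Model κ θ q a ψ r R) (l : ℕ) :
    AnalyticOnNhd ℂ (fun w => invSym θ q a w ^ (l : ℤ) * ψ w) (annulus r R) := by
  simp only [zpow_natCast]
  exact (h.invSym_an.fun_pow l).mul h.ψ_an

theorem inv_pow_continuousOn {δ : ℝ} (hδ : 0 < δ) (s : ℕ) :
    ContinuousOn (fun w : ℂ => (w ^ (s + 1))⁻¹) (sphere 0 δ) :=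
  ContinuousOn.inv₀ (by fun_prop) fun w hw =>
    pow_ne_zero _ (ne_zero_of_norm_eq hδ (by simpa using hw))

theorem hasSum_testPoly (h : Model κ θ q a ψ r R) (hδ : GoodRadius r R δ) (l s : ℕ) (y : ℤ) :
    HasSum (fun x : ℤ => RQpow θ q a ψ r (-(l : ℤ)) x y *
        ((θ : ℂ) ^ (-x) * (testPoly s).eval (x : ℂ)))
      (resKer θ δ (fun w => (w ^ (s + 1))⁻¹ * (invSym θ q a (1 - w) ^ l * ψ (1 - w))) 0 y) := by
  have := hδ.hasSum_resKer_contourKer h.θ_pos.ne' (h.RQ_an_annulus l)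
    (inv_pow_continuousOn hδ.pos s) 0 y
  simp only [zpow_natCast] at this
  rw [h.RQpow_eq]
  simp only [zpow_natCast]
  refine this.congr_fun fun x => ?_
  rw [resKer_inv_pow_eq_testPoly hδ.pos hδ.lt_one, mul_comm]

/-- The zero of order l of the symbol at w = 0 absorbs the pole of order s + 1 ≤ l. -/
theorem resKer_test_eq_zero (h : Model κ θ q a ψ r R) (hδ : GoodRadius r R δ) {l s : ℕ}
    (hs : s < l) (y : ℤ) :
    resKer θ δ (fun w => (w ^ (s + 1))⁻¹ * (invSym θ q a (1 - w) ^ l * ψ (1 - w))) 0 y = 0 := by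
  obtain ⟨g, hg, -, he⟩ := h.exists_factor hδ l
  have hG : AnalyticOnNhd ℂ (fun w => w ^ (l - (s + 1)) * g w) (closedBall 0 δ) := fun w hw =>
    (analyticAt_id.pow _).mul (hg w hw)
  rw [resKer_eq_zero hδ.pos hδ.lt_one hG]
  · rfl
  · intro w hw
    have hw0 := ne_zero_of_norm_eq hδ.pos hw
    rw [he, ← mul_assoc, pow_sub₀ w hw0 hs, mul_comm (w ^ (s + 1))⁻¹]

/-- Here a simple pole survives, and its residue is `g 0 ≠ 0`. -/
theorem resKer_test_ne_zero (h : Model κ θ q a ψ r R) (hδ : GoodRadius r R δ) (l : ℕ) (y : ℤ) :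
    resKer θ δ (fun w => (w ^ (l + 1))⁻¹ * (invSym θ q a (1 - w) ^ l * ψ (1 - w))) 0 y ≠ 0 := by
  obtain ⟨g, hg, hg0, he⟩ := h.exists_factor hδ l
  have e : (∮ w in C(0, δ), (1 - w) ^ (y - 0) *
      ((w ^ (l + 1))⁻¹ * (invSym θ q a (1 - w) ^ l * ψ (1 - w)))) =
      ∮ w in C(0, δ), ((1 - w) ^ y * g w) / w ^ (0 + 1) := by
    refine circleIntegral.integral_congr hδ.pos.le fun w hw => ?_
    have hw0 := ne_zero_of_norm_eq hδ.pos (w := w) (by simpa using hw)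
    simp only [he, sub_zero]
    field_simp
    ring
  rw [resKer, e, circleIntegral_div_pow hδ.pos (G := fun w => (1 - w) ^ y * g w)]
  · simp [h.θ_ne, hg0, zpow_ne_zero]
  · exact fun w hw => (analyticAt_one_sub_zpow hδ.lt_one (by simpa using hw) y).mul (hg w hw)

/-- Summation against `Ψ^n_l`, as a functional on polynomials: it vanishes on polynomials of
degree less than `l` and does not vanish on those of degree `l`. -/
theorem exists_functional (h : Model κ θ q a ψ r R) (l : ℕ) (y : ℤ) :
    ∃ L : ℂ[X] →ₗ[ℂ] ℂ,
      (∀ p : ℂ[X], HasSum (fun x : ℤ => RQpow θ q a ψ r (-(l : ℤ)) x y *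
        ((θ : ℂ) ^ (-x) * p.eval (x : ℂ))) (L p)) ∧
      (∀ p : ℂ[X], p.degree < l → L p = 0) ∧ ∀ p : ℂ[X], p.degree = l → L p ≠ 0 := by
  obtain ⟨δ, -, -, hδ⟩ := h.exists_goodRadius one_pos
  set f : ℂ[X] → ℤ → ℂ := fun p x =>
    RQpow θ q a ψ r (-(l : ℤ)) x y * ((θ : ℂ) ^ (-x) * p.eval (x : ℂ)) with hf
  have hadd : ∀ p p' : ℂ[X], f (p + p') = f p + f p' := fun p p' => by
    funext x; simp only [hf, eval_add, Pi.add_apply]; ring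
  have hsmul : ∀ (c : ℂ) (p : ℂ[X]), f (c • p) = c • f p := fun c p => by
    funext x; simp only [hf, eval_smul, Pi.smul_apply, smul_eq_mul]; ring
  have hdecomp : ∀ (p : ℂ[X]) (c : ℂ) (n : ℕ), p = (p - c • testPoly n) + c • testPoly n :=
    fun p c n => by ring
  -- The sums are known for the test polynomials, one in each degree. Induction on the degree,
  -- subtracting a multiple of `testPoly n` to cancel the leading term, reaches all polynomials; the
  -- vanishing `hzero` is obtained in the same way.
  have hsum : ∀ n : ℕ, ∀ p : ℂ[X], p.degree < n → Summable (f p) := by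
    intro n
    induction n with
    | zero =>
      intro p hp
      rw [eq_zero_of_degree_lt_natCast_zero hp]
      simp [hf]
    | succ n ih =>
      intro p hp
      obtain ⟨c, hc, -⟩ := exists_degree_sub_smul_lt (degree_testPoly n)
        (degree_le_of_lt_succ hp)
      rw [hdecomp p c n, hadd, hsmul]
      exact (ih _ hc).add ((h.hasSum_testPoly hδ l n y).summable.const_smul c)
  have hsum' : ∀ p : ℂ[X], Summable (f p) := fun p =>
    hsum (p.natDegree + 1) p (degree_le_natDegree.trans_lt (by exact_mod_cast Nat.lt_succ_self _))
  let L : ℂ[X] →ₗ[ℂ] ℂ :=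
    { toFun := fun p => ∑' x, f p x
      map_add' := fun p p' => by
        rw [hadd]; exact (hsum' p).tsum_add (hsum' p')
      map_smul' := fun c p => by
        rw [hsmul]; exact (hsum' p).tsum_const_smul c }
  have hL : ∀ s, L (testPoly s) = _ := fun s => (h.hasSum_testPoly hδ l s y).tsum_eq
  have hzero : ∀ n : ℕ, n ≤ l → ∀ p : ℂ[X], p.degree < n → L p = 0 := by
    intro n
    induction n with
    | zero =>
      intro _ p hp
      rw [eq_zero_of_degree_lt_natCast_zero hp, map_zero]
    | succ n ih =>
      intro hn p hp
      obtain ⟨c, hc, -⟩ := exists_degree_sub_smul_lt (degree_testPoly n)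
        (degree_le_of_lt_succ hp)
      rw [hdecomp p c n, map_add, map_smul, ih (by omega) _ hc, hL,
        h.resKer_test_eq_zero hδ (by omega)]
      simp
  refine ⟨L, fun p => (hsum' p).hasSum, hzero l le_rfl, fun p hp => ?_⟩
  obtain ⟨c, hc, hc0⟩ := exists_degree_sub_smul_lt (degree_testPoly l) hp.le
  rw [hdecomp p c l, map_add, map_smul, hzero l le_rfl _ hc, hL, zero_add]
  exact smul_ne_zero (hc0 hp) (h.resKer_test_ne_zero hδ l y)

theorem isBiorth_iff (h : Model κ θ q a ψ r R) {y : ℕ → ℤ} {n : ℕ} {L : ℕ → ℂ[X] →ₗ[ℂ] ℂ}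
    (hL : ∀ (l : ℕ) (p : ℂ[X]), HasSum (fun x : ℤ => RQpow θ q a ψ r (-(l : ℤ)) x
      (y ((n : ℤ) - l).toNat) * ((θ : ℂ) ^ (-x) * p.eval (x : ℂ))) (L l p))
    {φ : ℤ → ℂ} {p : ℂ[X]} (hp : ∀ x : ℤ, (θ : ℂ) ^ x * φ x = p.eval (x : ℂ)) (l : ℕ) (v : ℂ) :
    HasSum (fun x : ℤ => Psi θ q a ψ r y n l x * φ x) v ↔ L l p = v := by
  have e : (fun x : ℤ => Psi θ q a ψ r y n l x * φ x) = fun x : ℤ =>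
      RQpow θ q a ψ r (-(l : ℤ)) x (y ((n : ℤ) - l).toNat) *
        ((θ : ℂ) ^ (-x) * p.eval (x : ℂ)) := by
    funext x
    rw [← hp, ← mul_assoc ((θ : ℂ) ^ (-x)), ← zpow_add₀ h.θ_ne, neg_add_cancel, zpow_zero, one_mul,
      Psi]
  rw [e]
  exact ⟨fun hv => (hL l p).unique hv, fun hv => hv ▸ hL l p⟩

theorem existsUnique_biorth (h : Model κ θ q a ψ r R) (y : ℕ → ℤ) {n k : ℕ} (hk : k < n) :
    ∃! φ : ℤ → ℂ, IsBiorth θ (Psi θ q a ψ r y) n k φ := by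
  choose L hL h0 h1 using fun l : ℕ => h.exists_functional l (y ((n : ℤ) - l).toNat)
  have hcancel : ∀ (x : ℤ) (z : ℂ), (θ : ℂ) ^ x * ((θ : ℂ) ^ (-x) * z) = z := fun x z => by
    rw [← mul_assoc, ← zpow_add₀ h.θ_ne, add_neg_cancel, zpow_zero, one_mul]
  obtain ⟨p, hp, hpL⟩ := exists_biorthogonal_polynomial h0 h1 k
  refine ⟨fun x => (θ : ℂ) ^ (-x) * p.eval (x : ℂ), ⟨⟨p, hp, fun x => hcancel x _⟩, fun l _ => ?_⟩,
    ?_⟩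
  · rw [h.isBiorth_iff hL (p := p) fun x => hcancel x _]
    exact hpL l
  · rintro φ ⟨⟨p', hp', hφ⟩, hs⟩
    have : p' = p := by
      refine biorthogonal_polynomial_unique h1 hp'.le hp.le fun l hl => ?_
      rw [hpL, ← h.isBiorth_iff hL hφ]
      exact hs l (by omega)
    subst this
    funext x
    rw [← hφ, ← mul_assoc, ← zpow_add₀ h.θ_ne, neg_add_cancel, zpow_zero, one_mul]

/-- An upper bound on the degree suffices: a polynomial of degree less than k would have sum 0
against Ψ_k, not 1. -/
theorem isBiorth_of_natDegree_le (h : Model κ θ q a ψ r R) {y : ℕ → ℤ} {n k : ℕ} (hk : k < n)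
    {φ : ℤ → ℂ} {p : ℂ[X]} (hd : p.natDegree ≤ k)
    (hp : ∀ x : ℤ, (θ : ℂ) ^ x * φ x = p.eval (x : ℂ))
    (hs : ∀ l : ℕ, l < n →
      HasSum (fun x : ℤ => Psi θ q a ψ r y n l x * φ x) (if l = k then 1 else 0)) :
    IsBiorth θ (Psi θ q a ψ r y) n k φ := by
  refine ⟨⟨p, ?_, hp⟩, hs⟩
  choose L hL h0 _ using fun l : ℕ => h.exists_functional l (y ((n : ℤ) - l).toNat)
  by_contra hne
  have h1 := h0 k p (lt_of_le_of_ne (natDegree_le_iff_degree_le.mp hd) hne)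
  have h2 := (h.isBiorth_iff hL hp k _).mp (hs k hk)
  rw [if_pos rfl, h1] at h2
  exact zero_ne_one h2

end Model

end

end EpiKernel

namespace EpiKernel

open scoped Real
open Metric Set Complex Polynomial

noncomputable section

/-! ### Kernels acting on bounded functions -/

/-- The action of a kernel on a function. -/
def kact (K : ℤ → ℤ → ℂ) (f : ℤ → ℂ) (x : ℤ) : ℂ := ∑' z, K x z * f z

/-- All rows of `K` have absolute sum `C`. -/
def RowSummable (K : ℤ → ℤ → ℂ) (C : ℝ) : Prop := ∀ x, HasSum (fun z => ‖K x z‖) C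

theorem RowSummable.summable_mul {K : ℤ → ℤ → ℂ} {C M : ℝ} (hK : RowSummable K C) {f : ℤ → ℂ}
    (hf : ∀ z, ‖f z‖ ≤ M) (x : ℤ) : Summable fun z => K x z * f z := by
  refine Summable.of_norm_bounded ((hK x).summable.mul_right M) fun z => ?_
  rw [norm_mul]
  exact mul_le_mul_of_nonneg_left (hf z) (norm_nonneg _)

theorem RowSummable.norm_kact_le {K : ℤ → ℤ → ℂ} {C M : ℝ} (hK : RowSummable K C) {f : ℤ → ℂ}
    (hf : ∀ z, ‖f z‖ ≤ M) (x : ℤ) : ‖kact K f x‖ ≤ C * M := by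
  refine tsum_of_norm_bounded ((hK x).mul_right M) fun z => ?_
  rw [norm_mul]
  exact mul_le_mul_of_nonneg_left (hf z) (norm_nonneg _)

theorem RowSummable.kact_kact {V K : ℤ → ℤ → ℂ} {C C' M : ℝ} (hV : RowSummable V C)
    (hK : RowSummable K C') {f : ℤ → ℂ} (hf : ∀ z, ‖f z‖ ≤ M) (x : ℤ) :
    kact V (kact K f) x = kact (comp V K) f x := by
  have hs : Summable (Function.uncurry fun z b => V x z * (K z b * f b)) := by
    refine Summable.of_norm_bounded (g := fun p : ℤ × ℤ => ‖V x p.1‖ * (‖K p.1 p.2‖ * M)) ?_ ?_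
    · have hM : 0 ≤ M := (norm_nonneg _).trans (hf 0)
      refine (summable_prod_of_nonneg fun p => by positivity).mpr ⟨fun z => ?_, ?_⟩
      · exact ((hK z).summable.mul_right M).mul_left ‖V x z‖
      · refine ((hV x).summable.mul_right (C' * M)).congr fun z => ?_
        exact (((hK z).mul_right M).mul_left _).tsum_eq.symm
    · rintro ⟨z, b⟩
      simp only [Function.uncurry, norm_mul]
      have := hf b
      gcongr
  unfold kact comp
  simp_rw [← tsum_mul_left, ← tsum_mul_right]
  simp_rw [mul_assoc]
  exact hs.tsum_comm.symm

/-- Fubini: a bound `B u` uniform in `b` makes the double family absolutely summable. This lets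
summation against Ψ pass through a row of `Q` or `A`. -/
theorem hasSum_mul_tsum {ι : Type*} {k : ℤ → ℂ} (hk : Summable fun b => ‖k b‖) {Ψ : ι → ℂ}
    {g : ι → ℤ → ℂ} {B : ι → ℝ} (hB : Summable B) (hg : ∀ u b, ‖Ψ u * g u b‖ ≤ B u) {G : ℤ → ℂ}
    (hs : ∀ b, HasSum (fun u => Ψ u * g u b) (G b)) :
    HasSum (fun u => Ψ u * ∑' b, k b * g u b) (∑' b, k b * G b) := by
  have hB0 : ∀ u, 0 ≤ B u := fun u => (norm_nonneg _).trans (hg u 0)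
  have hF : Summable fun p : ι × ℤ => k p.2 * (Ψ p.1 * g p.1 p.2) := by
    refine Summable.of_norm_bounded (hB.mul_of_nonneg hk hB0 fun _ => norm_nonneg _) fun p => ?_
    rw [norm_mul, mul_comm]
    exact mul_le_mul_of_nonneg_right (hg _ _) (norm_nonneg _)
  have h1 := hF.hasSum.prod_fiberwise fun u => (hF.prod_factor u).hasSum
  have h2 := ((Equiv.prodComm ℤ ι).hasSum_iff.mpr hF.hasSum).prod_fiberwise
    fun b => (hs b).mul_left (k b)
  rw [h2.tsum_eq]
  refine h1.congr_fun fun u => ?_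
  rw [← tsum_mul_left]
  refine tsum_congr fun b => ?_
  ring

/-! ### Functions that are polynomials of bounded degree -/

/-- `f` is a polynomial of degree less than `d`. -/
def IsPolyLT (d : ℕ) (f : ℤ → ℂ) : Prop :=
  ∃ p : ℂ[X], p.degree < d ∧ ∀ x : ℤ, f x = p.eval (x : ℂ)

/-- The Lagrange basis for the nodes `0, …, d - 1`. -/
def lagrangePoly (d i : ℕ) : ℂ[X] := Lagrange.basis (Finset.range d) (fun j : ℕ => (j : ℂ)) i

/-- Lagrange interpolation turns the polynomial property into a finite linear identity between
values of `f`. Such identities survive pointwise convergent infinite sums, which gives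
`IsPolyLT.tsum`. -/
theorem isPolyLT_iff {d : ℕ} {f : ℤ → ℂ} :
    IsPolyLT d f ↔
      ∀ x : ℤ, f x = ∑ i ∈ Finset.range d, f i * (lagrangePoly d i).eval (x : ℂ) := by
  have hinj : Set.InjOn (fun j : ℕ => (j : ℂ)) (Finset.range d) := Nat.cast_injective.injOn
  constructor
  · rintro ⟨p, hp, hf⟩ x
    rw [hf, Lagrange.eq_interpolate (f := p) (s := Finset.range d) hinj (by simpa using hp)]
    simp only [Lagrange.interpolate_apply, eval_finsetSum, eval_mul, eval_C]
    refine Finset.sum_congr rfl fun i _ => ?_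
    rw [hf]
    rfl
  · intro h
    refine ⟨Lagrange.interpolate (Finset.range d) (fun j : ℕ => (j : ℂ)) fun i => f i, ?_,
      fun x => ?_⟩
    · simpa using Lagrange.degree_interpolate_lt (fun i : ℕ => f i) hinj
    · rw [h x]
      simp only [Lagrange.interpolate_apply, eval_finsetSum, eval_mul, eval_C]
      rfl

theorem IsPolyLT.mono {d d' : ℕ} {f : ℤ → ℂ} (h : IsPolyLT d f) (hd : d ≤ d') : IsPolyLT d' f := by
  obtain ⟨p, hp, hf⟩ := h
  exact ⟨p, hp.trans_le (by exact_mod_cast hd), hf⟩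

theorem IsPolyLT.zero (d : ℕ) : IsPolyLT d fun _ => 0 :=
  isPolyLT_iff.mpr fun x => by simp

theorem IsPolyLT.sub {d : ℕ} {f g : ℤ → ℂ} (hf : IsPolyLT d f) (hg : IsPolyLT d g) :
    IsPolyLT d fun x => f x - g x := by
  obtain ⟨p, hp, hf⟩ := hf
  obtain ⟨p', hp', hg⟩ := hg
  exact ⟨p - p', (degree_sub_le _ _).trans_lt (max_lt hp hp'), fun x => by
    simp only [hf, hg, eval_sub]⟩

theorem IsPolyLT.const_mul {d : ℕ} {f : ℤ → ℂ} (hf : IsPolyLT d f) (c : ℂ) :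
    IsPolyLT d fun x => c * f x := by
  rw [isPolyLT_iff] at hf ⊢
  intro x
  rw [hf x, Finset.mul_sum]
  exact Finset.sum_congr rfl fun i _ => by ring

theorem IsPolyLT.tsum {d : ℕ} {f : ℤ → ℤ → ℂ} (hf : ∀ b, IsPolyLT d (f b))
    (hs : ∀ x, Summable fun b => f b x) : IsPolyLT d fun x => ∑' b, f b x := by
  rw [isPolyLT_iff]
  intro x
  simp_rw [← tsum_mul_right]
  rw [← Summable.tsum_finsetSum (s := Finset.range d) (f := fun (i : ℕ) b =>
    f b i * eval (x : ℂ) (lagrangePoly d i)) fun i _ => (hs i).mul_right _]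
  exact tsum_congr fun b => isPolyLT_iff.mp (hf b) x

/-! ### The hitting problem for the walk, as a recursion -/

/-- The recursion for `E[S_{j-1-m}(B_m)]` where `m < j` is the first time with
`B_m > v_{j-1-m}`. -/
def hrec (Q : ℤ → ℤ → ℂ) (v : ℕ → ℤ) (S : ℕ → ℤ → ℂ) : ℕ → ℤ → ℂ
  | 0 => fun _ => 0
  | j + 1 => fun z => if v j < z then S j z else kact Q (hrec Q v S j) z

section hrec

variable {Q A : ℤ → ℤ → ℂ} {v : ℕ → ℤ} {S : ℕ → ℤ → ℂ} {CQ : ℝ}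

/-- The recursion evaluates `S j` only above the barrier `v j`, so a bound there is enough. The
weight `β u` carries all the dependence on the parameter; the constants are uniform in it, as the
later interchanges of sums require. -/
theorem hrec_bounded_family {ι : Type*} {S : ι → ℕ → ℤ → ℂ} (hQ : RowSummable Q CQ) {n : ℕ}
    {β : ι → ℝ} (hβ : ∀ u, 0 ≤ β u)
    (hS : ∀ j < n, ∃ C, ∀ u z, v j < z → ‖S u j z‖ ≤ C * β u) :
    ∀ j ≤ n, ∃ C, ∀ u z, ‖hrec Q v (S u) j z‖ ≤ C * β u := by
  intro j
  induction j with
  | zero => exact fun _ => ⟨0, fun u z => by simp [hrec]⟩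
  | succ j ih =>
    intro hj
    obtain ⟨C, hC⟩ := ih (by omega)
    obtain ⟨C', hC'⟩ := hS j (by omega)
    refine ⟨max C' (CQ * C), fun u z => ?_⟩
    simp only [hrec]
    split_ifs with h
    · exact (hC' u z h).trans (mul_le_mul_of_nonneg_right (le_max_left _ _) (hβ u))
    · refine (hQ.norm_kact_le (hC u) z).trans ?_
      rw [← mul_assoc]
      exact mul_le_mul_of_nonneg_right (le_max_right _ _) (hβ u)

theorem hrec_eq_zero {l : ℕ} (hS : ∀ j < l, ∀ z, S j z = 0) : ∀ j ≤ l, hrec Q v S j = 0 := by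
  intro j
  induction j with
  | zero => exact fun _ => rfl
  | succ j ih =>
    intro hj
    funext z
    simp [hrec, hS j (by omega), ih (by omega), kact]

theorem hasSum_hrec {ι : Type*} {S : ι → ℕ → ℤ → ℂ} {T : ℕ → ℤ → ℂ} (hQ : RowSummable Q CQ)
    {n : ℕ} {β : ι → ℝ} {Ψ : ι → ℂ} (hβ : ∀ u, 0 ≤ β u) (hΨ : Summable fun u => ‖Ψ u‖ * β u)
    (hS : ∀ j < n, ∃ C, ∀ u z, v j < z → ‖S u j z‖ ≤ C * β u)
    (hT : ∀ j < n, ∀ z, HasSum (fun u => Ψ u * S u j z) (T j z)) :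
    ∀ j ≤ n, ∀ z, HasSum (fun u => Ψ u * hrec Q v (S u) j z) (hrec Q v T j z) := by
  intro j
  induction j with
  | zero => exact fun _ z => by simp [hrec]
  | succ j ih =>
    intro hj z
    simp only [hrec]
    split_ifs with h
    · exact hT j (by omega) z
    · obtain ⟨C, hC⟩ := hrec_bounded_family hQ hβ hS j (by omega)
      refine hasSum_mul_tsum (hQ z).summable (hΨ.mul_left C) (fun u b => ?_) (ih (by omega))
      rw [norm_mul]
      have := hC u b
      calc _ ≤ ‖Ψ u‖ * (C * β u) := by gcongr
        _ = _ := by ring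

/-- The case distinction depends on z only. As a function of u, each step yields either the data or
a convergent combination, with coefficients Q(z,b), of functions from the previous step. -/
theorem isPolyLT_hrec {S : ℤ → ℕ → ℤ → ℂ} (hQ : RowSummable Q CQ) {n : ℕ} {β : ℤ → ℝ}
    {c : ℤ → ℂ} (hβ : ∀ u, 0 ≤ β u)
    (hS : ∀ j < n, ∃ C, ∀ u z, v j < z → ‖S u j z‖ ≤ C * β u)
    (hP : ∀ j < n, ∀ z, IsPolyLT (j + 1) fun u => c u * S u j z) :
    ∀ j ≤ n, ∀ z, IsPolyLT j fun u => c u * hrec Q v (S u) j z := by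
  intro j
  induction j with
  | zero => exact fun _ z => by simpa [hrec] using IsPolyLT.zero 0
  | succ j ih =>
    intro hj z
    simp only [hrec]
    split_ifs with h
    · exact hP j (by omega) z
    · obtain ⟨C, hC⟩ := hrec_bounded_family hQ hβ hS j (by omega)
      have e : (fun u => c u * kact Q (hrec Q v (S u) j) z) =
          fun u => ∑' b, Q z b * (c u * hrec Q v (S u) j b) := by
        funext u
        rw [kact, ← tsum_mul_left]
        exact tsum_congr fun b => by ring
      rw [e]
      refine IsPolyLT.tsum (fun b => ((ih (by omega) b).mono (by omega)).const_mul _) fun u => ?_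
      refine ((hQ.summable_mul (hC u) z).mul_left (c u)).congr fun b => ?_
      ring

/-- The twisted difference operator `θ⁻¹ f(z + 1) - f(z)`. -/
def tdiff (θ : ℝ) (f : ℤ → ℂ) (z : ℤ) : ℂ := (θ : ℂ)⁻¹ * f (z + 1) - f z

/-- For z < v_j both z and z + 1 are in the lower branch, and the relation is D Q = A. For z > v_j
both are in the upper branch, so D acts on the data S_j. Only z = v_j straddles the two branches. -/
theorem tdiff_hrec {θ : ℝ} {κ n : ℕ} (hQ : RowSummable Q CQ)
    (hAQ : ∀ z b, A z b = (θ : ℂ)⁻¹ * Q (z + 1) b - Q z b)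
    (hA : ∀ z b : ℤ, (κ : ℤ) < z - b → A z b = 0)
    (hv : ∀ j, j + 1 < n → v j + κ ≤ v (j + 1))
    (hS : ∀ j < n, ∃ M, ∀ z, v j < z → ‖S j z‖ ≤ M)
    (hS0 : ∀ z, tdiff θ (S 0) z = 0) (hS1 : ∀ j z, tdiff θ (S (j + 1)) z = kact A (S j) z)
    {j : ℕ} (hj : j < n) {z : ℤ} (hz : z ≠ v j) :
    tdiff θ (hrec Q v S (j + 1)) z = kact A (hrec Q v S j) z := by
  rcases hz.lt_or_gt with hlt | hgt
  · obtain ⟨C, hC⟩ := hrec_bounded_family (ι := Unit) (S := fun _ => S) (n := n) (v := v) hQ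
      (β := fun _ => 1) (fun _ => zero_le_one) (fun j hj => by simpa using hS j hj) j hj.le
    have hC' : ∀ z, ‖hrec Q v S j z‖ ≤ C := fun z => by simpa using hC () z
    simp only [tdiff, hrec]
    rw [if_neg (by omega), if_neg (by omega)]
    unfold kact
    rw [← tsum_mul_left, ← ((hQ.summable_mul hC' (z + 1)).mul_left _).tsum_sub
      (hQ.summable_mul hC' z)]
    refine tsum_congr fun b => ?_
    rw [hAQ]
    ring
  · have e : tdiff θ (hrec Q v S (j + 1)) z = tdiff θ (S j) z := by
      simp only [tdiff, hrec]
      rw [if_pos (by omega), if_pos hgt]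
    rw [e]
    cases j with
    | zero => rw [hS0]; simp [kact, hrec]
    | succ j =>
      rw [hS1]
      refine tsum_congr fun b => ?_
      -- If `A z b` does not vanish then b ≥ z - κ, which exceeds the previous barrier because of
      -- the gap κ; there the recursion coincides with its data.
      by_cases hb : (κ : ℤ) < z - b
      · rw [hA z b hb, zero_mul, zero_mul]
      · have := hv j (by omega)
        simp only [hrec]
        rw [if_pos (by omega)]

end hrec

end

end EpiKernel

/-! ### ### Differences and decay of kernels, and the geometric symbol -/

namespace EpiKernel

open scoped Real
open Metric Set Complex Polynomial

noncomputable section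

theorem exists_rowSummable_contourKer {θ r : ℝ} {φ : ℂ → ℂ} (hr : 0 < r) (hrθ : r ≤ θ)
    (hφ : AnalyticOnNhd ℂ φ (annulus r θ)) : ∃ C, RowSummable (contourKer θ r φ) C := by
  refine ⟨∑' z, ‖contourKer θ r φ 0 z‖, fun x => ?_⟩
  have h := (summable_norm_contourKer hr hrθ hφ 0).hasSum
  rw [← (Equiv.subRight x).hasSum_iff] at h
  refine h.congr_fun fun z => ?_
  simp only [Function.comp_apply, Equiv.subRight_apply, contourKer_eq]
  rw [show 0 - (z - x) = x - z by ring]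

theorem laurentCoeff_mul_inv_sub_one {φ : ℂ → ℂ} {ρ : ℝ} (hρ : 0 < ρ)
    (hφ : ContinuousOn φ (sphere 0 ρ)) (m : ℤ) :
    laurentCoeff (fun w => φ w * (w⁻¹ - 1)) ρ m =
      laurentCoeff φ ρ (m + 1) - laurentCoeff φ ρ m := by
  have hint : ∀ k : ℤ, CircleIntegrable (fun w => φ w / w ^ k) 0 ρ := fun k =>
    (hφ.div (continuousOn_zpow_sphere hρ k) fun w hw =>
      zpow_ne_zero _ (ne_zero_of_norm_eq hρ (by simpa using hw))).circleIntegrable hρ.le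
  unfold laurentCoeff
  rw [← mul_sub, ← circleIntegral.integral_sub (hint _) (hint _)]
  congr 1
  refine circleIntegral.integral_congr hρ.le fun w hw => ?_
  have hw0 := ne_zero_of_norm_eq hρ (w := w) (by simpa using hw)
  have := zpow_ne_zero (m + 1) hw0
  simp only
  rw [zpow_add₀ hw0 (m + 1), zpow_one]
  field_simp

theorem contourKer_mul_inv_sub_one {θ ρ : ℝ} {φ : ℂ → ℂ} (hθ : θ ≠ 0) (hρ : 0 < ρ)
    (hφ : ContinuousOn φ (sphere 0 ρ)) (x y : ℤ) :
    contourKer θ ρ (fun w => φ w * (w⁻¹ - 1)) x y =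
      (θ : ℂ)⁻¹ * contourKer θ ρ φ (x + 1) y - contourKer θ ρ φ x y := by
  have hθc : (θ : ℂ) ≠ 0 := by exact_mod_cast hθ
  simp only [contourKer_eq]
  rw [laurentCoeff_mul_inv_sub_one hρ hφ, show x + 1 - y = (x - y) + 1 by ring, zpow_add₀ hθc,
    zpow_one]
  field_simp

theorem contourKer_add_add {θ ρ : ℝ} {φ : ℂ → ℂ} (x y k : ℤ) :
    contourKer θ ρ φ (x + k) (y + k) = contourKer θ ρ φ x y := by
  rw [contourKer_eq, contourKer_eq, add_sub_add_right_eq_sub]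

/-- Raising z by one multiplies the integrand by θ/(1-w), and 1/(1-w) - 1 = w/(1-w). The zero at w =
0 lowers the order of a pole by one. -/
theorem tdiff_resKer {θ δ : ℝ} {F : ℂ → ℂ} (hθ : θ ≠ 0) (hδ : 0 ≤ δ) (hδ1 : δ < 1)
    (hF : ContinuousOn F (sphere 0 δ)) (z u : ℤ) :
    tdiff θ (fun z => resKer θ δ F z u) z = resKer θ δ (fun w => F w * (w / (1 - w))) z u := by
  have hθc : (θ : ℂ) ≠ 0 := by exact_mod_cast hθ
  have hint : ∀ k : ℤ, CircleIntegrable (fun w => (1 - w) ^ k * F w) 0 δ := fun k =>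
    ((continuousOn_one_sub_zpow hδ1 k).mul hF).circleIntegrable hδ
  have e : (∮ w in C(0, δ), (1 - w) ^ (u - z) * (F w * (w / (1 - w)))) =
      (∮ w in C(0, δ), (1 - w) ^ (u - (z + 1)) * F w) -
        ∮ w in C(0, δ), (1 - w) ^ (u - z) * F w := by
    rw [← circleIntegral.integral_sub (hint _) (hint _)]
    refine circleIntegral.integral_congr hδ fun w hw => ?_
    have hw0 := one_sub_ne_zero hδ1 (w := w) (by simpa using hw.le)
    rw [show u - z = (u - (z + 1)) + 1 by ring, zpow_add₀ hw0, zpow_one]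
    field_simp
    ring
  simp only [tdiff, resKer]
  rw [e, show z + 1 - u = (z - u) + 1 by ring, zpow_add₀ hθc, zpow_one]
  field_simp

/-- The weight `θ^(-u) ((1 - δ)^u + (1 + δ)^u)`. -/
def resWeight (θ δ : ℝ) (u : ℤ) : ℝ := θ ^ (-u) * ((1 - δ) ^ u + (1 + δ) ^ u)

theorem resWeight_nonneg {θ δ : ℝ} (hθ : 0 < θ) (hδ : 0 < δ) (hδ1 : δ < 1) (u : ℤ) :
    0 ≤ resWeight θ δ u := by
  have h1 : 0 < 1 - δ := by linarith
  unfold resWeight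
  positivity

/-- The dependence on z is through (θ/t)^z with t = 1 ± δ. As θ < 1 - δ these decrease in z, so they
are bounded by their values at the barrier `v`; the remaining factor is `resWeight`. -/
theorem exists_norm_resKer_le {θ δ : ℝ} {F : ℂ → ℂ} (hθ : 0 < θ) (hδ : 0 < δ) (hθδ : θ < 1 - δ)
    (hF : ContinuousOn F (sphere 0 δ)) (v : ℤ) :
    ∃ C, ∀ u z, v < z → ‖resKer θ δ F z u‖ ≤ C * resWeight θ δ u := by
  obtain ⟨M, hM⟩ := (isCompact_sphere (0 : ℂ) δ).exists_bound_of_continuousOn hF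
  have hδ1 : 0 < 1 - δ := hθ.trans hθδ
  have hδ2 : 0 < 1 + δ := by linarith
  have hM0 : 0 ≤ M := (norm_nonneg _).trans (hM (δ : ℂ) (by simp [hδ.le]))
  refine ⟨δ * M * ((θ / (1 - δ)) ^ v + (θ / (1 + δ)) ^ v), fun u z hz => ?_⟩
  refine (norm_resKer_le hθ hδ.le (by linarith) (fun w hw => hM w (by simpa using hw)) z u).trans ?_
  rw [mul_assoc (δ * M)]
  refine mul_le_mul_of_nonneg_left ?_ (by positivity)
  have key : ∀ t : ℝ, θ < t → θ ^ (z - u) * t ^ (u - z) ≤ (θ / t) ^ v * (θ ^ (-u) * t ^ u) := by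
    intro t ht
    have ht0 : 0 < t := hθ.trans ht
    have : θ ^ (z - u) * t ^ (u - z) = (θ / t) ^ z * (θ ^ (-u) * t ^ u) := by
      rw [sub_eq_add_neg z u, sub_eq_add_neg u z, zpow_add₀ hθ.ne', zpow_add₀ ht0.ne', div_zpow,
        zpow_neg t z]
      field_simp
    rw [this]
    refine mul_le_mul_of_nonneg_right ?_ (by positivity)
    exact zpow_le_zpow_right_of_le_one₀ (by positivity) ((div_le_one ht0).mpr ht.le) hz.le
  have k1 := key (1 - δ) hθδ
  have k2 := key (1 + δ) (by linarith)
  have p1 : 0 ≤ (θ / (1 - δ)) ^ v * (θ ^ (-u) * (1 + δ) ^ u) := by positivity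
  have p2 : 0 ≤ (θ / (1 + δ)) ^ v * (θ ^ (-u) * (1 - δ) ^ u) := by positivity
  unfold resWeight
  calc θ ^ (z - u) * ((1 - δ) ^ (u - z) + (1 + δ) ^ (u - z))
      = θ ^ (z - u) * (1 - δ) ^ (u - z) + θ ^ (z - u) * (1 + δ) ^ (u - z) := by ring
    _ ≤ (θ / (1 - δ)) ^ v * (θ ^ (-u) * (1 - δ) ^ u) +
        (θ / (1 + δ)) ^ v * (θ ^ (-u) * (1 + δ) ^ u) := add_le_add k1 k2
    _ ≤ _ := by linarith

theorem isPolyLT_resKer {θ δ : ℝ} {F G : ℂ → ℂ} (hθ : θ ≠ 0) (hδ : 0 < δ) (hδ1 : δ < 1) {s : ℕ}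
    (hG : AnalyticOnNhd ℂ G (closedBall 0 δ)) (hF : ∀ w : ℂ, ‖w‖ = δ → F w = G w / w ^ (s + 1))
    (z : ℤ) : IsPolyLT (s + 1) fun u => (θ : ℂ) ^ u * resKer θ δ F z u := by
  have hθc : (θ : ℂ) ≠ 0 := by exact_mod_cast hθ
  obtain ⟨p, hp, hr⟩ := exists_resKer_eq_eval (θ := θ) hδ hδ1 hG hF
  refine ⟨Polynomial.C ((θ : ℂ) ^ z) * p.comp (X - Polynomial.C (z : ℂ)), ?_, fun u => ?_⟩
  · rw [degree_C_mul (zpow_ne_zero _ hθc)]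
    refine degree_le_natDegree.trans_lt ?_
    rw [natDegree_comp, natDegree_X_sub_C, mul_one]
    exact_mod_cast Nat.lt_succ_of_le hp
  · simp only [hr]
    rw [← mul_assoc, ← zpow_add₀ hθc, add_sub_cancel]
    simp

/-- Inside the unit disc the binomial series gives binom(m-1, s) as the coefficient of w^m for m ≥
1, and no other powers occur: a small contour truncates the polynomial kernel `Qbar0` to x > y. -/
theorem contourKer_geometric {θ ρ : ℝ} (hρ : 0 < ρ) (hρ1 : ρ < 1) (s : ℕ) (x y : ℤ) :
    contourKer θ ρ (fun w => (w / (1 - w)) ^ (s + 1)) x y =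
      if y < x then Qbar0 θ (s + 1) x y else 0 := by
  set c : ℤ → ℂ := fun m => if 1 ≤ m then (((m - 1).toNat.choose s : ℕ) : ℂ) else 0 with hc
  have hinj : Function.Injective fun n : ℕ => ((n + s + 1 : ℕ) : ℤ) := fun n n' h => by
    simp only at h; omega
  have hcn : ∀ n : ℕ, c ((n + s + 1 : ℕ) : ℤ) = ((n + s).choose s : ℕ) := fun n => by
    simp only [hc]
    rw [if_pos (by omega)]
    congr 2
    omega
  have hsupp : ∀ m : ℤ, m ∉ Set.range (fun n : ℕ => ((n + s + 1 : ℕ) : ℤ)) → c m = 0 := by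
    intro m hm
    simp only [hc]
    split_ifs with h
    · have : (m - 1).toNat < s := by
        by_contra hlt
        exact hm ⟨(m - 1).toNat - s, by simp only; omega⟩
      rw [Nat.choose_eq_zero_of_lt this, Nat.cast_zero]
    · rfl
  have hL : HasLaurent (fun w => (w / (1 - w)) ^ (s + 1)) ρ c := by
    constructor
    · rw [← hinj.summable_iff fun m hm => by rw [hsupp m hm, norm_zero, zero_mul]]
      have := (summable_choose_mul_geometric_of_norm_lt_one s (r := ρ)
        (by rwa [Real.norm_of_nonneg hρ.le])).mul_right (ρ ^ (s + 1))
      refine this.congr fun n => ?_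
      simp only [Function.comp_apply, hcn, zpow_natCast, Complex.norm_natCast]
      rw [mul_assoc, ← pow_add, add_assoc]
    · intro w hw
      rw [← hinj.hasSum_iff fun m hm => by rw [hsupp m hm, zero_mul]]
      have := (hasSum_choose_mul_geometric_of_norm_lt_one s (r := w)
        (by rwa [hw])).mul_right (w ^ (s + 1))
      rw [one_div, ← div_eq_inv_mul, ← div_pow] at this
      refine this.congr_fun fun n => ?_
      simp only [Function.comp_apply, hcn, zpow_natCast]
      rw [mul_assoc, ← pow_add, add_assoc]
  rw [contourKer_of_hasLaurent hρ hL]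
  simp only [hc]
  by_cases hxy : y < x
  · rw [if_pos hxy, if_pos (by omega), Qbar0, Nat.add_sub_cancel, mul_div_assoc]
    congr 1
    obtain ⟨n, hn⟩ : ∃ n : ℕ, x - y - 1 = n := ⟨(x - y - 1).toNat, by omega⟩
    have h1 : ∏ i ∈ Finset.range s, ((x - y - 1 - i : ℤ) : ℂ) = (n.descFactorial s : ℂ) := by
      rw [← descPochhammer_eval_eq_descFactorial, descPochhammer_eval_eq_prod_range]
      refine Finset.prod_congr rfl fun i _ => ?_
      rw [hn]
      push_cast
      ring
    rw [h1, hn, Int.toNat_natCast, Nat.descFactorial_eq_factorial_mul_choose, Nat.cast_mul,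
      mul_div_cancel_left₀]
    exact_mod_cast s.factorial_ne_zero
  · rw [if_neg hxy, if_neg (by omega), mul_zero]

end

end EpiKernel

/-! ### ### Relations between `Q`, `A` and the difference operator, and the telescoping sum -/

namespace EpiKernel

open scoped Real
open Metric Set Complex Polynomial

noncomputable section

namespace Model

variable {κ : ℕ} {θ : ℝ} {q : ℤ → ℝ} {a ψ : ℂ → ℂ} {r R δ : ℝ}

theorem Aker_eq_zero (h : Model κ θ q a ψ r R) {z b : ℤ} (hzb : (κ : ℤ) < z - b) :
    Aker θ q z b = 0 := by
  rw [Aker, h.q_eq_one _ hzb, h.q_eq_one _ (by omega)]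
  simp

theorem Aker_eq_tdiff (h : Model κ θ q a ψ r R) (z b : ℤ) :
    Aker θ q z b = (θ : ℂ)⁻¹ * Qker θ q (z + 1) b - Qker θ q z b := by
  have := h.θ_ne
  simp only [Aker, Qker, stepProb]
  rw [show z + 1 - b = (z - b) + 1 by ring, zpow_add₀ h.θ_pos.ne', zpow_one]
  push_cast
  field_simp

theorem kpow_Aker_eq_zero (h : Model κ θ q a ψ r R) (p : ℕ) {z b : ℤ}
    (hzb : (κ * p : ℤ) < z - b) : kpow (Aker θ q) p z b = 0 := by
  induction p generalizing b with
  | zero =>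
    rw [kpow, idKer, if_neg]
    rintro rfl
    simp at hzb
  | succ p ih =>
    rw [kpow, comp]
    convert tsum_zero with c
    by_cases hc : (κ * p : ℤ) < z - c
    · rw [ih hc, zero_mul]
    · rw [h.Aker_eq_zero, mul_zero]
      push_cast at hzb
      linarith

/-- The factor `A` turns `Q⁻¹` into a first-order difference operator. -/
theorem invSym_mul_aSym (h : Model κ θ q a ψ r R) {w : ℂ} (hw : w ∈ annulus r R) :
    invSym θ q a w * aSym θ q a w = w⁻¹ - 1 := by
  have h1 := h.ne_zero_of_mem hw.1
  have h2 := h.a_ne w hw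
  have h3 := h.alpha_ne
  rw [invSym, aSym]
  field_simp

theorem mem_sphere (h : Model κ θ q a ψ r R) {w : ℂ} (hw : ‖w‖ = r) : w ∈ annulus r R ∧ w ≠ 1 :=
  h.mem_of_lt_one h.r_lt_one ⟨hw.ge, hw.le⟩

theorem exists_rowSummable_Q (h : Model κ θ q a ψ r R) : ∃ C, RowSummable (Qker θ q) C := by
  rw [h.Qker_eq]
  exact exists_rowSummable_contourKer h.r_pos h.r_lt.le (h.invSym_inv_an h.θ_lt)

theorem exists_rowSummable_A (h : Model κ θ q a ψ r R) : ∃ C, RowSummable (Aker θ q) C := by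
  rw [h.Aker_eq]
  exact exists_rowSummable_contourKer h.r_pos h.r_lt.le h.aSym_an

theorem exists_rowSummable_RQpow (h : Model κ θ q a ψ r R) (k : ℤ) :
    ∃ C, RowSummable (RQpow θ q a ψ r (-k)) C := by
  rw [h.RQpow_eq]
  exact exists_rowSummable_contourKer h.r_pos h.r_lt.le (h.RQ_an h.θ_lt k)

theorem exists_rowSummable_RQpow_A (h : Model κ θ q a ψ r R) (k : ℤ) :
    ∃ C, RowSummable (comp (RQpow θ q a ψ r (-k)) (Aker θ q)) C := by
  rw [h.RQpow_A_eq]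
  exact exists_rowSummable_contourKer h.r_pos h.r_lt.le ((h.RQ_an h.θ_lt k).mul h.aSym_an)

theorem RQpow_A_apply (h : Model κ θ q a ψ r R) (k x z : ℤ) :
    comp (RQpow θ q a ψ r (-k)) (Aker θ q) x z =
      (θ : ℂ)⁻¹ * RQpow θ q a ψ r (-(k - 1)) x (z - 1) - RQpow θ q a ψ r (-(k - 1)) x z := by
  have e : contourKer θ r (fun w => invSym θ q a w ^ k * ψ w * aSym θ q a w) =
      contourKer θ r fun w => invSym θ q a w ^ (k - 1) * ψ w * (w⁻¹ - 1) := by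
    refine contourKer_congr h.r_pos.le fun w hw => ?_
    obtain ⟨h1, h2⟩ := h.mem_sphere hw
    rw [← h.invSym_mul_aSym h1, zpow_sub_one₀ (h.invSym_ne h1 h2)]
    have := h.invSym_ne h1 h2
    field_simp
  rw [h.RQpow_A_eq, e, contourKer_mul_inv_sub_one h.θ_pos.ne' h.r_pos
    (sphere_an (h.RQ_an h.θ_lt (k - 1)) h.r_lt.le).continuousOn, h.RQpow_eq,
    ← contourKer_add_add x (z - 1) 1, sub_add_cancel]

/-- Summation by parts: Q⁻¹ A has symbol 1/w - 1, which acts on the right as D. Boundedness of `f`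
and summability of the rows justify splitting the sum. -/
theorem kact_RQpow_A (h : Model κ θ q a ψ r R) (k : ℤ) {f : ℤ → ℂ} {M : ℝ}
    (hf : ∀ z, ‖f z‖ ≤ M) (x : ℤ) :
    kact (comp (RQpow θ q a ψ r (-k)) (Aker θ q)) f x =
      kact (RQpow θ q a ψ r (-(k - 1))) (tdiff θ f) x := by
  obtain ⟨C, hC⟩ := h.exists_rowSummable_RQpow (k - 1)
  have s1 := (hC.summable_mul (f := fun z => f (z + 1)) (fun z => hf _) x).mul_left (θ : ℂ)⁻¹
  have s2 := hC.summable_mul hf x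
  have s3 := s1
  rw [← (Equiv.subRight (1 : ℤ)).summable_iff] at s3
  have e : ∑' z, (θ : ℂ)⁻¹ * (RQpow θ q a ψ r (-(k - 1)) x z * f (z + 1)) =
      ∑' z, (θ : ℂ)⁻¹ * (RQpow θ q a ψ r (-(k - 1)) x (z - 1) * f z) := by
    rw [← (Equiv.subRight (1 : ℤ)).tsum_eq]
    simp
  have s3' : Summable fun z => (θ : ℂ)⁻¹ * (RQpow θ q a ψ r (-(k - 1)) x (z - 1) * f z) := by
    refine s3.congr fun z => ?_
    simp
  have t1 : kact (RQpow θ q a ψ r (-(k - 1))) (tdiff θ f) x =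
      ∑' z, ((θ : ℂ)⁻¹ * (RQpow θ q a ψ r (-(k - 1)) x z * f (z + 1)) -
        RQpow θ q a ψ r (-(k - 1)) x z * f z) :=
    tsum_congr fun z => by rw [tdiff]; ring
  rw [t1, s1.tsum_sub s2, e, ← s3'.tsum_sub s2]
  refine tsum_congr fun z => ?_
  rw [h.RQpow_A_apply]
  ring

/-- Each step turns R Q^(-k) A f_(n+1) into R Q^(-(k-1)) A f_n plus the contribution of one jump;
the process stops at f_0 = 0. -/
theorem kact_RQpow_A_telescope (h : Model κ θ q a ψ r R) {f : ℕ → ℤ → ℂ} {c : ℕ → ℂ} {v : ℕ → ℤ}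
    (h0 : f 0 = fun _ => 0) (n : ℕ) (hb : ∀ j ≤ n, ∃ M, ∀ z, ‖f j z‖ ≤ M)
    (hstep : ∀ j < n, ∀ z, tdiff θ (f (j + 1)) z =
      kact (Aker θ q) (f j) z + if z = v j then c j else 0) (k x : ℤ) :
    kact (comp (RQpow θ q a ψ r (-k)) (Aker θ q)) (f n) x =
      ∑ j ∈ Finset.range n, RQpow θ q a ψ r (-(k - n + j)) x (v j) * c j := by
  induction n generalizing k with
  | zero => simp [h0, kact]
  | succ n ih =>
    obtain ⟨M, hM⟩ := hb (n + 1) le_rfl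
    obtain ⟨M', hM'⟩ := hb n (by omega)
    obtain ⟨C, hC⟩ := h.exists_rowSummable_RQpow (k - 1)
    obtain ⟨C', hC'⟩ := h.exists_rowSummable_A
    have s1 := hC.summable_mul (hC'.norm_kact_le hM') x
    have s2 : HasSum (fun z => RQpow θ q a ψ r (-(k - 1)) x z * if z = v n then c n else 0)
        (RQpow θ q a ψ r (-(k - 1)) x (v n) * c n) := by
      convert! hasSum_ite_eq (v n) (RQpow θ q a ψ r (-(k - 1)) x (v n) * c n) using 2 with z
      split_ifs with hz
      · rw [hz]
      · rw [mul_zero]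
    have e : kact (RQpow θ q a ψ r (-(k - 1))) (tdiff θ (f (n + 1))) x =
        kact (RQpow θ q a ψ r (-(k - 1))) (kact (Aker θ q) (f n)) x +
          RQpow θ q a ψ r (-(k - 1)) x (v n) * c n := by
      rw [← s2.tsum_eq, kact, kact, ← s1.tsum_add s2.summable]
      refine tsum_congr fun z => ?_
      rw [hstep n (by omega)]
      ring
    rw [h.kact_RQpow_A k hM, e, hC.kact_kact hC' hM',
      ih (fun j hj => hb j (by omega)) (fun j hj => hstep j (by omega)), Finset.sum_range_succ]
    congr 1
    · refine Finset.sum_congr rfl fun j _ => ?_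
      rw [show k - 1 - (n : ℤ) + j = k - ((n + 1 : ℕ) : ℤ) + j by push_cast; ring]
    · rw [show k - ((n + 1 : ℕ) : ℤ) + n = k - 1 by push_cast; ring]

/-! ### The residue kernels `Sbar` -/

/-- The kernel `Sbar_{j+1}`, with a small contour. -/
def barKer (θ : ℝ) (q : ℤ → ℝ) (a ψ : ℂ → ℂ) (δ : ℝ) (j : ℕ) (z u : ℤ) : ℂ :=
  resKer θ δ (fun w => barSym θ q a j w * (ψ (1 - w))⁻¹) z u

theorem barKer_continuousOn (h : Model κ θ q a ψ r R) (hδ : GoodRadius r R δ) (k : ℤ) :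
    ContinuousOn (fun w => barSym θ q a k w * (ψ (1 - w))⁻¹) (sphere 0 δ) :=
  (h.barSym_continuousOn hδ k).mul (comp_one_sub_continuousOn hδ h.ψ_inv_an)

theorem tdiff_barKer_zero (h : Model κ θ q a ψ r R) (hδ : GoodRadius r R δ) (z u : ℤ) :
    tdiff θ (fun z => barKer θ q a ψ δ 0 z u) z = 0 := by
  simp only [barKer]
  rw [tdiff_resKer h.θ_pos.ne' hδ.pos.le hδ.lt_one (h.barKer_continuousOn hδ _),
    resKer_eq_zero hδ.pos hδ.lt_one (G := fun w => (1 - w)⁻¹ * (ψ (1 - w))⁻¹)]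
  · rfl
  · intro w hw
    have h1 : AnalyticAt ℂ (fun w : ℂ => 1 - w) w := by fun_prop
    exact (h1.inv (one_sub_ne_zero hδ.lt_one (by simpa using hw))).mul
      (comp_one_sub_an hδ h.ψ_inv_an w hw)
  · intro w hw
    have := ne_zero_of_norm_eq hδ.pos hw
    simp only [barSym, Nat.cast_zero, neg_zero, zpow_zero, one_mul]
    field_simp

/-- The factor w/(1-w) produced by D is `invSym * aSym` at 1 - w: the first lowers the index of
`barSym`, the second is the symbol of `A`. -/
theorem tdiff_barKer_succ (h : Model κ θ q a ψ r R) (hδ : GoodRadius r R δ) (j : ℕ) (z u : ℤ) :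
    tdiff θ (fun z => barKer θ q a ψ δ (j + 1) z u) z =
      kact (Aker θ q) (fun z => barKer θ q a ψ δ j z u) z := by
  simp only [barKer, kact]
  rw [tdiff_resKer h.θ_pos.ne' hδ.pos.le hδ.lt_one (h.barKer_continuousOn hδ _), h.Aker_eq,
    (hδ.hasSum_contourKer_resKer h.θ_pos.ne' h.aSym_an (h.barKer_continuousOn hδ _) z u).tsum_eq]
  refine congrFun (congrFun (resKer_congr hδ.pos.le fun w hw => ?_) z) u
  have hm := hδ.mem hw.le
  have hw0 := ne_zero_of_norm_eq hδ.pos hw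
  have h1 := one_sub_ne_zero hδ.lt_one hw.le
  have hi := h.invSym_ne hm (by simpa using hw0)
  have e : w / (1 - w) = invSym θ q a (1 - w) * aSym θ q a (1 - w) := by
    rw [h.invSym_mul_aSym hm]
    field_simp
    ring
  rw [e]
  simp only [barSym]
  rw [show -((j + 1 : ℕ) : ℤ) = -(j : ℤ) - 1 by push_cast; ring, zpow_sub_one₀ hi]
  field_simp

theorem isPolyLT_barKer (h : Model κ θ q a ψ r R) (hδ : GoodRadius r R δ) (j : ℕ) (z : ℤ) :
    IsPolyLT (j + 1) fun u => (θ : ℂ) ^ u * barKer θ q a ψ δ j z u := by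
  refine isPolyLT_resKer h.θ_pos.ne' hδ.pos hδ.lt_one
    (G := fun w => (1 - w) ^ j * aSym θ q a (1 - w) ^ j * (ψ (1 - w))⁻¹) ?_ (fun w hw => ?_) z
  · intro w hw
    have h1 : AnalyticAt ℂ (fun w : ℂ => (1 - w) ^ j) w := by fun_prop
    exact (h1.mul ((comp_one_sub_an hδ h.aSym_an w hw).pow j)).mul
      (comp_one_sub_an hδ h.ψ_inv_an w hw)
  · rw [h.barSym_natCast hδ hw]
    ring

/-- Composition with R Q^(-l) on the right cancels 1/ψ(1-w) and lowers the index of `barSym` by l.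
-/
theorem hasSum_Psi_barKer (h : Model κ θ q a ψ r R) (hδ : GoodRadius r R δ) (l j : ℕ) (z y : ℤ) :
    HasSum (fun u => RQpow θ q a ψ r (-(l : ℤ)) u y * barKer θ q a ψ δ j z u)
      (resKer θ δ (barSym θ q a (j - l)) z y) := by
  have key := hδ.hasSum_resKer_contourKer h.θ_pos.ne' (h.RQ_an_annulus l)
    (h.barKer_continuousOn hδ j) z y
  rw [← h.RQpow_eq] at key
  have e : resKer θ δ (barSym θ q a (j - l)) = resKer θ δ fun w =>
      barSym θ q a j w * (ψ (1 - w))⁻¹ * (invSym θ q a (1 - w) ^ (l : ℤ) * ψ (1 - w)) := by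
    refine resKer_congr hδ.pos.le fun w hw => ?_
    have hm := hδ.mem hw.le
    have hw0 := ne_zero_of_norm_eq hδ.pos hw
    have hi := h.invSym_ne hm (by simpa using hw0)
    have hψ := h.ψ_ne _ hm
    simp only [barSym]
    rw [neg_sub, show (l : ℤ) - j = -(j : ℤ) + l by ring, zpow_add₀ hi]
    field_simp
  rw [e]
  exact key.congr_fun fun u => mul_comm _ _

/-- For l ≥ 0 the symbol has no pole at 1, so its Laurent series converges absolutely on both
circles |w| = 1 - δ and |w| = 1 + δ. -/
theorem summable_Psi_resWeight (h : Model κ θ q a ψ r R) (hδ : GoodRadius r R δ) (l : ℕ) (y : ℤ) :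
    Summable fun u => ‖RQpow θ q a ψ r (-(l : ℤ)) u y‖ * resWeight θ δ u := by
  have h1' : 0 < 1 - δ := by linarith [hδ.lt_one]
  have h2' : 0 < 1 + δ := by linarith [hδ.pos]
  have s1 := (hasLaurent_of_analyticOnNhd h.r_pos (h.RQ_an_annulus l) hδ.le_sub
    (by linarith [hδ.pos, hδ.add_le])).summable
  have s2 := (hasLaurent_of_analyticOnNhd h.r_pos (h.RQ_an_annulus l) (ρ := 1 + δ)
    (by linarith [hδ.pos, hδ.le_sub]) hδ.add_le).summable
  rw [← (Equiv.subRight y).summable_iff] at s1 s2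
  have s := (((s1.mul_right ((1 - δ) ^ y)).add (s2.mul_right ((1 + δ) ^ y)))).mul_left (θ ^ (-y))
  refine s.congr fun u => ?_
  have hθ := h.θ_pos
  simp only [Function.comp_apply, Equiv.subRight_apply, h.RQpow_eq, contourKer_eq, resWeight]
  rw [norm_mul, norm_zpow, Complex.norm_real, Real.norm_of_nonneg h.θ_pos.le, zpow_sub₀ h1'.ne',
    zpow_sub₀ h2'.ne', sub_eq_add_neg, zpow_add₀ hθ.ne', zpow_neg, zpow_neg]
  field_simp

/-- A positive power of `invSym (1 - w)` vanishes at w = 0 and cancels the pole of 1/w. -/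
theorem resKer_barSym_eq_zero (h : Model κ θ q a ψ r R) (hδ : GoodRadius r R δ) {k : ℤ}
    (hk : k < 0) (z u : ℤ) : resKer θ δ (barSym θ q a k) z u = 0 := by
  obtain ⟨p, hp⟩ : ∃ p : ℕ, -k = (p + 1 : ℕ) := ⟨(-k - 1).toNat, by omega⟩
  rw [resKer_eq_zero hδ.pos hδ.lt_one
    (G := fun w => w ^ p * ((1 - w) * aSym θ q a (1 - w))⁻¹ ^ (p + 1))]
  · rfl
  · intro w hw
    have h1 : AnalyticAt ℂ (fun w : ℂ => 1 - w) w := by fun_prop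
    exact (analyticAt_id.pow p).mul (((h1.mul (comp_one_sub_an hδ h.aSym_an w hw)).inv
      (mul_ne_zero (one_sub_ne_zero hδ.lt_one (by simpa using hw))
        (h.aSym_ne (hδ.mem (by simpa using hw))))).pow _)
  · intro w hw
    have hw0 := ne_zero_of_norm_eq hδ.pos hw
    rw [barSym, hp, zpow_natCast, invSym_one_sub, mul_pow, pow_succ w]
    field_simp

end Model

end

end EpiKernel

namespace EpiKernel

open scoped Real
open Metric Set Complex Polynomial

noncomputable section

namespace Model

variable {κ : ℕ} {θ : ℝ} {q : ℤ → ℝ} {a ψ : ℂ → ℂ} {r R δ : ℝ}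

/-! ### The kernels `A⁻¹ Q^(s+1)` -/

/-- The kernel `A⁻¹ Q^(s+1)`. -/
def invAQ (θ : ℝ) (q : ℤ → ℝ) (a : ℂ → ℂ) (r : ℝ) (s : ℕ) : ℤ → ℤ → ℂ :=
  contourKer θ r fun w => aSym θ q a w ^ s * (w / (1 - w)) ^ (s + 1)

theorem geometric_an {r ρ : ℝ} (hρ : ρ < 1) (s : ℕ) :
    AnalyticOnNhd ℂ (fun w : ℂ => (w / (1 - w)) ^ s) (annulus r ρ) := by
  intro w hw
  have h1 : AnalyticAt ℂ (fun w : ℂ => 1 - w) w := by fun_prop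
  refine (analyticAt_id.div h1 ?_).pow s
  rw [sub_ne_zero]
  rintro rfl
  have := hw.2
  rw [norm_one] at this
  linarith

theorem invAQ_sphere_an (h : Model κ θ q a ψ r R) (p s : ℕ) :
    AnalyticOnNhd ℂ (fun w => aSym θ q a w ^ p * (w / (1 - w)) ^ s) (sphere 0 r) :=
  sphere_an ((h.aSym_an.fun_pow p).mul (geometric_an h.r_lt_one s)) le_rfl

theorem invAQ_zero_eq_zero (h : Model κ θ q a ψ r R) {z u : ℤ} (hz : z ≤ u) :
    invAQ θ q a r 0 z u = 0 := by
  simp only [invAQ, pow_zero, one_mul]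
  rw [contourKer_geometric h.r_pos h.r_lt_one, if_neg (by omega)]

/-- Both sides are A^s composed with `Qbar0`, truncated to b > u on the left and not truncated on
the right. As A^s(z,b) vanishes for z - b > κ s, only b ≥ z - κ s > u contribute, where the two
agree. -/
theorem invAQ_eq_resKer (h : Model κ θ q a ψ r R) (hδ : GoodRadius r R δ) (s : ℕ) {z u : ℤ}
    (hz : (κ * s : ℤ) < z - u) : invAQ θ q a r s z u = resKer θ δ (barSym θ q a s) z u := by
  have k1 := hasSum_comp_contourKer h.θ_pos.ne' h.r_pos
    (sphere_an (h.aSym_an.fun_pow s) h.r_le_R)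
    (sphere_an (geometric_an h.r_lt_one (s + 1)) le_rfl) z u
  have k2 := h.hasSum_Qbar hδ s s z u
  have e : resKer θ δ (barSym θ q a s) = resKer θ δ fun w =>
      (1 - w) ^ s / w ^ (s + 1) * aSym θ q a (1 - w) ^ s :=
    resKer_congr hδ.pos.le fun w hw => h.barSym_natCast hδ hw s
  rw [e]
  refine k1.unique (k2.congr_fun fun b => ?_)
  rw [← h.kpow_A_eq]
  by_cases hb : (κ * s : ℤ) < z - b
  · rw [h.kpow_Aker_eq_zero s hb, zero_mul, zero_mul]
  · rw [contourKer_geometric h.r_pos h.r_lt_one, if_pos (by linarith)]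

theorem kact_Q_invAQ (h : Model κ θ q a ψ r R) (s : ℕ) (z u : ℤ) :
    kact (Qker θ q) (fun b => invAQ θ q a r s b u) z = invAQ θ q a r (s + 1) z u := by
  rw [h.Qker_eq, kact, invAQ, (hasSum_comp_contourKer h.θ_pos.ne' h.r_pos
    (sphere_an (h.invSym_inv_an h.θ_lt) h.r_lt.le) (h.invAQ_sphere_an _ _) z u).tsum_eq, invAQ]
  refine congrFun (congrFun (contourKer_congr h.r_pos.le fun w hw => ?_) z) u
  obtain ⟨h1, h2⟩ := h.mem_sphere hw
  have e : (invSym θ q a w)⁻¹ = aSym θ q a w * (w / (1 - w)) := by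
    rw [invSym, aSym, mul_inv, inv_inv, inv_div]
    ring
  rw [e]
  ring

theorem kact_A_invAQ (h : Model κ θ q a ψ r R) (s : ℕ) (z u : ℤ) :
    kact (Aker θ q) (fun b => invAQ θ q a r s b u) z =
      tdiff θ (fun b => invAQ θ q a r (s + 1) b u) z := by
  simp only [tdiff, invAQ]
  rw [← contourKer_mul_inv_sub_one h.θ_pos.ne' h.r_pos
    (h.invAQ_sphere_an (s + 1) (s + 1 + 1)).continuousOn, h.Aker_eq, kact,
    (hasSum_comp_contourKer h.θ_pos.ne' h.r_pos
    (sphere_an h.aSym_an h.r_le_R) (h.invAQ_sphere_an _ _) z u).tsum_eq]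
  refine congrFun (congrFun (contourKer_congr h.r_pos.le fun w hw => ?_) z) u
  obtain ⟨h1, h2⟩ := h.mem_sphere hw
  have hw0 := h.ne_zero_of_mem h1.1
  have hw1 : 1 - w ≠ 0 := sub_ne_zero.mpr h2.symm
  rw [pow_succ (w / (1 - w)) (s + 1), pow_succ (aSym θ q a w) s]
  have : w / (1 - w) * (w⁻¹ - 1) = 1 := by field_simp
  linear_combination (-(aSym θ q a w ^ s * aSym θ q a w * (w / (1 - w)) ^ (s + 1))) * this

theorem add_mul_le {v : ℕ → ℤ} {n : ℕ} (hv : ∀ j, j + 1 < n → v j + κ ≤ v (j + 1)) (l s : ℕ)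
    (hls : l + s < n) : v l + κ * s ≤ v (l + s) := by
  induction s with
  | zero => simp
  | succ s ih =>
    have := hv (l + s) (by omega)
    have := ih (by omega)
    push_cast
    rw [← add_assoc]
    linarith

/-- The recursion is trivial up to step l and then produces the truncated kernel A⁻¹ Q. Afterwards,
above the barrier v_(l+s) ≥ v_l + κ s the data equal A⁻¹ Q^(s+1), and below it applying `Q` to the
previous step gives the same kernel. -/
theorem hrec_resKer (h : Model κ θ q a ψ r R) (hδ : GoodRadius r R δ) {v : ℕ → ℤ} {n : ℕ}
    (hv : ∀ j, j + 1 < n → v j + κ ≤ v (j + 1)) (l s : ℕ) (hls : l + s < n) :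
    hrec (Qker θ q) v (fun j z => resKer θ δ (barSym θ q a ((j : ℤ) - l)) z (v l)) (l + s + 1) =
      fun z => invAQ θ q a r s z (v l) := by
  induction s with
  | zero =>
    funext z
    simp only [hrec]
    rw [hrec_eq_zero (l := l) (fun j hj z => h.resKer_barSym_eq_zero hδ (by omega) _ _) l le_rfl]
    split_ifs with hz
    · rw [sub_self, h.invAQ_eq_resKer hδ 0 (by simpa using hz), Nat.cast_zero]
    · rw [h.invAQ_zero_eq_zero (by omega)]
      simp [kact]
  | succ s ih =>
    funext z
    rw [← add_assoc, hrec, ih (by omega)]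
    beta_reduce
    split_ifs with hz
    · rw [h.invAQ_eq_resKer hδ (s + 1)]
      · congr 2
        push_cast
        ring
      · have := add_mul_le (κ := κ) hv l (s + 1) hls
        rw [← add_assoc] at this
        linarith
    · rw [h.kact_Q_invAQ]

/-! ### The biorthogonal functions -/

/-- The jump at `v j` of `tdiff` of the `j+1`-st function of the recursion. -/
def jump (θ : ℝ) (q : ℤ → ℝ) (v : ℕ → ℤ) (S : ℕ → ℤ → ℂ) (j : ℕ) : ℂ :=
  tdiff θ (hrec (Qker θ q) v S (j + 1)) (v j) - kact (Aker θ q) (hrec (Qker θ q) v S j) (v j)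

/-- For j < l everything is zero. For j > l the functions are A⁻¹ Q^(s+1) and A⁻¹ Q^(s+2), related
by D at every point. For j = l the previous function is 0 and the new one is θ^(z - v_l) for z > v_l
and 0 at v_l, so the jump is θ⁻¹ θ = 1. -/
theorem jump_resKer (h : Model κ θ q a ψ r R) (hδ : GoodRadius r R δ) {v : ℕ → ℤ} {n : ℕ}
    (hv : ∀ j, j + 1 < n → v j + κ ≤ v (j + 1)) {l j : ℕ} (hl : l < n) (hj : j < n) :
    jump θ q v (fun j z => resKer θ δ (barSym θ q a ((j : ℤ) - l)) z (v l)) j =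
      if l = j then 1 else 0 := by
  have hzero := hrec_eq_zero (Q := Qker θ q) (v := v)
    (S := fun j z => resKer θ δ (barSym θ q a ((j : ℤ) - l)) z (v l)) (l := l)
    fun j hj z => h.resKer_barSym_eq_zero hδ (by omega) _ _
  unfold jump
  rcases lt_trichotomy j l with hjl | rfl | hjl
  · rw [hzero j hjl.le, hzero (j + 1) hjl, if_neg (by omega)]
    simp [tdiff, kact]
  · have h1 := h.hrec_resKer hδ hv j 0 (by omega)
    rw [add_zero] at h1
    rw [hzero j le_rfl, h1, if_pos rfl, tdiff, h.invAQ_zero_eq_zero le_rfl]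
    simp only [invAQ, pow_zero, one_mul]
    rw [contourKer_geometric h.r_pos h.r_lt_one, if_pos (by omega)]
    have := h.θ_ne
    simp [Qbar0, kact, this]
  · obtain ⟨s, rfl⟩ : ∃ s, j = l + s + 1 := ⟨j - l - 1, by omega⟩
    rw [h.hrec_resKer hδ hv l s (by omega), h.kact_A_invAQ, if_neg (by omega)]
    have := h.hrec_resKer hδ hv l (s + 1) (by omega)
    rw [← add_assoc] at this
    rw [this, sub_self]

section jump

variable {v : ℕ → ℤ} {n : ℕ}

theorem exists_norm_barKer_le (h : Model κ θ q a ψ r R) (hδ : GoodRadius r R δ) (hθδ : θ < 1 - δ)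
    (j : ℕ) (v : ℤ) : ∃ C, ∀ u z, v < z → ‖barKer θ q a ψ δ j z u‖ ≤ C * resWeight θ δ u :=
  exists_norm_resKer_le h.θ_pos hδ.pos hθδ (h.barKer_continuousOn hδ j) v

theorem resWeight_nonneg' (h : Model κ θ q a ψ r R) (hδ : GoodRadius r R δ) (u : ℤ) :
    0 ≤ resWeight θ δ u := resWeight_nonneg h.θ_pos hδ.pos hδ.lt_one u

theorem exists_norm_hrec_le (h : Model κ θ q a ψ r R) (hδ : GoodRadius r R δ) (hθδ : θ < 1 - δ)
    (v : ℕ → ℤ) (j : ℕ) : ∃ C, ∀ u z,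
      ‖hrec (Qker θ q) v (fun j z => barKer θ q a ψ δ j z u) j z‖ ≤ C * resWeight θ δ u := by
  obtain ⟨C, hC⟩ := h.exists_rowSummable_Q
  exact hrec_bounded_family (S := fun u j z => barKer θ q a ψ δ j z u) (n := j) hC
    (h.resWeight_nonneg' hδ) (fun j _ => h.exists_norm_barKer_le hδ hθδ j (v j)) j le_rfl

/-- The jump is linear in the data of the recursion, so summing over u replaces the data `barKer` by
their sums against Ψ. -/
theorem hasSum_Psi_jump (h : Model κ θ q a ψ r R) (hδ : GoodRadius r R δ) (hθδ : θ < 1 - δ)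
    (v : ℕ → ℤ) (l j : ℕ) (y : ℤ) :
    HasSum (fun u => RQpow θ q a ψ r (-(l : ℤ)) u y *
        jump θ q v (fun j z => barKer θ q a ψ δ j z u) j)
      (jump θ q v (fun j z => resKer θ δ (barSym θ q a ((j : ℤ) - l)) z y) j) := by
  obtain ⟨CQ, hCQ⟩ := h.exists_rowSummable_Q
  obtain ⟨CA, hCA⟩ := h.exists_rowSummable_A
  have hs := h.summable_Psi_resWeight hδ l y
  have key := fun (i : ℕ) => hasSum_hrec (S := fun u j z => barKer θ q a ψ δ j z u) (n := i) hCQ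
    (h.resWeight_nonneg' hδ) hs (fun j _ => h.exists_norm_barKer_le hδ hθδ j (v j))
    (fun j _ z => h.hasSum_Psi_barKer hδ l j z y) i le_rfl
  obtain ⟨C, hC⟩ := h.exists_norm_hrec_le (ψ := ψ) hδ hθδ v j
  have k1 := ((key (j + 1) (v j + 1)).mul_left (θ : ℂ)⁻¹).sub (key (j + 1) (v j))
  have k2 := hasSum_mul_tsum (hCA (v j)).summable (hs.mul_left C) (fun u b => by
    rw [norm_mul]
    have := hC u b
    calc _ ≤ ‖RQpow θ q a ψ r (-(l : ℤ)) u y‖ * (C * resWeight θ δ u) := by gcongr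
      _ = _ := by ring) (key j)
  refine (k1.sub k2).congr_fun fun u => ?_
  simp only [jump, tdiff, kact]
  ring

theorem isPolyLT_jump (h : Model κ θ q a ψ r R) (hδ : GoodRadius r R δ) (hθδ : θ < 1 - δ)
    (v : ℕ → ℤ) (j : ℕ) : IsPolyLT (j + 1) fun u =>
      (θ : ℂ) ^ u * jump θ q v (fun j z => barKer θ q a ψ δ j z u) j := by
  obtain ⟨CQ, hCQ⟩ := h.exists_rowSummable_Q
  obtain ⟨CA, hCA⟩ := h.exists_rowSummable_A
  have key := fun (i : ℕ) => isPolyLT_hrec (S := fun u j z => barKer θ q a ψ δ j z u) (n := i) hCQ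
    (c := fun u => (θ : ℂ) ^ u) (h.resWeight_nonneg' hδ)
    (fun j _ => h.exists_norm_barKer_le hδ hθδ j (v j))
    (fun j _ z => h.isPolyLT_barKer hδ j z) i le_rfl
  obtain ⟨C, hC⟩ := h.exists_norm_hrec_le (ψ := ψ) hδ hθδ v j
  have k1 := ((key (j + 1) (v j + 1)).const_mul (θ : ℂ)⁻¹).sub (key (j + 1) (v j))
  have k2 := IsPolyLT.tsum (f := fun b u => Aker θ q (v j) b * ((θ : ℂ) ^ u *
      hrec (Qker θ q) v (fun j z => barKer θ q a ψ δ j z u) j b))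
    (fun b => ((key j b).mono (by omega : j ≤ j + 1)).const_mul _) fun u =>
      ((hCA.summable_mul (hC u) (v j)).mul_left ((θ : ℂ) ^ u)).congr fun b => by ring
  convert! k1.sub k2 using 2 with u
  simp only [jump, tdiff, kact]
  have : ∀ b, Aker θ q (v j) b * ((θ : ℂ) ^ u *
      hrec (Qker θ q) v (fun j z => barKer θ q a ψ δ j z u) j b) = (θ : ℂ) ^ u *
      (Aker θ q (v j) b * hrec (Qker θ q) v (fun j z => barKer θ q a ψ δ j z u) j b) :=
    fun b => by ring
  simp only [this]
  rw [tsum_mul_left]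
  ring

/-- This identifies the jumps with the biorthogonal functions, with the barrier read backwards: time
j of the recursion corresponds to `y (n - j)`. -/
theorem isBiorth_jump (h : Model κ θ q a ψ r R) (hδ : GoodRadius r R δ) (hθδ : θ < 1 - δ)
    {y : ℕ → ℤ} {N n : ℕ} (hn : n ≤ N)
    (hy : ∀ j : ℕ, 1 ≤ j → j + 1 ≤ N → (κ : ℤ) ≤ y j - y (j + 1)) {j : ℕ} (hj : j < n) :
    IsBiorth θ (Psi θ q a ψ r y) n j fun u =>
      jump θ q (fun i => y (n - i)) (fun j z => barKer θ q a ψ δ j z u) j := by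
  obtain ⟨p, hp, hpe⟩ := h.isPolyLT_jump (ψ := ψ) hδ hθδ (fun i => y (n - i)) j
  refine h.isBiorth_of_natDegree_le hj (natDegree_le_iff_degree_le.mpr (degree_le_of_lt_succ hp))
    hpe fun l hl => ?_
  have hv : ∀ i, i + 1 < n → y (n - i) + κ ≤ y (n - (i + 1)) := fun i hi => by
    have := hy (n - (i + 1)) (by omega) (by omega)
    rw [show n - (i + 1) + 1 = n - i by omega] at this
    linarith
  have e : ((n : ℤ) - l).toNat = n - l := by omega
  have k := h.hasSum_Psi_jump hδ hθδ (fun i => y (n - i)) l j (y (n - l))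
  rw [h.jump_resKer hδ (v := fun i => y (n - i)) hv hl hj] at k
  simpa only [Psi, e] using k

theorem kact_RQpow_A_hrec (h : Model κ θ q a ψ r R) (hδ : GoodRadius r R δ) (hθδ : θ < 1 - δ)
    (hv : ∀ j, j + 1 < n → v j + κ ≤ v (j + 1)) (k x u : ℤ) :
    kact (comp (RQpow θ q a ψ r (-k)) (Aker θ q))
        (hrec (Qker θ q) v (fun j z => barKer θ q a ψ δ j z u) n) x =
      ∑ j ∈ Finset.range n, RQpow θ q a ψ r (-(k - n + j)) x (v j) *
        jump θ q v (fun j z => barKer θ q a ψ δ j z u) j := by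
  obtain ⟨CQ, hCQ⟩ := h.exists_rowSummable_Q
  refine h.kact_RQpow_A_telescope (f := hrec (Qker θ q) v fun j z => barKer θ q a ψ δ j z u)
    rfl n (fun j _ => ?_) (fun j hj z => ?_) k x
  · obtain ⟨C, hC⟩ := h.exists_norm_hrec_le (ψ := ψ) hδ hθδ v j
    exact ⟨_, hC u⟩
  · split_ifs with hz
    · rw [hz, jump]
      ring
    · rw [add_zero]
      refine tdiff_hrec hCQ h.Aker_eq_tdiff (fun z b => h.Aker_eq_zero) hv (fun j _ => ?_)
        (fun z => h.tdiff_barKer_zero hδ z u) (fun j z => h.tdiff_barKer_succ hδ j z u) hj hz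
      obtain ⟨C, hC⟩ := h.exists_norm_barKer_le (ψ := ψ) hδ hθδ j (v j)
      exact ⟨_, hC u⟩

end jump

end Model

end

end EpiKernel

namespace EpiKernel

open MeasureTheory

noncomputable section

/-! ### The random walk -/

/-- The trajectory that follows `x` up to time `k` and is equal to `c` afterwards. -/
def extendPath {k : ℕ} (x : Fin (k + 1) → ℤ) (c : ℤ) (i : ℕ) : ℤ :=
  if h : i < k + 1 then x ⟨i, h⟩ else c

/-- `F` depends only on the coordinates up to time `k`. -/
def DependsUpTo (k : ℕ) (F : (ℕ → ℤ) → ℂ) : Prop :=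
  ∀ b b' : ℕ → ℤ, (∀ i ≤ k, b i = b' i) → F b = F b'

theorem integral_eq_tsum_of_countable {Ω α : Type*} [MeasurableSpace Ω] [MeasurableSpace α]
    [Countable α] [MeasurableSingletonClass α] {μ : Measure Ω} [IsProbabilityMeasure μ] {X : Ω → α}
    (hX : Measurable X) {g : α → ℂ} {M : ℝ} (hg : ∀ x, ‖g x‖ ≤ M) :
    HasSum (fun x => (μ.real {ω | X ω = x} : ℂ) * g x) (∫ ω, g (X ω) ∂μ) := by
  have hprob : IsProbabilityMeasure (μ.map X) := Measure.isProbabilityMeasure_map hX.aemeasurable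
  have hgm : Measurable g := measurable_of_countable g
  have hint : Integrable g (μ.map X) :=
    Integrable.of_bound hgm.aestronglyMeasurable M (.of_forall hg)
  have hreal : ∀ x, (μ.map X).real {x} = μ.real {ω | X ω = x} := fun x => by
    rw [map_measureReal_apply hX (measurableSet_singleton x)]
    rfl
  have hsum : Summable fun x => ((μ.map X).real {x} : ℂ) * g x := by
    have h1 : Summable fun x => (μ.map X).real {x} := by
      have := (integrable_const (μ := μ.map X) (1 : ℝ))
      simpa [Measure.real] using (hasSum_integral_measure (μ := fun x : α => (μ.map X) {x} • Measure.dirac x)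
        (f := fun _ => (1 : ℝ)) (by rwa [Measure.sum_smul_dirac])).summable
    refine Summable.of_norm_bounded (h1.mul_right M) fun x => ?_
    rw [norm_mul, Complex.norm_real, Real.norm_of_nonneg measureReal_nonneg]
    exact mul_le_mul_of_nonneg_left (hg x) measureReal_nonneg
  rw [← integral_map hX.aemeasurable hgm.aestronglyMeasurable, integral_countable hint]
  simp only [Complex.real_smul]
  simp only [← hreal]
  exact hsum.hasSum

namespace IsWalk

variable {Ω : Type*} [MeasurableSpace Ω] {p : ℤ → ℤ → ℝ} {P : ℤ → Measure Ω} {B : ℕ → Ω → ℤ}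

theorem measurable_path (hB : IsWalk p P B) (k : ℕ) :
    Measurable fun ω => fun i : Fin (k + 1) => B i ω :=
  measurable_pi_lambda _ fun i => hB.meas i

theorem measurable_comp (hB : IsWalk p P B) {k : ℕ} {F : (ℕ → ℤ) → ℂ} (hF : DependsUpTo k F) :
    Measurable fun ω => F fun m => B m ω := by
  have e : (fun ω => F fun m => B m ω) =
      (fun x : Fin (k + 1) → ℤ => F (extendPath x 0)) ∘ fun ω => fun i : Fin (k + 1) => B i ω := by
    funext ω
    refine hF _ _ fun i hi => ?_
    rw [extendPath, dif_pos (by omega)]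
  rw [e]
  exact (measurable_of_countable _).comp (hB.measurable_path k)

theorem integrable_comp (hB : IsWalk p P B) {k : ℕ} {F : (ℕ → ℤ) → ℂ} (hF : DependsUpTo k F)
    {M : ℝ} (hM : ∀ b, ‖F b‖ ≤ M) (z : ℤ) : Integrable (fun ω => F fun m => B m ω) (P z) := by
  have := hB.prob z
  exact Integrable.of_bound (hB.measurable_comp hF).aestronglyMeasurable M (.of_forall fun ω => hM _)

theorem real_path_eq (hB : IsWalk p P B) (z : ℤ) (k : ℕ) (x : Fin (k + 1) → ℤ) (c : ℤ) :
    (P z).real {ω | (fun i : Fin (k + 1) => B i ω) = x} =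
      if x 0 = z then ∏ i ∈ Finset.range k, p (extendPath x c i) (extendPath x c (i + 1)) else 0 := by
  have e : {ω | (fun i : Fin (k + 1) => B i ω) = x} = {ω | ∀ i ≤ k, B i ω = extendPath x c i} := by
    ext ω
    simp only [Set.mem_ofPred_eq, funext_iff, extendPath]
    constructor
    · intro h i hi
      rw [dif_pos (by omega)]
      exact h ⟨i, by omega⟩
    · intro h i
      have := h i (by omega)
      rwa [dif_pos i.2] at this
  rw [e, hB.law]
  simp only [extendPath]
  rfl

theorem real_path_succ_eq (hB : IsWalk p P B) (z : ℤ) (k : ℕ) (x : Fin (k + 1) → ℤ) (c : ℤ) :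
    (P z).real {ω | ((fun i : Fin (k + 1) => B i ω), B (k + 1) ω) = (x, c)} =
      (P z).real {ω | (fun i : Fin (k + 1) => B i ω) = x} * p (x (Fin.last k)) c := by
  have e : {ω | ((fun i : Fin (k + 1) => B i ω), B (k + 1) ω) = (x, c)} =
      {ω | ∀ i ≤ k + 1, B i ω = extendPath x c i} := by
    ext ω
    simp only [Set.mem_ofPred_eq, Prod.mk.injEq, funext_iff, extendPath]
    constructor
    · rintro ⟨h, hc⟩ i hi
      split_ifs with hik
      · exact h ⟨i, hik⟩
      · rw [show i = k + 1 by omega, hc]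
    · intro h
      refine ⟨fun i => ?_, ?_⟩
      · have := h i (by omega)
        rwa [dif_pos i.2] at this
      · have := h (k + 1) le_rfl
        rwa [dif_neg (by omega)] at this
  rw [e, hB.law, hB.real_path_eq z k x c, Finset.prod_range_succ, ite_mul, zero_mul]
  have h1 : extendPath x c k = x (Fin.last k) := by
    rw [extendPath, dif_pos (by omega)]
    rfl
  have h2 : extendPath x c (k + 1) = c := by
    rw [extendPath, dif_neg (by omega)]
  rw [h1, h2]
  rfl

/-- The Markov property. -/
theorem integral_mul_next (hB : IsWalk p P B) {C : ℝ}
    (hp : RowSummable (fun x y => (p x y : ℂ)) C) {k : ℕ} {F : (ℕ → ℤ) → ℂ} (hF : DependsUpTo k F)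
    {M M' : ℝ} (hM : ∀ b, ‖F b‖ ≤ M) {f : ℤ → ℂ} (hf : ∀ x, ‖f x‖ ≤ M') (z : ℤ) :
    ∫ ω, F (fun m => B m ω) * f (B (k + 1) ω) ∂(P z) =
      ∫ ω, F (fun m => B m ω) * kact (fun x y => (p x y : ℂ)) f (B k ω) ∂(P z) := by
  have := hB.prob z
  have hM0 : 0 ≤ M := (norm_nonneg _).trans (hM 0)
  have hFe : ∀ ω, F (fun m => B m ω) = F (extendPath (fun i : Fin (k + 1) => B i ω) 0) := fun ω =>
    hF _ _ fun i hi => by rw [extendPath, dif_pos (by omega)]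
  -- Both expectations are sums over the countable set of finite paths. The probability of a path
  -- extended by one step is that of the path times a transition probability, and the sum over the
  -- last step is the action of the kernel.
  have h1 := integral_eq_tsum_of_countable (μ := P z) ((hB.measurable_path k).prodMk
    (hB.meas (k + 1))) (g := fun x => F (extendPath x.1 0) * f x.2) (M := M * M') fun x => by
      rw [norm_mul]
      exact mul_le_mul (hM _) (hf _) (norm_nonneg _) hM0
  have h2 := integral_eq_tsum_of_countable (μ := P z) (hB.measurable_path k)
    (g := fun x => F (extendPath x 0) * kact (fun x y => (p x y : ℂ)) f (x (Fin.last k)))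
    (M := M * (C * M')) fun x => by
      rw [norm_mul]
      exact mul_le_mul (hM _) (hp.norm_kact_le hf _) (norm_nonneg _) hM0
  have e1 : ∫ ω, F (fun m => B m ω) * f (B (k + 1) ω) ∂(P z) = _ :=
    (integral_congr_ae (.of_forall fun ω => by rw [hFe])).trans h1.tsum_eq.symm
  have e2 : ∫ ω, F (fun m => B m ω) * kact (fun x y => (p x y : ℂ)) f (B k ω) ∂(P z) = _ :=
    (integral_congr_ae (.of_forall fun ω => by simp only [hFe]; rfl)).trans h2.tsum_eq.symm
  rw [e1, e2, h1.summable.tsum_prod]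
  refine tsum_congr fun x => ?_
  rw [kact, ← tsum_mul_left, ← tsum_mul_left]
  refine tsum_congr fun c => ?_
  rw [hB.real_path_succ_eq]
  push_cast
  ring

theorem integral_zero (hB : IsWalk p P B) (f : ℤ → ℂ) (z : ℤ) :
    ∫ ω, f (B 0 ω) ∂(P z) = f z := by
  have := hB.prob z
  have h1 := hB.law z 0 fun _ => z
  simp only [nonpos_iff_eq_zero, forall_eq, if_true, Finset.range_zero, Finset.prod_empty] at h1
  have hms : MeasurableSet {ω | B 0 ω = z} := hB.meas 0 (measurableSet_singleton z)
  have h2 : ∀ᵐ ω ∂(P z), B 0 ω = z := by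
    exact (mem_ae_iff_prob_eq_one hms).mpr ((ENNReal.toReal_eq_one_iff _).mp h1)
  rw [integral_congr_ae (g := fun _ => f z) (h2.mono fun ω hω => by simp only [hω])]
  simp

end IsWalk

/-! ### The hitting time -/

/-- The trajectory stays below the barrier before time `m`. -/
def StaysBelow (y : ℕ → ℤ) (m : ℕ) (b : ℕ → ℤ) : Prop := ∀ i < m, b i ≤ y (i + 1)

open Classical in
/-- The contribution of `{τ = m}` to the expectation. -/
def hitTerm (S : ℕ → ℤ → ℤ → ℂ) (y : ℕ → ℤ) (n : ℕ) (z₂ : ℤ) (m : ℕ) (b : ℕ → ℤ) : ℂ :=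
  if StaysBelow y m b ∧ y (m + 1) < b m then S (n - m) (b m) z₂ else 0

theorem epiIntegrand_eq_sum (S : ℕ → ℤ → ℤ → ℂ) (y : ℕ → ℤ) (n : ℕ) (z₂ : ℤ) (b : ℕ → ℤ) :
    epiIntegrand S y n z₂ b = ∑ m ∈ Finset.range n, hitTerm S y n z₂ m b := by
  classical
  by_cases hex : ∃ m, m < n ∧ y (m + 1) < b m
  · set k := Nat.find hex with hk
    obtain ⟨hkn, hkb⟩ := Nat.find_spec hex
    have hmin : ∀ i < k, b i ≤ y (i + 1) := fun i hi => by
      have := Nat.find_min hex hi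
      push Not at this
      exact this (hi.trans hkn)
    have hτ : hitTime y n b = (k : ℕ∞) := by
      refine le_antisymm (iInf₂_le k ⟨hkn, hkb⟩) (le_iInf₂ fun m hm => ?_)
      exact_mod_cast Nat.find_min' hex hm
    rw [epiIntegrand, hτ, if_pos (by exact_mod_cast hkn), Finset.sum_eq_single k]
    · rw [hitTerm, if_pos ⟨hmin, hkb⟩, ENat.toNat_natCast]
    · intro m hm hne
      rw [hitTerm, if_neg]
      rintro ⟨h1, h2⟩
      rcases hne.lt_or_gt with hlt | hgt
      · exact absurd h2 (not_lt.mpr (hmin m hlt))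
      · exact absurd hkb (not_lt.mpr (h1 k hgt))
    · exact fun hk' => absurd (Finset.mem_range.mpr hkn) hk'
  · have hτ : hitTime y n b = ⊤ := by
      simp only [hitTime, iInf_eq_top]
      exact fun m hm => absurd ⟨m, hm⟩ hex
    rw [epiIntegrand, hτ, if_neg (by simp), Finset.sum_eq_zero]
    intro m hm
    rw [hitTerm, if_neg]
    exact fun h => hex ⟨m, Finset.mem_range.mp hm, h.2⟩

theorem dependsUpTo_hitTerm (S : ℕ → ℤ → ℤ → ℂ) (y : ℕ → ℤ) (n : ℕ) (z₂ : ℤ) (m : ℕ) :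
    DependsUpTo m (hitTerm S y n z₂ m) := by
  intro b b' h
  have h1 : StaysBelow y m b ↔ StaysBelow y m b' :=
    forall₂_congr fun i hi => by rw [h i hi.le]
  classical
  exact if_congr (by rw [h m le_rfl, h1]) (by rw [h m le_rfl]) rfl

theorem norm_hitTerm_le {S : ℕ → ℤ → ℤ → ℂ} {y : ℕ → ℤ} {n : ℕ} {z₂ : ℤ} {m : ℕ} {M : ℝ}
    (hM0 : 0 ≤ M) (hM : ∀ z, y (m + 1) < z → ‖S (n - m) z z₂‖ ≤ M) (b : ℕ → ℤ) :
    ‖hitTerm S y n z₂ m b‖ ≤ M := by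
  rw [hitTerm]
  split_ifs with h
  · exact hM _ h.2
  · simpa using hM0

namespace IsWalk

variable {Ω : Type*} [MeasurableSpace Ω] {p : ℤ → ℤ → ℝ} {P : ℤ → Measure Ω} {B : ℕ → Ω → ℤ}
  {S : ℕ → ℤ → ℤ → ℂ} {y : ℕ → ℤ} {n : ℕ} {z₂ : ℤ}

theorem integrable_hitTerm (hB : IsWalk p P B) {m : ℕ}
    (hS : ∃ M, ∀ z, y (m + 1) < z → ‖S (n - m) z z₂‖ ≤ M) (z : ℤ) :
    Integrable (fun ω => hitTerm S y n z₂ m fun i => B i ω) (P z) := by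
  obtain ⟨M, hM⟩ := hS
  exact hB.integrable_comp (dependsUpTo_hitTerm S y n z₂ m)
    (norm_hitTerm_le (le_max_right M 0) fun z hz => (hM z hz).trans (le_max_left _ _)) z

theorem integrable_epiIntegrand (hB : IsWalk p P B)
    (hS : ∀ m < n, ∃ M, ∀ z, y (m + 1) < z → ‖S (n - m) z z₂‖ ≤ M) (z : ℤ) :
    Integrable (fun ω => epiIntegrand S y n z₂ fun i => B i ω) (P z) := by
  simp only [epiIntegrand_eq_sum]
  exact integrable_finsetSum _ fun m hm => hB.integrable_hitTerm (hS m (Finset.mem_range.mp hm)) z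

open Classical in
/-- The expectation over the hitting time solves the recursion. -/
theorem integral_epiIntegrand (hB : IsWalk p P B) {C : ℝ}
    (hp : RowSummable (fun x y => (p x y : ℂ)) C)
    (hS : ∀ m < n, ∃ M, ∀ z, y (m + 1) < z → ‖S (n - m) z z₂‖ ≤ M) (z : ℤ) :
    ∫ ω, epiIntegrand S y n z₂ (fun i => B i ω) ∂(P z) =
      hrec (fun x y => (p x y : ℂ)) (fun j => y (n - j)) (fun j x => S (j + 1) x z₂) n z := by
  set Q : ℤ → ℤ → ℂ := fun x y => (p x y : ℂ)
  set H := hrec Q (fun j => y (n - j)) (fun j x => S (j + 1) x z₂) with hH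
  have hbd : ∀ j ≤ n, ∃ M, ∀ z, ‖H j z‖ ≤ M := fun j hj => by
    obtain ⟨M, hM⟩ := hrec_bounded_family (ι := Unit) (S := fun _ j x => S (j + 1) x z₂) (n := n)
      (v := fun j => y (n - j)) hp (β := fun _ => 1) (fun _ => zero_le_one) (fun j hj => by
        obtain ⟨M, hM⟩ := hS (n - (j + 1)) (by omega)
        rw [show n - (j + 1) + 1 = n - j by omega, show n - (n - (j + 1)) = j + 1 by omega] at hM
        exact ⟨M, fun _ z hz => by simpa using hM z hz⟩) j hj
    exact ⟨M, fun z => by simpa using hM () z⟩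
  set alive : ℕ → (ℕ → ℤ) → ℂ := fun k b => if StaysBelow y k b then 1 else 0 with halive
  have hdep : ∀ k, DependsUpTo k (alive (k + 1)) := fun k b b' h => by
    have h1 : StaysBelow y (k + 1) b ↔ StaysBelow y (k + 1) b' :=
      forall₂_congr fun i hi => by rw [h i (by omega)]
    simp only [halive, h1]
  have hal1 : ∀ k b, ‖alive k b‖ ≤ 1 := fun k b => by
    simp only [halive]
    split_ifs <;> simp
  -- Invariant after k steps: what has been collected on {τ < k}, plus the recursion with n - k
  -- steps left, evaluated at B_k on the event that the barrier has not been crossed. At k = n the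
  -- last term vanishes because `H 0 = 0`.
  have key : ∀ k ≤ n, H n z = ∑ m ∈ Finset.range k,
      ∫ ω, hitTerm S y n z₂ m (fun i => B i ω) ∂(P z) +
        ∫ ω, alive k (fun i => B i ω) * H (n - k) (B k ω) ∂(P z) := by
    intro k
    induction k with
    | zero =>
      intro _
      have : ∀ b, alive 0 b = 1 := fun b => by simp [halive, StaysBelow]
      simp only [Finset.range_zero, Finset.sum_empty, zero_add, this, one_mul, Nat.sub_zero]
      rw [hB.integral_zero]
    | succ k ih =>
      intro hk
      rw [ih (by omega), Finset.sum_range_succ, add_assoc]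
      congr 1
      obtain ⟨j, hj⟩ : ∃ j, n - k = j + 1 := ⟨n - k - 1, by omega⟩
      have hj' : n - (k + 1) = j := by omega
      obtain ⟨M, hM⟩ := hbd j (by omega)
      -- At time k either b_k is above the barrier, which is the event τ = k, or the path stays
      -- alive and the recursion applies `Q`. Since alive at k + 1 depends on times up to k only,
      -- the Markov property replaces the action of `Q` by B_(k+1).
      have hsplit : ∀ b : ℕ → ℤ, alive k b * H (n - k) (b k) =
          hitTerm S y n z₂ k b + alive (k + 1) b * kact Q (H j) (b k) := by
        intro b
        have e1 : n - j = k + 1 := by omega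
        have hstay : StaysBelow y (k + 1) b ↔ StaysBelow y k b ∧ b k ≤ y (k + 1) :=
          Nat.forall_lt_succ_right
        rw [hj, hH]
        simp only [hrec, halive, hitTerm, hstay, e1, hj]
        by_cases h1 : StaysBelow y k b <;> by_cases h2 : y (k + 1) < b k
        · simp [h1, h2, not_le.mpr h2]
        · simp [h1, h2, not_lt.mp h2]
        · simp [h1]
        · simp [h1]
      rw [hj', hB.integral_mul_next hp (hdep k) (hal1 (k + 1)) hM,
        ← integral_add (hB.integrable_hitTerm (hS k (by omega)) z)]
      · exact integral_congr_ae (.of_forall fun ω => hsplit fun i => B i ω)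
      · refine hB.integrable_comp (k := k) (F := fun b => alive (k + 1) b * kact Q (H j) (b k))
          (fun b b' h => ?_) (M := 1 * (C * M)) (fun b => ?_) z
        · simp only [hdep k b b' h, h k le_rfl]
        · rw [norm_mul]
          exact mul_le_mul (hal1 _ _) (hp.norm_kact_le hM _) (norm_nonneg _) zero_le_one
  simp only [epiIntegrand_eq_sum]
  rw [key n le_rfl, integral_finsetSum _ fun m hm =>
    hB.integrable_hitTerm (hS m (Finset.mem_range.mp hm)) z]
  simp [hH, hrec]

end IsWalk

end

end EpiKernel

/-! ### ### The formula for the extended kernel -/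

namespace EpiKernel

open Metric Set MeasureTheory

noncomputable section

namespace Model

variable {κ : ℕ} {θ : ℝ} {q : ℤ → ℝ} {a ψ : ℂ → ℂ} {r R δ δ₀ : ℝ}
  {Ω : Type*} [MeasurableSpace Ω] {P : ℤ → Measure Ω} {B : ℕ → Ω → ℤ}

theorem exists_norm_Sbar_le (h : Model κ θ q a ψ r R) (hδ : GoodRadius r R δ) (hθδ : θ < 1 - δ)
    (hS : ∀ s, Sbar θ q a ψ δ₀ (s + 1) = barKer θ q a ψ δ s) (y : ℕ → ℤ) {n m : ℕ} (hm : m < n)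
    (z₂ : ℤ) : ∃ M, ∀ z, y (m + 1) < z → ‖Sbar θ q a ψ δ₀ (n - m) z z₂‖ ≤ M := by
  obtain ⟨C, hC⟩ := h.exists_norm_barKer_le (ψ := ψ) hδ hθδ (n - m - 1) (y (m + 1))
  refine ⟨C * resWeight θ δ z₂, fun z hz => ?_⟩
  rw [show n - m = n - m - 1 + 1 by omega, hS]
  exact hC z₂ z hz

theorem Sepi_eq_hrec (h : Model κ θ q a ψ r R) (hδ : GoodRadius r R δ) (hθδ : θ < 1 - δ)
    (hS : ∀ s, Sbar θ q a ψ δ₀ (s + 1) = barKer θ q a ψ δ s)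
    (hB : IsWalk (stepProb θ q) P B) (y : ℕ → ℤ) (n : ℕ) (z₁ z₂ : ℤ) :
    Sepi P B (Sbar θ q a ψ δ₀) y n z₁ z₂ =
      hrec (Qker θ q) (fun j => y (n - j)) (fun j z => barKer θ q a ψ δ j z z₂) n z₁ := by
  obtain ⟨C, hC⟩ := h.exists_rowSummable_Q
  have := hB.integral_epiIntegrand (S := Sbar θ q a ψ δ₀) (y := y) (n := n) (z₂ := z₂) hC
    (fun m hm => h.exists_norm_Sbar_le hδ hθδ hS y hm z₂) z₁
  simp only [hS] at this
  exact this

theorem Kext_formula (h : Model κ θ q a ψ r R) (hδ : GoodRadius r R δ) (hθδ : θ < 1 - δ)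
    (hS : ∀ s, Sbar θ q a ψ δ₀ (s + 1) = barKer θ q a ψ δ s) {N : ℕ} {y : ℕ → ℤ}
    (hy : ∀ j : ℕ, 1 ≤ j → j + 1 ≤ N → (κ : ℤ) ≤ y j - y (j + 1))
    (hB : IsWalk (stepProb θ q) P B) {Φ : ℕ → ℕ → ℤ → ℂ}
    (hΦ : ∀ n ∈ Finset.Icc 1 N, ∀ k < n, IsBiorth θ (Psi θ q a ψ r y) n k (Φ n k))
    {r' : ℝ} (hr' : r' ∈ Ico r 1) {ni nj : ℕ} (hnj : nj ∈ Finset.Icc 1 N) :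
    Composable (adj (Sneg θ q a ψ r' ni)) (Sepi P B (Sbar θ q a ψ δ₀) y nj) ∧
      ∀ xi xj : ℤ,
        Kext (Qker θ q) (Psi θ q a ψ r y) Φ ni xi nj xj =
          -(if ni < nj then kpow (Qker θ q) (nj - ni) xi xj else 0) +
            comp (adj (Sneg θ q a ψ r' ni)) (Sepi P B (Sbar θ q a ψ δ₀) y nj) xi xj := by
  have hN := (Finset.mem_Icc.mp hnj).2
  have hadj : adj (Sneg θ q a ψ r' ni) = comp (RQpow θ q a ψ r (-(ni : ℤ))) (Aker θ q) := by
    rw [h.Sneg_eq hr']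
    rfl
  have hE := h.Sepi_eq_hrec (ψ := ψ) hδ hθδ hS hB y nj
  constructor
  · intro x u
    obtain ⟨C, hC⟩ := h.exists_rowSummable_RQpow_A (ψ := ψ) ni
    obtain ⟨M, hM⟩ := h.exists_norm_hrec_le (ψ := ψ) hδ hθδ (fun j => y (nj - j)) nj
    rw [hadj]
    exact hC.summable_mul (f := fun z => Sepi P B (Sbar θ q a ψ δ₀) y nj z u)
      (fun z => by rw [hE]; exact hM u z) x
  · intro xi xj
    have hv : ∀ i, i + 1 < nj → y (nj - i) + κ ≤ y (nj - (i + 1)) := fun i hi => by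
      have := hy (nj - (i + 1)) (by omega) (by omega)
      rw [show nj - (i + 1) + 1 = nj - i by omega] at this
      linarith
    have hk := h.kact_RQpow_A_hrec (ψ := ψ) hδ hθδ (v := fun j => y (nj - j)) hv ni xi xj
    have hcomp : comp (adj (Sneg θ q a ψ r' ni)) (Sepi P B (Sbar θ q a ψ δ₀) y nj) xi xj =
        kact (comp (RQpow θ q a ψ r (-(ni : ℤ))) (Aker θ q))
          (hrec (Qker θ q) (fun j => y (nj - j)) (fun j z => barKer θ q a ψ δ j z xj) nj) xi := by
      rw [hadj]
      exact tsum_congr fun z => by rw [hE]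
    rw [hcomp, hk, Kext]
    congr 1
    -- The j-th jump sits at `y (nj - j)`, so it matches the summand k = nj - j of `Kext`.
    refine (Finset.sum_nbij' (fun j => nj - j) (fun k => nj - k) ?_ ?_ ?_ ?_ ?_).symm
    · intro j hj
      have := Finset.mem_range.mp hj
      rw [Finset.mem_Icc]
      omega
    · intro k hk
      have := Finset.mem_Icc.mp hk
      rw [Finset.mem_range]
      omega
    · intro j hj
      have := Finset.mem_range.mp hj
      omega
    · intro k hk
      have := Finset.mem_Icc.mp hk
      omega
    · intro j hj
      have hj' := Finset.mem_range.mp hj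
      have huniq := (h.existsUnique_biorth y hj').unique (h.isBiorth_jump hδ hθδ hN hy hj')
        (hΦ nj hnj j hj')
      have e1 : nj - (nj - j) = j := by omega
      have e2 : (ni : ℤ) - ((nj - j : ℕ) : ℤ) = ni - nj + j := by omega
      have e3 : ((ni : ℤ) - (ni - nj + j)).toNat = nj - j := by omega
      rw [e1, ← huniq, Psi, e2, e3]

end Model

end

end EpiKernel

theorem theorem5p9
    -- the weights
    (κ : ℕ) (θ : ℝ) (hθ0 : 0 < θ) (hθ1 : θ < 1)
    (q : ℤ → ℝ) (hq0 : ∀ i, 0 ≤ q i) (hq1 : ∀ i : ℤ, (κ : ℤ) < i → q i = 1)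
    (hqs : Summable fun i : ℤ => q i * θ ^ i)
    -- the function `a` is the sum of its Laurent series, and `ψ` is a complex function
    (a ψ : ℂ → ℂ)
    (ha : ∀ w : ℂ, θ ≤ ‖w‖ →
      HasSum (fun i : ℤ => ((q (i + 1) - q i : ℝ) : ℂ) * w ^ i) (a w))
    (r R : ℝ) (hr0 : 0 < r) (hrθ : r < θ) (hR : 1 < R)
    (ha_an : AnalyticOnNhd ℂ a {w | r ≤ ‖w‖})
    (ha_ne : ∀ w ∈ annulus r R, a w ≠ 0)
    (hψ_an : AnalyticOnNhd ℂ ψ (annulus r R))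
    (hψ_ne : ∀ w ∈ annulus r R, ψ w ≠ 0)
    -- the initial data `y 1, …, y N` (no other value of `y` enters)
    (N : ℕ) (y : ℕ → ℤ)
    (hy : ∀ j : ℕ, 1 ≤ j → j + 1 ≤ N → (κ : ℤ) ≤ y j - y (j + 1))
    -- the random walk with transition matrix `Q`
    {Ω : Type*} [MeasurableSpace Ω] (P : ℤ → MeasureTheory.Measure Ω) (B : ℕ → Ω → ℤ)
    (hB : IsWalk (stepProb θ q) P B) :
    -- the inverse kernels are inverses, and `Ψ` is well defined, with its contour formula
    (IsInverse (Qker θ q) (Qinv θ q a r) ∧ IsInverse (Aker θ q) (Ainv θ q a r) ∧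
      IsInverse (Rker θ ψ r) (Rinv θ ψ r)) ∧
    (∀ m : ℕ, Composable (kpow (Qker θ q) m) (Qker θ q) ∧
      Composable (kpow (Qinv θ q a r) m) (Qinv θ q a r) ∧
      Composable (kpow (Aker θ q) m) (Aker θ q)) ∧
    (∀ k : ℤ, Composable (Rker θ ψ r) (Qpow θ q a r (-k)) ∧
      RQpow θ q a ψ r (-k) =
        contourKer θ r fun w => ((alpha θ q : ℂ)⁻¹ * ((1 - w) / (w * a w))) ^ k * ψ w) ∧
    -- the biorthogonalization problem has a unique solution
    (∀ n ∈ Finset.Icc 1 N, ∀ k < n, ∃! φ : ℤ → ℂ, IsBiorth θ (Psi θ q a ψ r y) n k φ) ∧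
    -- `S_{-n} = (R Q^{-n} A)^*`, with any radius in `[r, 1)`
    (∀ n ∈ Finset.Icc 1 N, Composable (RQpow θ q a ψ r (-(n : ℤ))) (Aker θ q) ∧
      ∀ r' ∈ Set.Ico r 1,
        Sneg θ q a ψ r' n = adj (comp (RQpow θ q a ψ r (-(n : ℤ))) (Aker θ q))) ∧
    ∀ δ : ℝ, 0 < δ → δ < 1 →
      AnalyticOnNhd ℂ (fun w => a (1 - w)) (Metric.closedBall 0 δ) →
      AnalyticOnNhd ℂ (fun w => (ψ (1 - w))⁻¹) (Metric.closedBall 0 δ) →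
      -- `Sbar_n = Qbar^(n) R⁻¹ A⁻¹`
      (∀ n ∈ Finset.Icc 1 N, Composable (kpow (Aker θ q) n) (Qbar0 θ n) ∧
        Composable (Qbar θ q n) (Rinv θ ψ r) ∧
        Composable (comp (Qbar θ q n) (Rinv θ ψ r)) (Ainv θ q a r) ∧
        Sbar θ q a ψ δ n = comp (comp (Qbar θ q n) (Rinv θ ψ r)) (Ainv θ q a r)) ∧
      -- the expectation is well defined
      (∀ n ∈ Finset.Icc 1 N, ∀ z₁ z₂ : ℤ, MeasureTheory.Integrable
        (fun ω => epiIntegrand (Sbar θ q a ψ δ) y n z₂ (fun m => B m ω)) (P z₁)) ∧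
      -- the formula for the kernel, with any radius in `[r, 1)`
      ∀ Φ : ℕ → ℕ → ℤ → ℂ,
        (∀ n ∈ Finset.Icc 1 N, ∀ k < n, IsBiorth θ (Psi θ q a ψ r y) n k (Φ n k)) →
        ∀ r' ∈ Set.Ico r 1, ∀ ni ∈ Finset.Icc 1 N, ∀ nj ∈ Finset.Icc 1 N,
          Composable (adj (Sneg θ q a ψ r' ni)) (Sepi P B (Sbar θ q a ψ δ) y nj) ∧
          ∀ xi xj : ℤ,
            Kext (Qker θ q) (Psi θ q a ψ r y) Φ ni xi nj xj =
              -(if ni < nj then kpow (Qker θ q) (nj - ni) xi xj else 0) +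
                comp (adj (Sneg θ q a ψ r' ni)) (Sepi P B (Sbar θ q a ψ δ) y nj) xi xj := by
  have h : Model κ θ q a ψ r R :=
    ⟨hθ0, hθ1, hq0, hq1, hqs, ha, hr0, hrθ, hR, ha_an, ha_ne, hψ_an, hψ_ne⟩
  refine ⟨h.inverses, h.composable_kpow, fun k => ⟨h.composable_R_Qpow _, h.RQpow_eq k⟩,
    fun n _ k hk => h.existsUnique_biorth y hk,
    fun n _ => ⟨h.composable_RQpow_A _, fun r' hr' => h.Sneg_eq hr'⟩,
    fun δ₀ hδ₀ hδ₀1 haδ hψδ => ?_⟩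
  -- The given contour radius `δ₀` only enters the definition of `Sbar`; all estimates are made on
  -- the smaller circle of radius `δ`.
  obtain ⟨δ, hle, hθδ, hδ⟩ := h.exists_goodRadius hδ₀
  have hS : ∀ s, Sbar θ q a ψ δ₀ (s + 1) = Model.barKer θ q a ψ δ s :=
    fun s => h.Sbar_eq_resKer hδ hle hδ₀1 haδ hψδ s
  exact ⟨fun n hn => h.Sbar_factorization hδ₀ hδ₀1 haδ hψδ (Finset.mem_Icc.mp hn).1,
    fun n _ z₁ z₂ => hB.integrable_epiIntegrand
      (fun m hm => h.exists_norm_Sbar_le hδ hθδ hS y hm z₂) z₁,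
    fun Φ hΦ r' hr' ni _ nj hnj => h.Kext_formula hδ hθδ hS hy hB hΦ hr' hnj⟩
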